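/- Let $m\ge 1$ be an integer and let $a_{i,n},d_{i,n}$ ($0\le i\le m$) and $b_{j,n},c_{j,n}$ ($1\le j\le m$), $n\in\mathbb Z$, be complex numbers such that, for every $n$, the $4m+2$ numbers $a_{i,n},d_{i,n},b_{j,n},c_{j,n}$ are pairwise distinct. Suppose that the confinement conditions hold for all $n$, $i$, $k$: $$a_{i,n+1}=-d_{i,n},\qquad d_{i,n+1}=-a_{i,n},$$ $$b_{k,n+1}=-c_{k,n-1}+\sum_{j=1}^m(b_{j,n}+c_{j,n})-\sum_{i=0}^m(a_{i,n}+d_{i,n}),$$ $$c_{k,n+1}=-b_{k,n-1}+\sum_{j=1}^m(b_{j,n}+c_{j,n})-\sum_{i=0}^m(a_{i,n}+d_{i,n}).$$ Let $\varphi_n:\mathbb P^1\times\mathbb P^1\dashrightarrow\mathbb P^1\times\mathbb P^1$ be the birational mapping over $\mathbb C$ given by $(x,y)\mapsto(\bar x,\bar y)$, $$\bar x=-x+\frac{\prod_{i=0}^m(x-a_{i,n})(x-d_{i,n})}{(x+y)\prod_{j=1}^m(x-b_{j,n})(x-c_{j,n})},\qquad \bar y=x .$$ Let $\pi_n:X_n\to\mathbb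 P^1\times\mathbb P^1$ be the blow-up at the following $6m+2$ distinct points: $(x,y)=(a_{i,n},-a_{i,n})$ and $(d_{i,n},-d_{i,n})$ for $0\le i\le m$; and $(\infty,b_{j,n-1})$, $(\infty,c_{j,n-1})$, $(b_{j,n},\infty)$ and $(c_{j,n},\infty)$ for $1\le j\le m$. Denote the corresponding exceptional divisors by $A_i,E_i,B_j,C_j,\tilde B_j,\tilde C_j$ respectively. Let $\operatorname{Pic}(\mathcal X)$ be the free $\mathbb Z$-module on $\mathcal H_x,\mathcal H_y,\mathcal A_i,\mathcal E_i$ ($0\le i\le m$), $\mathcal B_j,\mathcal C_j,\tilde{\mathcal B}_j,\tilde{\mathcal C}_j$ ($1\le j\le m$), with the symmetric bilinear form for which $\mathcal H_x\cdot\mathcal H_y=1$, $\mathcal H_x\cdot\mathcal H_x=\mathcal H_y\cdot\mathcal H_y=0$, and the other generators have self-intersection $-1$ and are orthogonal to all other generators. Let $\iota_n:\operatorname{Pic}(\mathcal X)\to\operatorname{Pic}(X_n)$ be the homomorphism that sends $\mathcal H_x$ and $\mathcal H_y$ to the pullbacks under $\pi_n$ of the classes of the lines $x=\mathrm{const}$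 and $y=\mathrm{const}$, and sends $\mathcal A_i$ to $[A_i]$, $\mathcal E_i$ to $[E_i]$, and so on. Then every $\iota_n$ is an isomorphism, $\varphi_n$ lifts to an isomorphism $\tilde\varphi_n=\pi_{n+1}^{-1}\circ\varphi_n\circ\pi_n:X_n\to X_{n+1}$, and $\Phi=\iota_n^{-1}\circ\tilde\varphi_n^*\circ\iota_{n+1}$ is, for every $n$, the following automorphism of $\operatorname{Pic}(\mathcal X)$, which preserves the bilinear form: $$\mathcal H_x\mapsto(2m+1)\mathcal H_x+\mathcal H_y-\sum_{i=0}^m(\mathcal A_i+\mathcal E_i)-\sum_{j=1}^m(\tilde{\mathcal B}_j+\tilde{\mathcal C}_j),\qquad \mathcal H_y\mapsto\mathcal H_x,$$ $$\mathcal A_i\mapsto\mathcal H_x-\mathcal E_i,\quad \mathcal E_i\mapsto\mathcal H_x-\mathcal A_i,\quad \mathcal B_j\mapsto\mathcal H_x-\tilde{\mathcal B}_j,\quad \mathcal C_j\mapsto\mathcal H_x-\tilde{\mathcal C}_j,\quad \tilde{\mathcal B}_j\mapsto\mathcal C_j,\quad \tilde{\mathcal C}_j\mapsto\mathcal B_j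 .$$ -/

import Mathlib

open scoped BigOperators

noncomputable section

namespace ClassIII

/-! ### Integral schemes with a given function field

An integral separated scheme of finite type over `ℂ` with function field `F` is described, as in
Zariski's language of models, by the set of the local rings of its points, each of which is a local
subring of `F`.  Two local rings are related by a morphism exactly when one dominates the other
(the order `≤` on `LocalSubring F`), and the Zariski topology is the one in which the domain of
regularity of every rational function is open. -/

/-- The Zariski topology: the sets `{R | s ∈ R}`, for `s` in the function field, form a subbasis
of open sets. -/
instance zariskiTopology {F : Type*} [Field F] : TopologicalSpace (LocalSubring F) :=
  TopologicalSpace.generateFrom (Set.range fun s : F => {R : LocalSubring F | s ∈ R.toSubring})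

/-- The points of `Spec A` for a subring `A` of `F`: the localisations of `A` at its primes. -/
def specModel {F : Type*} [Field F] (A : Subring F) : Set (LocalSubring F) :=
  {R | ∃ (p : Ideal A) (_ : p.IsPrime), R = LocalSubring.ofPrime A p}

/-- The rational function `u` is regular at the point with local ring `R` and takes the value `0`
there. -/
def Vanishes {F : Type*} [Field F] (R : LocalSubring F) (u : F) : Prop :=
  ∃ h : u ∈ R.toSubring, (⟨u, h⟩ : R.toSubring) ∈ IsLocalRing.maximalIdeal R.toSubring

/-- Morphisms `X ⟶ Y` over `ℂ` which induce `σ` (pullback of rational functions) on the function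
fields: a continuous map `f` of the points such that, for every point `P` of `X`, the map `σ` sends
the local ring of `Y` at `f P` into the local ring of `X` at `P` by a local homomorphism. -/
structure Hom {F G : Type*} [Field F] [Field G] [Algebra ℂ F] [Algebra ℂ G] (σ : G →ₐ[ℂ] F)
    (X : Set (LocalSubring F)) (Y : Set (LocalSubring G)) where
  /-- the map on points -/
  toFun : X → Y
  continuous_toFun : Continuous toFun
  map_le : ∀ P : X, (toFun P).1.map (σ : G →+* F) ≤ P.1

/-- A morphism `f : X ⟶ Y` is an isomorphism if it has a two-sided inverse morphism. -/
def Hom.IsIso {F G : Type*} [Field F] [Field G] [Algebra ℂ F] [Algebra ℂ G] {σ : G ≃ₐ[ℂ] F}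
    {X : Set (LocalSubring F)} {Y : Set (LocalSubring G)} (f : Hom (σ : G →ₐ[ℂ] F) X Y) : Prop :=
  ∃ g : Hom (σ.symm : F →ₐ[ℂ] G) Y X,
    Function.LeftInverse g.toFun f.toFun ∧ Function.RightInverse g.toFun f.toFun

/-! ### Cartier divisors and the Picard group -/

/-- The units `R^×` of a local subring, as a subgroup of `F^×`. -/
abbrev unitsAt {F : Type*} [Field F] (R : LocalSubring F) : Subgroup Fˣ :=
  R.toSubring.toSubmonoid.units

/-- Families of classes in `F^× / 𝒪_{X,P}^×`, one for every point `P` of `X`. -/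
def Stalks {F : Type*} [Field F] (X : Set (LocalSubring F)) :=
  ∀ P : X, Fˣ ⧸ unitsAt P.1

instance {F : Type*} [Field F] (X : Set (LocalSubring F)) : CommGroup (Stalks X) :=
  inferInstanceAs (CommGroup (∀ P : X, Fˣ ⧸ unitsAt P.1))

/-- Cartier divisors on `X`, i.e. global sections of `F^× / 𝒪_X^×` (written multiplicatively): a
class in `F^× / 𝒪_{X,P}^×` for every point `P`, given locally by one rational function (its local
equation). -/
def CaDiv {F : Type*} [Field F] (X : Set (LocalSubring F)) :
    Subgroup (Stalks X) where
  carrier := {D | ∀ P : X, ∃ U : Set X, IsOpen U ∧ P ∈ U ∧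
    ∃ f : Fˣ, ∀ Q ∈ U, D Q = QuotientGroup.mk f}
  one_mem' := fun _ => ⟨Set.univ, isOpen_univ, trivial, 1, fun _ _ => rfl⟩
  mul_mem' := by
    intro D E hD hE P
    obtain ⟨U, hU, hPU, f, hf⟩ := hD P
    obtain ⟨V, hV, hPV, g, hg⟩ := hE P
    refine ⟨U ∩ V, hU.inter hV, ⟨hPU, hPV⟩, f * g, fun Q hQ => ?_⟩
    exact congrArg₂ (· * ·) (hf Q hQ.1) (hg Q hQ.2)
  inv_mem' := by
    intro D hD P
    obtain ⟨U, hU, hPU, f, hf⟩ := hD P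
    refine ⟨U, hU, hPU, f⁻¹, fun Q hQ => ?_⟩
    exact congrArg (·⁻¹) (hf Q hQ)

/-- The principal Cartier divisor of a rational function. -/
def principal {F : Type*} [Field F] (X : Set (LocalSubring F)) : Fˣ →* CaDiv X where
  toFun f := ⟨fun _ => QuotientGroup.mk f,
    fun _ => ⟨Set.univ, isOpen_univ, trivial, f, fun _ _ => rfl⟩⟩
  map_one' := rfl
  map_mul' _ _ := rfl

/-- The Picard group of the integral scheme `X`: Cartier divisors modulo principal ones. -/
def Pic {F : Type*} [Field F] (X : Set (LocalSubring F)) :=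
  CaDiv X ⧸ (principal X).range

instance {F : Type*} [Field F] (X : Set (LocalSubring F)) : CommGroup (Pic X) :=
  inferInstanceAs (CommGroup (CaDiv X ⧸ (principal X).range))

/-- The class of a Cartier divisor in the Picard group. -/
def Pic.mk {F : Type*} [Field F] {X : Set (LocalSubring F)} : CaDiv X →* Pic X :=
  QuotientGroup.mk' (principal X).range

section pullback

variable {F G : Type*} [Field F] [Field G] [Algebra ℂ F] [Algebra ℂ G] {σ : G →ₐ[ℂ] F}
  {X : Set (LocalSubring F)} {Y : Set (LocalSubring G)}

theorem Hom.unitsAt_le (f : Hom σ X Y) (P : X) :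
    unitsAt (f.toFun P).1 ≤ (unitsAt P.1).comap (Units.map (σ : G →* F)) := by
  intro z hz
  have h := (f.map_le P).1
  rw [Submonoid.mem_units_iff] at hz
  rw [Subgroup.mem_comap, Submonoid.mem_units_iff]
  exact ⟨h ⟨_, hz.1, rfl⟩, h ⟨_, hz.2, rfl⟩⟩

/-- The map `G^× / 𝒪_{Y,f(P)}^× → F^× / 𝒪_{X,P}^×` induced by `σ`. -/
def Hom.stalkMap (f : Hom σ X Y) (P : X) : Gˣ ⧸ unitsAt (f.toFun P).1 →* Fˣ ⧸ unitsAt P.1 :=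
  QuotientGroup.map _ _ (Units.map (σ : G →* F)) (f.unitsAt_le P)

/-- The pullback of Cartier divisors along a morphism: local equations are pulled back. -/
def Hom.pullbackDiv (f : Hom σ X Y) : CaDiv Y →* CaDiv X where
  toFun D := ⟨fun P => f.stalkMap P (D.1 (f.toFun P)), by
    intro P
    obtain ⟨U, hU, hPU, g, hg⟩ := D.2 (f.toFun P)
    refine ⟨f.toFun ⁻¹' U, hU.preimage f.continuous_toFun, hPU, Units.map (σ : G →* F) g,
      fun Q hQ => ?_⟩
    exact congrArg _ (hg _ hQ)⟩
  map_one' := Subtype.ext (funext fun P => map_one (f.stalkMap P))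
  map_mul' D E := Subtype.ext (funext fun P =>
    map_mul (f.stalkMap P) (D.1 (f.toFun P)) (E.1 (f.toFun P)))

/-- The pullback `f^* : Pic Y → Pic X` along a morphism. -/
def Hom.pullback (f : Hom σ X Y) : Pic Y →* Pic X :=
  QuotientGroup.map (principal Y).range (principal X).range f.pullbackDiv (by
    rintro _ ⟨g, rfl⟩
    exact ⟨Units.map (σ : G →* F) g, Subtype.ext rfl⟩)

end pullback

/-! ### The surface `ℙ¹ × ℙ¹` and its blow-ups -/

/-- The field `ℂ(x, y)`. -/
abbrev K : Type := FractionRing (MvPolynomial (Fin 2) ℂ)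

/-- The affine coordinate `x`. -/
def x : K := algebraMap (MvPolynomial (Fin 2) ℂ) K (MvPolynomial.X 0)

/-- The affine coordinate `y`. -/
def y : K := algebraMap (MvPolynomial (Fin 2) ℂ) K (MvPolynomial.X 1)

theorem x_ne_zero : x ≠ 0 := by
  unfold x
  simp

theorem y_ne_zero : y ≠ 0 := by
  unfold y
  simp

/-- `ℙ¹ × ℙ¹`, covered by the four affine planes with coordinates `(x, y)`, `(x⁻¹, y)`,
`(x, y⁻¹)`, `(x⁻¹, y⁻¹)`. -/
def P1P1 : Set (LocalSubring K) :=
  {R | ∃ s ∈ ({x, x⁻¹} : Set K), ∃ t ∈ ({y, y⁻¹} : Set K),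
    R ∈ specModel (Algebra.adjoin ℂ {s, t}).toSubring}

/-- The closed points of `ℙ¹ × ℙ¹`, given by their coordinates `(x, y)` in
`ℙ¹(ℂ) = ℂ ∪ {∞}`. -/
abbrev Pt : Type := OnePoint ℂ × OnePoint ℂ

/-- The local coordinate of `ℙ¹` (with affine coordinate `z`) that vanishes at a given point:
`z - α` at `α ∈ ℂ`, and `z⁻¹` at `∞`. -/
def localCoord (z : K) : OnePoint ℂ → K
  | none => z⁻¹
  | some α => z - algebraMap ℂ K α

/-- The local coordinate `u` of `ℙ¹ × ℙ¹` at a closed point. -/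
abbrev uAt (p : Pt) : K := localCoord x p.1

/-- The local coordinate `v` of `ℙ¹ × ℙ¹` at a closed point. -/
abbrev vAt (p : Pt) : K := localCoord y p.2

/-- The point with local ring `R` (of `ℙ¹ × ℙ¹` or of a blow-up of it) lies over the closed point
`p`: both local coordinates at `p` vanish there. -/
def LiesOver (R : LocalSubring K) (p : Pt) : Prop := Vanishes R (uAt p) ∧ Vanishes R (vAt p)

/-- The blow-up of `ℙ¹ × ℙ¹` at a set `Z` of closed points: outside of `Z` nothing is changed, and
the local ring `O` of a point of `Z`, with local coordinates `u`, `v`, is replaced by the points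
over the closed point of `Spec O` in the two charts `Spec O[u/v]` and `Spec O[v/u]` of the blow-up
of `Spec O` at the ideal `(u, v)`. -/
def blowUp (Z : Set Pt) : Set (LocalSubring K) :=
  {R | R ∈ P1P1 ∧ ∀ p ∈ Z, ¬ LiesOver R p} ∪
  {R | ∃ p ∈ Z, ∃ O ∈ P1P1, LiesOver O p ∧ O ≤ R ∧
    (R ∈ specModel (O.toSubring ⊔ Subring.closure {uAt p / vAt p}) ∨
     R ∈ specModel (O.toSubring ⊔ Subring.closure {vAt p / uAt p}))}

section helpers

theorem mem_ofPrime {F : Type*} [Field F] {A : Subring F} {p : Ideal A} [p.IsPrime] {r : F}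
    (h : r ∈ (LocalSubring.ofPrime A p).toSubring) :
    ∃ a ∈ A, ∃ g ∈ A, g⁻¹ ∈ (LocalSubring.ofPrime A p).toSubring ∧ r = a * g⁻¹ := by
  obtain ⟨⟨a, g⟩, hag⟩ := IsLocalization.surj (M := p.primeCompl)
    (⟨r, h⟩ : (LocalSubring.ofPrime A p).toSubring)
  have hu := IsLocalization.map_units (M := p.primeCompl)
    (LocalSubring.ofPrime A p).toSubring g
  obtain ⟨w, hw⟩ := hu.exists_right_inv
  have hw' : (g.1.1 : F) * w.1 = 1 := congrArg Subtype.val hw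
  have hr : r * (g.1.1 : F) = a.1 := congrArg Subtype.val hag
  have hg : (g.1.1 : F) ≠ 0 := left_ne_zero_of_mul_eq_one hw'
  refine ⟨a.1, a.2, g.1.1, g.1.2, ?_, ?_⟩
  · rw [← eq_inv_of_mul_eq_one_right hw']
    exact w.2
  · rw [← hr]
    field_simp

theorem inv_mem_of_le {F : Type*} [Field F] {O R : LocalSubring F} (h : O ≤ R) {w : F}
    (hw : w ∈ O.toSubring) (hw' : w⁻¹ ∈ R.toSubring) : w⁻¹ ∈ O.toSubring := by
  by_cases h0 : w = 0
  · simp [h0]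
  obtain ⟨hle, hloc⟩ := h
  have hu : IsUnit (Subring.inclusion hle ⟨w, hw⟩) :=
    IsUnit.of_mul_eq_one (⟨w⁻¹, hw'⟩ : R.toSubring) (Subtype.ext (mul_inv_cancel₀ h0))
  obtain ⟨v, hv⟩ := (hloc.map_nonunit _ hu).exists_right_inv
  have : w * v.1 = 1 := congrArg Subtype.val hv
  rw [← eq_inv_of_mul_eq_one_right this]
  exact v.2

theorem P1P1_x {R : LocalSubring K} (h : R ∈ P1P1) : x ∈ R.toSubring ∨ x⁻¹ ∈ R.toSubring := by
  obtain ⟨s, hs, t, -, p, hp, rfl⟩ := h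
  have : s ∈ (LocalSubring.ofPrime (Algebra.adjoin ℂ {s, t}).toSubring p).toSubring :=
    LocalSubring.le_ofPrime _ p (Algebra.subset_adjoin (by simp))
  rcases hs with rfl | rfl
  · exact Or.inl this
  · exact Or.inr this

theorem P1P1_y {R : LocalSubring K} (h : R ∈ P1P1) : y ∈ R.toSubring ∨ y⁻¹ ∈ R.toSubring := by
  obtain ⟨s, -, t, ht, p, hp, rfl⟩ := h
  have : t ∈ (LocalSubring.ofPrime (Algebra.adjoin ℂ {s, t}).toSubring p).toSubring :=
    LocalSubring.le_ofPrime _ p (Algebra.subset_adjoin (by simp))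
  rcases ht with rfl | rfl
  · exact Or.inl this
  · exact Or.inr this

theorem P1P1_const {R : LocalSubring K} (h : R ∈ P1P1) (α : ℂ) :
    algebraMap ℂ K α ∈ R.toSubring := by
  obtain ⟨s, -, t, -, p, hp, rfl⟩ := h
  exact LocalSubring.le_ofPrime _ p (Subalgebra.algebraMap_mem _ α)

theorem mem_of_le {z : K} {O R : LocalSubring K} (hO : z ∈ O.toSubring ∨ z⁻¹ ∈ O.toSubring)
    (h : O ≤ R) {w : K} (hw : w ∈ ({z, z⁻¹} : Set K)) (hR : w ∈ R.toSubring) :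
    w ∈ O.toSubring := by
  rcases hw with rfl | rfl
  · rcases hO with hO | hO
    · exact hO
    · simpa using inv_mem_of_le h hO (by simpa using hR)
  · rcases hO with hO | hO
    · exact inv_mem_of_le h hO hR
    · exact hO

theorem isOpen_mem {F : Type*} [Field F] (X : Set (LocalSubring F)) (s : F) :
    IsOpen {P : X | s ∈ P.1.toSubring} :=
  (TopologicalSpace.isOpen_generateFrom_of_mem ⟨s, rfl⟩ :
    IsOpen {R : LocalSubring F | s ∈ R.toSubring}).preimage continuous_subtype_val

/-- A map to `ℙ¹ × ℙ¹` under which every point dominates its image is continuous. -/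
theorem continuous_of_le {X : Set (LocalSubring K)} (f : X → P1P1) (hf : ∀ P, (f P).1 ≤ P.1) :
    Continuous f := by
  refine Continuous.subtype_mk (f := fun P => (f P).1) (continuous_generateFrom_iff.2 ?_) _
  rintro _ ⟨r, rfl⟩
  refine isOpen_iff_forall_mem_open.2 fun P hP => ?_
  obtain ⟨s, hs, t, ht, p, hp, hR⟩ := (f P).2
  have hP' : r ∈ (f P).1.toSubring := hP
  rw [hR] at hP'
  obtain ⟨a, ha, g, hg, hgi, rfl⟩ := mem_ofPrime hP'
  rw [← hR] at hgi
  have hA : (Algebra.adjoin ℂ {s, t}).toSubring ≤ (f P).1.toSubring := by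
    rw [hR]; exact LocalSubring.le_ofPrime _ p
  have hsP : s ∈ (f P).1.toSubring := hA (Algebra.subset_adjoin (by simp))
  have htP : t ∈ (f P).1.toSubring := hA (Algebra.subset_adjoin (by simp))
  refine ⟨{P | s ∈ P.1.toSubring} ∩ {P | t ∈ P.1.toSubring} ∩ {P | g⁻¹ ∈ P.1.toSubring},
    ?_, ((isOpen_mem X s).inter (isOpen_mem X t)).inter (isOpen_mem X _),
    ⟨(hf P).1 hsP, (hf P).1 htP⟩, (hf P).1 hgi⟩
  rintro Q ⟨⟨hsQ, htQ⟩, hgQ⟩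
  have h1 : s ∈ (f Q).1.toSubring := mem_of_le (P1P1_x (f Q).2) (hf Q) hs hsQ
  have h2 : t ∈ (f Q).1.toSubring := mem_of_le (P1P1_y (f Q).2) (hf Q) ht htQ
  have hAQ : ∀ w ∈ Algebra.adjoin ℂ {s, t}, w ∈ (f Q).1.toSubring := by
    intro w hw
    induction hw using Algebra.adjoin_induction with
    | mem w hw =>
      rcases hw with rfl | rfl
      · exact h1
      · exact h2
    | algebraMap α => exact P1P1_const (f Q).2 α
    | add _ _ _ _ h h' => exact add_mem h h'
    | mul _ _ _ _ h h' => exact mul_mem h h'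
  exact mul_mem (hAQ a ha) (inv_mem_of_le (hf Q) (hAQ g hg) hgQ)

theorem exists_le_of_mem_blowUp {Z : Set Pt} {R : LocalSubring K} (h : R ∈ blowUp Z) :
    ∃ O ∈ P1P1, O ≤ R := by
  rcases h with h | ⟨p, -, O, hO, -, h, -⟩
  · exact ⟨R, h.1, le_rfl⟩
  · exact ⟨O, hO, h⟩

theorem map_id_le {F : Type*} [Field F] [Algebra ℂ F] {O R : LocalSubring F} (h : O ≤ R) :
    O.map ((AlgHom.id ℂ F : F →ₐ[ℂ] F) : F →+* F) ≤ R := by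
  have : O.map ((AlgHom.id ℂ F : F →ₐ[ℂ] F) : F →+* F) = O :=
    LocalSubring.toSubring_injective (by ext; simp)
  rwa [this]

end helpers

/-- The blow-down morphism `π : blowUp Z ⟶ ℙ¹ × ℙ¹`: it is the identity on rational functions, and
every point dominates its image. -/
def blowDown (Z : Set Pt) : Hom (AlgHom.id ℂ K) (blowUp Z) P1P1 where
  toFun P := ⟨(exists_le_of_mem_blowUp P.2).choose, (exists_le_of_mem_blowUp P.2).choose_spec.1⟩
  continuous_toFun := continuous_of_le _ fun P => (exists_le_of_mem_blowUp P.2).choose_spec.2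
  map_le P := map_id_le (exists_le_of_mem_blowUp P.2).choose_spec.2

/-! ### Divisors -/

section helpers

theorem isUnit_iff_inv_mem {F : Type*} [Field F] (R : LocalSubring F) {u : F} (h0 : u ≠ 0)
    (h : u ∈ R.toSubring) : IsUnit (⟨u, h⟩ : R.toSubring) ↔ u⁻¹ ∈ R.toSubring := by
  constructor
  · intro hu
    obtain ⟨v, hv⟩ := hu.exists_right_inv
    have : u * v.1 = 1 := congrArg Subtype.val hv
    rw [← eq_inv_of_mul_eq_one_right this]
    exact v.2
  · intro hu
    exact IsUnit.of_mul_eq_one (⟨u⁻¹, hu⟩ : R.toSubring) (Subtype.ext (mul_inv_cancel₀ h0))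

theorem vanishes_iff {F : Type*} [Field F] {R : LocalSubring F} {u : F} (h0 : u ≠ 0) :
    Vanishes R u ↔ u ∈ R.toSubring ∧ u⁻¹ ∉ R.toSubring := by
  constructor
  · rintro ⟨h, hm⟩
    refine ⟨h, fun h' => ?_⟩
    exact (IsLocalRing.mem_maximalIdeal _).1 hm ((isUnit_iff_inv_mem R h0 h).2 h')
  · rintro ⟨h, h'⟩
    exact ⟨h, (IsLocalRing.mem_maximalIdeal _).2 fun hu => h' ((isUnit_iff_inv_mem R h0 h).1 hu)⟩

theorem Vanishes.sub {F : Type*} [Field F] {R : LocalSubring F} {u v : F} (hu : Vanishes R u)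
    (hv : Vanishes R v) : Vanishes R (u - v) :=
  ⟨sub_mem hu.1 hv.1, sub_mem hu.2 hv.2⟩

theorem Vanishes.mul {F : Type*} [Field F] {R : LocalSubring F} {u v : F} (hu : u ∈ R.toSubring)
    (hv : Vanishes R v) : Vanishes R (u * v) :=
  ⟨mul_mem hu hv.1, Ideal.mul_mem_left _ ⟨u, hu⟩ hv.2⟩

theorem Vanishes.mono {F : Type*} [Field F] {O R : LocalSubring F} (h : O ≤ R) {u : F}
    (hu : Vanishes O u) : Vanishes R u := by
  obtain ⟨hle, hloc⟩ := h
  refine ⟨hle hu.1, (IsLocalRing.mem_maximalIdeal _).2 fun h' => ?_⟩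
  exact (IsLocalRing.mem_maximalIdeal _).1 hu.2 (hloc.map_nonunit ⟨u, hu.1⟩ h')

theorem not_vanishes_one {F : Type*} [Field F] {R : LocalSubring F} : ¬ Vanishes R (1 : F) := by
  rw [vanishes_iff one_ne_zero]
  simp [one_mem]

theorem not_vanishes_const {R : LocalSubring K} (hR : ∀ α : ℂ, algebraMap ℂ K α ∈ R.toSubring)
    {α : ℂ} (h : α ≠ 0) : ¬ Vanishes R (algebraMap ℂ K α) := by
  rw [vanishes_iff (by simpa using h), ← map_inv₀]
  exact fun h' => h'.2 (hR _)

theorem localCoord_ne_zero {z : K} (hz : z = x ∨ z = y) (α : OnePoint ℂ) : localCoord z α ≠ 0 := by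
  match α with
  | none => rcases hz with rfl | rfl <;> simp [localCoord, x_ne_zero, y_ne_zero]
  | some α =>
    have key : ∀ i : Fin 2, algebraMap (MvPolynomial (Fin 2) ℂ) K (MvPolynomial.X i)
        - algebraMap ℂ K α ≠ 0 := by
      intro i h
      rw [sub_eq_zero, IsScalarTower.algebraMap_apply ℂ (MvPolynomial (Fin 2) ℂ) K,
        (IsFractionRing.injective (MvPolynomial (Fin 2) ℂ) K).eq_iff] at h
      have h1 := congrArg (MvPolynomial.eval fun _ => α + 1) h
      simp [MvPolynomial.algebraMap_eq] at h1
    rcases hz with rfl | rfl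
    · exact key 0
    · exact key 1

theorem localCoord_unique {R : LocalSubring K} (hR : ∀ α : ℂ, algebraMap ℂ K α ∈ R.toSubring)
    {z : K} (hz : z ≠ 0) {α β : OnePoint ℂ} (h : Vanishes R (localCoord z α))
    (h' : Vanishes R (localCoord z β)) : α = β := by
  have aux : ∀ β : ℂ, Vanishes R z⁻¹ → ¬ Vanishes R (z - algebraMap ℂ K β) := by
    intro β h h'
    have hmem : z ∈ R.toSubring := by
      simpa using add_mem h'.1 (hR β)
    apply not_vanishes_one (R := R)
    simpa [hz] using Vanishes.mul hmem h
  match α, β with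
  | none, none => rfl
  | none, some β => exact absurd h' (aux β h)
  | some α, none => exact absurd h (aux α h')
  | some α, some β =>
    by_contra hne
    have hne' : β - α ≠ 0 := fun h0 => hne (congrArg some (sub_eq_zero.1 h0).symm)
    apply not_vanishes_const hR hne'
    have := h.sub h'
    simpa [localCoord] using this

theorem localCoord_inv_mem {R : LocalSubring K} (hR : ∀ α : ℂ, algebraMap ℂ K α ∈ R.toSubring)
    {z : K} (hz : z ∈ R.toSubring ∨ z⁻¹ ∈ R.toSubring) (hz0 : z ≠ 0) {α : OnePoint ℂ}
    (h0 : localCoord z α ≠ 0)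
    (h : ¬ Vanishes R (localCoord z α)) : (localCoord z α)⁻¹ ∈ R.toSubring := by
  rw [vanishes_iff h0, not_and_or, not_not] at h
  rcases h with h | h
  · match α with
    | none =>
      have h : z⁻¹ ∉ R.toSubring := h
      have : (localCoord z none)⁻¹ = z := inv_inv z
      rw [this]
      tauto
    | some α =>
      have h : z - algebraMap ℂ K α ∉ R.toSubring := h
      have hz1 : z ∉ R.toSubring := fun h' => h (sub_mem h' (hR α))
      have hz2 : z⁻¹ ∈ R.toSubring := by tauto
      have hv : Vanishes R z⁻¹ := (vanishes_iff (inv_ne_zero hz0)).2 ⟨hz2, by simpa using hz1⟩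
      have hv' := Vanishes.mul (hR α) hv
      have h1 : 1 - algebraMap ℂ K α * z⁻¹ = z⁻¹ * (z - algebraMap ℂ K α) := by
        field_simp
      have hne : z - algebraMap ℂ K α ≠ 0 := h0
      have hnv : ¬ Vanishes R (1 - algebraMap ℂ K α * z⁻¹) := by
        intro h2
        apply not_vanishes_one (R := R)
        have h3 : Vanishes R ((1 - algebraMap ℂ K α * z⁻¹) - (-1) * (algebraMap ℂ K α * z⁻¹)) :=
          h2.sub (Vanishes.mul (neg_mem (one_mem _)) hv')
        simpa using h3
      have hw : 1 - algebraMap ℂ K α * z⁻¹ ≠ 0 := by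
        rw [h1]
        exact mul_ne_zero (inv_ne_zero hz0) hne
      rw [vanishes_iff hw, not_and_or, not_not] at hnv
      have hi : (1 - algebraMap ℂ K α * z⁻¹)⁻¹ ∈ R.toSubring :=
        hnv.resolve_left fun h' => h' (sub_mem (one_mem _) hv'.1)
      have : (localCoord z (some α))⁻¹ = z⁻¹ * (1 - algebraMap ℂ K α * z⁻¹)⁻¹ := by
        rw [h1]
        change (z - algebraMap ℂ K α)⁻¹ = _
        field_simp
      rw [this]
      exact mul_mem hz2 hi
  · exact h

theorem uAt_ne_zero (p : Pt) : uAt p ≠ 0 := localCoord_ne_zero (Or.inl rfl) _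

theorem vAt_ne_zero (p : Pt) : vAt p ≠ 0 := localCoord_ne_zero (Or.inr rfl) _

theorem blowUp_const {Z : Set Pt} {R : LocalSubring K} (h : R ∈ blowUp Z) (α : ℂ) :
    algebraMap ℂ K α ∈ R.toSubring := by
  obtain ⟨O, hO, hle⟩ := exists_le_of_mem_blowUp h
  exact hle.1 (P1P1_const hO α)

theorem div_mem_of_liesOver {Z : Set Pt} {p : Pt} (hp : p ∈ Z) {R : LocalSubring K}
    (h : R ∈ blowUp Z) (hl : LiesOver R p) :
    uAt p / vAt p ∈ R.toSubring ∨ vAt p / uAt p ∈ R.toSubring := by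
  have hc := blowUp_const h
  rcases h with h | ⟨q, hq, O, hO, hOq, hle, h⟩
  · exact absurd hl (h.2 p hp)
  · have hpq : p = q := Prod.ext
      (localCoord_unique hc x_ne_zero hl.1 (hOq.1.mono hle))
      (localCoord_unique hc y_ne_zero hl.2 (hOq.2.mono hle))
    subst hpq
    rcases h with ⟨P, hP, rfl⟩ | ⟨P, hP, rfl⟩
    · exact Or.inl (LocalSubring.le_ofPrime _ P
        ((le_sup_right : Subring.closure _ ≤ _) (Subring.subset_closure rfl)))
    · exact Or.inr (LocalSubring.le_ofPrime _ P
        ((le_sup_right : Subring.closure _ ≤ _) (Subring.subset_closure rfl)))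

end helpers

/-- The divisor `{z = ∞}` on `ℙ¹ × ℙ¹` for `z = x` or `z = y`: its local equation is `1` where `z`
is regular, and `z⁻¹` elsewhere. -/
def infDiv (z : Kˣ) (hz : ∀ R ∈ P1P1, (z : K) ∈ R.toSubring ∨ (z : K)⁻¹ ∈ R.toSubring) :
    CaDiv P1P1 :=
  open Classical in
  ⟨fun P => if (z : K) ∈ P.1.toSubring then QuotientGroup.mk 1 else QuotientGroup.mk z⁻¹, by
    intro P
    rcases hz P.1 P.2 with h | h
    · exact ⟨_, isOpen_mem _ (z : K), h, 1, fun Q hQ => if_pos hQ⟩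
    · refine ⟨_, isOpen_mem _ (z : K)⁻¹, h, z⁻¹, fun Q hQ => ?_⟩
      by_cases hQ' : (z : K) ∈ Q.1.toSubring
      · refine (if_pos hQ').trans (QuotientGroup.eq.2 ?_)
        rw [Submonoid.mem_units_iff]
        refine ⟨?_, ?_⟩
        · simpa using hQ
        · simpa using hQ'
      · exact if_neg hQ'⟩

/-- `𝒪_{ℙ¹}(1) ⊠ 𝒪` on `ℙ¹ × ℙ¹`: the class of the line `x = ∞`. -/
def lineX : Pic P1P1 := Pic.mk (infDiv (Units.mk0 x x_ne_zero) fun _ h => P1P1_x h)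

/-- `𝒪 ⊠ 𝒪_{ℙ¹}(1)` on `ℙ¹ × ℙ¹`: the class of the line `y = ∞`. -/
def lineY : Pic P1P1 := Pic.mk (infDiv (Units.mk0 y y_ne_zero) fun _ h => P1P1_y h)

/-- The exceptional divisor `π⁻¹(p)` over a point `p` that is blown up: over `p` its ideal sheaf
`(u, v) 𝒪` is generated by `v` where `u / v` is regular, and by `u` where `v / u` is regular; its
local equation is `1` at the points that do not lie over `p`. -/
def excDiv {Z : Set Pt} {p : Pt} (hp : p ∈ Z) : CaDiv (blowUp Z) :=
  open Classical in
  ⟨fun P =>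
    if LiesOver P.1 p then
      if uAt p / vAt p ∈ P.1.toSubring then QuotientGroup.mk (Units.mk0 (vAt p) (vAt_ne_zero p))
      else QuotientGroup.mk (Units.mk0 (uAt p) (uAt_ne_zero p))
    else 1, by
    have hu0 := uAt_ne_zero p
    have hv0 := vAt_ne_zero p
    have one_eq : ∀ (Q : blowUp Z) (w : K) (hw : w ≠ 0), w ∈ Q.1.toSubring → ¬ Vanishes Q.1 w →
        (1 : Kˣ ⧸ unitsAt Q.1) = QuotientGroup.mk (Units.mk0 w hw) := by
      intro Q w hw h h'
      rw [vanishes_iff hw, not_and_or, not_not] at h'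
      refine QuotientGroup.eq.2 ?_
      rw [Submonoid.mem_units_iff]
      exact ⟨by simpa using h, by simpa using h'.resolve_left fun h' => h' h⟩
    intro P
    by_cases hl : LiesOver P.1 p
    · rcases div_mem_of_liesOver hp P.2 hl with h | h
      · refine ⟨_, (isOpen_mem _ (uAt p / vAt p)).inter (isOpen_mem _ (vAt p)), ⟨h, hl.2.1⟩,
          Units.mk0 _ hv0, ?_⟩
        rintro Q ⟨hQ, hQ'⟩
        have hQ : uAt p / vAt p ∈ Q.1.toSubring := hQ
        by_cases hlQ : LiesOver Q.1 p
        · simp only [if_pos hlQ, if_pos hQ]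
        · simp only [if_neg hlQ]
          refine one_eq Q _ hv0 hQ' fun hv => hlQ ⟨?_, hv⟩
          have := Vanishes.mul hQ hv
          rwa [div_mul_cancel₀ _ hv0] at this
      · refine ⟨_, (isOpen_mem _ (vAt p / uAt p)).inter (isOpen_mem _ (uAt p)), ⟨h, hl.1.1⟩,
          Units.mk0 _ hu0, ?_⟩
        rintro Q ⟨hQ, hQ'⟩
        have hQ : vAt p / uAt p ∈ Q.1.toSubring := hQ
        by_cases hlQ : LiesOver Q.1 p
        · by_cases hQ2 : uAt p / vAt p ∈ Q.1.toSubring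
          · simp only [if_pos hlQ, if_pos hQ2]
            refine QuotientGroup.eq.2 ?_
            rw [Submonoid.mem_units_iff]
            refine ⟨?_, ?_⟩
            · simpa [div_eq_inv_mul] using hQ2
            · simpa [div_eq_inv_mul, mul_comm] using hQ
          · simp only [if_pos hlQ, if_neg hQ2]
        · simp only [if_neg hlQ]
          refine one_eq Q _ hu0 hQ' fun hu => hlQ ⟨hu, ?_⟩
          have := Vanishes.mul hQ hu
          rwa [div_mul_cancel₀ _ hu0] at this
    · obtain ⟨O, hO, hle⟩ := exists_le_of_mem_blowUp P.2
      have hc := blowUp_const P.2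
      have key : ∃ w : K, w⁻¹ ∈ P.1.toSubring ∧
          ∀ Q : blowUp Z, w⁻¹ ∈ Q.1.toSubring → ¬ LiesOver Q.1 p := by
        rw [LiesOver, not_and_or] at hl
        rcases hl with hl | hl
        · exact ⟨uAt p, localCoord_inv_mem hc ((P1P1_x hO).imp (fun h => hle.1 h) fun h => hle.1 h)
            x_ne_zero hu0 hl, fun Q hQ hlQ => ((vanishes_iff hu0).1 hlQ.1).2 hQ⟩
        · exact ⟨vAt p, localCoord_inv_mem hc ((P1P1_y hO).imp (fun h => hle.1 h) fun h => hle.1 h)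
            y_ne_zero hv0 hl, fun Q hQ hlQ => ((vanishes_iff hv0).1 hlQ.2).2 hQ⟩
      obtain ⟨w, hw, hQ⟩ := key
      exact ⟨_, isOpen_mem _ w⁻¹, hw, 1, fun Q hQ' => if_neg (hQ Q hQ')⟩⟩

/-! ### The mapping and its surfaces -/

section mapping

variable {m : ℕ}

/-- The parameters `a_i, d_i` (`i = 0, …, m`) and `b_j, c_j` (`j = 1, …, m`) at one value of `n`. -/
structure Params (m : ℕ) where
  a : Fin (m + 1) → ℂ
  d : Fin (m + 1) → ℂ
  b : Fin m → ℂ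
  c : Fin m → ℂ

/-- The function `x̄ = -x + ∏ (x - a_i) (x - d_i) / ((x + y) ∏ (x - b_j) (x - c_j))`. -/
def xBar (q : Params m) : K :=
  -x + (∏ i, (x - algebraMap ℂ K (q.a i)) * (x - algebraMap ℂ K (q.d i))) /
    ((x + y) * ∏ j, (x - algebraMap ℂ K (q.b j)) * (x - algebraMap ℂ K (q.c j)))

/-- Labels of the `6m + 2` points that are blown up. -/
inductive Center (m : ℕ)
  | A (i : Fin (m + 1))
  | E (i : Fin (m + 1))
  | B (j : Fin m)
  | C (j : Fin m)
  | Bt (j : Fin m)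
  | Ct (j : Fin m)
  deriving DecidableEq

/-- The points that are blown up, in terms of the parameters `q₀` at `n - 1` and `q` at `n`. -/
def center (q₀ q : Params m) : Center m → Pt
  | .A i => (some (q.a i), some (-q.a i))
  | .E i => (some (q.d i), some (-q.d i))
  | .B j => (none, some (q₀.b j))
  | .C j => (none, some (q₀.c j))
  | .Bt j => (some (q.b j), none)
  | .Ct j => (some (q.c j), none)

/-- The set of the points that are blown up to obtain `X_n`. -/
abbrev centers (q : ℤ → Params m) (n : ℤ) : Set Pt := Set.range (center (q (n - 1)) (q n))

/-- The surface `X_n`. -/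
abbrev surface (q : ℤ → Params m) (n : ℤ) : Set (LocalSubring K) := blowUp (centers q n)

/-- Labels of the generators of `Pic(𝒳)`. -/
inductive Gen (m : ℕ)
  | Hx
  | Hy
  | exc (p : Center m)

/-- The lattice `Pic(𝒳)`, free on `ℋ_x`, `ℋ_y` and the classes of the exceptional divisors. -/
abbrev PicLattice (m : ℕ) : Type := Gen m →₀ ℤ

section generators

/-- The generator `ℋ_x` of `Pic(𝒳)`. -/
abbrev Hx : PicLattice m := Finsupp.single .Hx 1
/-- The generator `ℋ_y` of `Pic(𝒳)`. -/
abbrev Hy : PicLattice m := Finsupp.single .Hy 1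
/-- The generators `𝒜_i` of `Pic(𝒳)`. -/
abbrev cA (i : Fin (m + 1)) : PicLattice m := Finsupp.single (.exc (.A i)) 1
/-- The generators `ℰ_i` of `Pic(𝒳)`. -/
abbrev cE (i : Fin (m + 1)) : PicLattice m := Finsupp.single (.exc (.E i)) 1
/-- The generators `ℬ_j` of `Pic(𝒳)`. -/
abbrev cB (j : Fin m) : PicLattice m := Finsupp.single (.exc (.B j)) 1
/-- The generators `𝒞_j` of `Pic(𝒳)`. -/
abbrev cC (j : Fin m) : PicLattice m := Finsupp.single (.exc (.C j)) 1
/-- The generators `ℬ̃_j` of `Pic(𝒳)`. -/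
abbrev cBt (j : Fin m) : PicLattice m := Finsupp.single (.exc (.Bt j)) 1
/-- The generators `𝒞̃_j` of `Pic(𝒳)`. -/
abbrev cCt (j : Fin m) : PicLattice m := Finsupp.single (.exc (.Ct j)) 1

end generators

/-- The linear map `ι_n : Pic(𝒳) → Pic(X_n)` which sends `ℋ_x`, `ℋ_y` to the pullbacks under
`π_n` of the classes of the lines `x = const` and `y = const`, and the other generators to the
classes of the exceptional divisors. -/
def iota (q : ℤ → Params m) (n : ℤ) : PicLattice m →ₗ[ℤ] Additive (Pic (surface q n)) :=
  Finsupp.linearCombination ℤ fun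
    | .Hx => Additive.ofMul ((blowDown (centers q n)).pullback lineX)
    | .Hy => Additive.ofMul ((blowDown (centers q n)).pullback lineY)
    | .exc p => Additive.ofMul (Pic.mk (excDiv (Set.mem_range_self p)))

/-- The intersection form on `Pic(𝒳)`: `ℋ_x · ℋ_y = 1`, `ℋ_x · ℋ_x = ℋ_y · ℋ_y = 0`, and the
classes of the exceptional divisors have self-intersection `-1` and are orthogonal to all other
generators. -/
def intersection : PicLattice m →ₗ[ℤ] PicLattice m →ₗ[ℤ] ℤ :=
  Finsupp.linearCombination ℤ fun g => Finsupp.linearCombination ℤ fun h =>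
    match g, h with
    | .Hx, .Hy => 1
    | .Hy, .Hx => 1
    | .exc p, .exc p' => if p = p' then -1 else 0
    | _, _ => 0

/-- The linear map `Φ` of `Pic(𝒳)`. -/
def Phi : PicLattice m →ₗ[ℤ] PicLattice m :=
  Finsupp.linearCombination ℤ fun
    | .Hx => (2 * m + 1 : ℤ) • Hx + Hy - ∑ i, cA i - ∑ i, cE i - ∑ j, cBt j - ∑ j, cCt j
    | .Hy => Hx
    | .exc (.A i) => Hx - cE i
    | .exc (.E i) => Hx - cA i
    | .exc (.B j) => Hx - cBt j
    | .exc (.C j) => Hx - cCt j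
    | .exc (.Bt j) => cC j
    | .exc (.Ct j) => cB j

/-- The confinement conditions. -/
structure Confined (q : ℤ → Params m) : Prop where
  a_succ : ∀ n i, (q (n + 1)).a i = -(q n).d i
  d_succ : ∀ n i, (q (n + 1)).d i = -(q n).a i
  b_succ : ∀ n k, (q (n + 1)).b k =
    -(q (n - 1)).c k + ∑ j, ((q n).b j + (q n).c j) - ∑ i, ((q n).a i + (q n).d i)
  c_succ : ∀ n k, (q (n + 1)).c k =
    -(q (n - 1)).b k + ∑ j, ((q n).b j + (q n).c j) - ∑ i, ((q n).a i + (q n).d i)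

/-- The zeros `a_i, d_i` and the poles `b_j, c_j` of the right-hand side are `4m + 2` distinct
numbers. -/
def Params.Distinct (q : Params m) : Prop :=
  Function.Injective (Sum.elim (Sum.elim q.a q.d) (Sum.elim q.b q.c))

end mapping

end ClassIII

end

/-!
# The action of a confined mapping on the Picard group

Write `s = y + x` and `t = x̄ + x`. The mapping says that `s t = g(x)` with
`g = ∏ (x - a_i) (x - d_i) / ∏ (x - b_j) (x - c_j)`, and `ȳ = x`. So it is the exchange of the two
coordinates after the involution `y ↦ x̄` of the field `K` over `ℂ(x)`, which preserves every fibre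
of `(x, y) ↦ x` (`Conjugate`, `add_mul_add_eq_ratio`). The geometry is therefore local on the base:

* over a point where `g` has neither a zero nor a pole, `s ↦ g / s` is an automorphism of the fibre;
* over a simple zero `α`, with `u = x - α`, it is `s ↦ u h / s` with a unit `h`. This elementary
  transformation becomes regular after the point `u = s = 0`, i.e. `(α, -α)`, has been blown up, and
  exchanges the two components of the fibre (`FibPoint.transform`). Over a pole the same holds
  for `s⁻¹`, with the centre `(β, ∞)`;
* over `x = ∞` the expansion of `g` gives `y + x̄ + u y x̄ = c + e u` with `u = x⁻¹`,
  `c = ∑ (b_j + c_j) - ∑ (a_i + d_i)` and `e` regular, so that the involution is the reflection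
  `γ ↦ c - γ` of the line (`OnBlowUp.transform_infinity`).

Hence the involution maps the blow-up with the centres `(∞, γ)`, `γ = b_{j,n-1}, c_{j,n-1}`, to the
one with the centres `(∞, c - γ)`, and the confinement conditions say exactly that after the exchange
of coordinates these are the centres of `X_{n+1}` (`Conjugate.transform`,
`pullSub_mem_surface_iff`).

Points of the surfaces are local rings in `K = ℂ(x, y)`, so all of this is proved for a fixed local
ring `R`: that `R` lies on a chart with coordinates `s`, `t` means that `R` is a localisation of
`ℂ[s, t]` (`PlanePoint`), and a lift to the blow-ups is a change of coordinates from one chart to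
another. The isomorphism `f` then carries a local ring to its preimage under the automorphism `φ`
of `K`.

For the Picard group, a Cartier divisor on the blow-up is trivial if it is trivial at the prime
divisors, as the charts are factorial (`eq_one_of_isUniformizer`). The prime divisors are the curves
in the affine plane, the lines at infinity and the exceptional curves. Since `ℂ[x, y]` is factorial,
a divisor can be made trivial along the affine curves by a principal divisor, and what is left is a
combination of `H_x`, `H_y` and the exceptional curves (`exists_mk_eq_combDiv`). A function without
zeros and poles in the affine plane is constant, so these classes are independent
(`eq_zero_of_mk_combDiv`).

The action is found by comparing local equations. The fibre over a zero or a pole is the sum of an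
exceptional curve and of the pullback of one (`FibExc.mul`), the exceptional curves over `x = ∞`
pull back from those over `y = ∞` (`pull_exc_infinity`), and the function `s ∏ (x - b_j) (x - c_j)`
accounts for the image of `H_x` (`pull_pullX`).
-/

noncomputable section

namespace ClassIII

/-! ### Units of a local subring -/

section UnitAt

variable {F : Type*} [Field F] {R : LocalSubring F} {a b z : F}

/-- `z` is a unit of the local ring `R`. -/
def UnitAt (R : LocalSubring F) (z : F) : Prop :=
  z ≠ 0 ∧ z ∈ R.toSubring ∧ z⁻¹ ∈ R.toSubring

theorem unitAt_one : UnitAt R 1 := ⟨one_ne_zero, one_mem _, by simp [one_mem]⟩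

theorem UnitAt.inv (h : UnitAt R z) : UnitAt R z⁻¹ :=
  ⟨inv_ne_zero h.1, h.2.2, by simpa using h.2.1⟩

theorem UnitAt.neg (h : UnitAt R z) : UnitAt R (-z) :=
  ⟨neg_ne_zero.2 h.1, neg_mem h.2.1, by simpa [inv_neg] using h.2.2⟩

theorem UnitAt.mul (ha : UnitAt R a) (hb : UnitAt R b) : UnitAt R (a * b) :=
  ⟨mul_ne_zero ha.1 hb.1, mul_mem ha.2.1 hb.2.1, by
    rw [mul_inv]; exact mul_mem ha.2.2 hb.2.2⟩

theorem UnitAt.div (ha : UnitAt R a) (hb : UnitAt R b) : UnitAt R (a / b) := by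
  rw [div_eq_mul_inv]; exact ha.mul hb.inv

theorem UnitAt.pow (h : UnitAt R z) (n : ℕ) : UnitAt R (z ^ n) :=
  ⟨pow_ne_zero _ h.1, pow_mem h.2.1 _, by rw [← inv_pow]; exact pow_mem h.2.2 _⟩

theorem UnitAt.zpow (h : UnitAt R z) (n : ℤ) : UnitAt R (z ^ n) := by
  obtain ⟨n, rfl | rfl⟩ := n.eq_nat_or_neg
  · simpa using h.pow n
  · simpa using (h.pow n).inv

theorem UnitAt.prod {ι : Type*} {s : Finset ι} {f : ι → F} (h : ∀ i ∈ s, UnitAt R (f i)) :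
    UnitAt R (∏ i ∈ s, f i) :=
  Finset.prod_induction f (UnitAt R) (fun _ _ => UnitAt.mul) unitAt_one h

theorem UnitAt.not_vanishes (h : UnitAt R z) : ¬ Vanishes R z :=
  fun h' => ((vanishes_iff h.1).1 h').2 h.2.2

theorem vanishes_zero : Vanishes R (0 : F) := ⟨zero_mem _, Ideal.zero_mem _⟩

theorem vanishes_or_unitAt (h : z ∈ R.toSubring) : Vanishes R z ∨ UnitAt R z := by
  by_cases h0 : z = 0
  · subst h0; exact .inl vanishes_zero
  by_cases h' : z⁻¹ ∈ R.toSubring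
  · exact .inr ⟨h0, h, h'⟩
  · exact .inl ((vanishes_iff h0).2 ⟨h, h'⟩)

theorem unitAt_of_not_vanishes (h : z ∈ R.toSubring) (h' : ¬ Vanishes R z) : UnitAt R z :=
  (vanishes_or_unitAt h).resolve_left h'

theorem Vanishes.neg (h : Vanishes R z) : Vanishes R (-z) := by
  simpa using Vanishes.sub vanishes_zero h

theorem Vanishes.add (ha : Vanishes R a) (hb : Vanishes R b) : Vanishes R (a + b) := by
  simpa using ha.sub hb.neg

theorem Vanishes.mul_right (ha : Vanishes R a) (hb : b ∈ R.toSubring) : Vanishes R (a * b) := by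
  rw [mul_comm]; exact Vanishes.mul hb ha

theorem UnitAt.add_vanishes (ha : UnitAt R a) (hb : Vanishes R b) : UnitAt R (a + b) :=
  unitAt_of_not_vanishes (add_mem ha.2.1 hb.1) fun h =>
    ha.not_vanishes (by simpa using h.sub hb)

theorem UnitAt.sub_vanishes (ha : UnitAt R a) (hb : Vanishes R b) : UnitAt R (a - b) := by
  rw [sub_eq_add_neg]; exact ha.add_vanishes hb.neg

theorem vanishes_inv_of_notMem (h : z ∉ R.toSubring) (h' : z⁻¹ ∈ R.toSubring) :
    Vanishes R z⁻¹ := by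
  refine (vanishes_or_unitAt h').resolve_right fun hu => h ?_
  simpa using hu.2.2

theorem notMem_of_vanishes_inv (hz : z ≠ 0) (h : Vanishes R z⁻¹) : z ∉ R.toSubring := by
  have := (vanishes_iff (inv_ne_zero hz)).1 h
  simpa using this.2

theorem UnitAt.of_mul_left (ha : a ∈ R.toSubring) (hb : b ∈ R.toSubring)
    (h : UnitAt R (a * b)) : UnitAt R a :=
  unitAt_of_not_vanishes ha fun h' => h.not_vanishes (h'.mul_right hb)

theorem UnitAt.of_mul_right (ha : a ∈ R.toSubring) (hb : b ∈ R.toSubring)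
    (h : UnitAt R (a * b)) : UnitAt R b :=
  UnitAt.of_mul_left hb ha (by rwa [mul_comm])

/-- A unit stays a unit in a larger local ring. -/
theorem UnitAt.mono {R' : LocalSubring F} (h : UnitAt R z) (hle : R.toSubring ≤ R'.toSubring) :
    UnitAt R' z := ⟨h.1, hle h.2.1, hle h.2.2⟩

theorem Vanishes.of_le {R' : LocalSubring F} (hle : R.toSubring ≤ R'.toSubring)
    (hz : z ∈ R.toSubring) (h : Vanishes R' z) : Vanishes R z :=
  (vanishes_or_unitAt hz).resolve_right fun hu => (hu.mono hle).not_vanishes h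

theorem mk_eq_mk_iff {a b : Fˣ} :
    (QuotientGroup.mk a : Fˣ ⧸ unitsAt R) = QuotientGroup.mk b ↔ UnitAt R ((b : F) / a) := by
  rw [QuotientGroup.eq, Submonoid.mem_units_iff]
  have : (b : F) / a ≠ 0 := div_ne_zero b.ne_zero a.ne_zero
  simp [UnitAt, div_eq_inv_mul]

end UnitAt

/-! ### Points of affine planes -/

section PlanePoint

variable {F : Type*} [Field F] {R : LocalSubring F}

/-- The element `a⁻¹` of a subring `A` of `F` lies in the localisation at `p` exactly when
`a ∉ p`. -/
theorem inv_mem_ofPrime_iff {A : Subring F} {p : Ideal A} [p.IsPrime] {a : A} (ha : a ≠ 0) :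
    (a : F)⁻¹ ∈ (LocalSubring.ofPrime A p).toSubring ↔ a ∉ p := by
  have h := IsLocalization.AtPrime.isUnit_to_map_iff (LocalSubring.ofPrime A p).toSubring p a
  have h' := isUnit_iff_inv_mem (LocalSubring.ofPrime A p) (u := (a : F)) (by simpa using ha)
    (LocalSubring.le_ofPrime A p a.2)
  rw [← h']
  exact h

/-- The local rings of the points of `Spec A`, without mention of prime ideals. -/
theorem mem_specModel_iff {A : Subring F} : R ∈ specModel A ↔ A ≤ R.toSubring ∧
    ∀ z ∈ R.toSubring, ∃ a ∈ A, ∃ b ∈ A, b ≠ 0 ∧ b⁻¹ ∈ R.toSubring ∧ z = a * b⁻¹ := by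
  constructor
  · rintro ⟨p, hp, rfl⟩
    refine ⟨LocalSubring.le_ofPrime A p, fun z hz => ?_⟩
    obtain ⟨a, ha, b, hb, hb', rfl⟩ := mem_ofPrime hz
    by_cases h0 : b = 0
    · exact ⟨0, zero_mem _, 1, one_mem _, one_ne_zero, by simp [one_mem], by simp [h0]⟩
    · exact ⟨a, ha, b, hb, h0, hb', rfl⟩
  · rintro ⟨hA, h⟩
    let p := (IsLocalRing.maximalIdeal R.toSubring).comap (Subring.inclusion hA)
    have hp : p.IsPrime := inferInstance
    have key : ∀ b : A, b ≠ 0 → ((b : F)⁻¹ ∈ R.toSubring ↔ b ∉ p) := by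
      intro b hb
      have hb0 : (b : F) ≠ 0 := by simpa using hb
      rw [← isUnit_iff_inv_mem R hb0 (hA b.2), Ideal.mem_comap, IsLocalRing.mem_maximalIdeal,
        mem_nonunits_iff, not_not]
      rfl
    refine ⟨p, hp, LocalSubring.toSubring_injective (le_antisymm ?_ ?_)⟩
    · intro z hz
      obtain ⟨a, ha, b, hb, hb0, hb', rfl⟩ := h z hz
      have hb1 : (⟨b, hb⟩ : A) ≠ 0 := fun h => hb0 (congrArg Subtype.val h)
      exact mul_mem (LocalSubring.le_ofPrime A p ha)
        ((inv_mem_ofPrime_iff hb1).2 ((key _ hb1).1 hb'))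
    · intro z hz
      obtain ⟨a, ha, b, hb, hb', rfl⟩ := mem_ofPrime hz
      refine mul_mem (hA ha) ?_
      by_cases hb0 : b = 0
      · simp [hb0]
      have hb1 : (⟨b, hb⟩ : A) ≠ 0 := fun h => hb0 (congrArg Subtype.val h)
      exact (key _ hb1).2 ((inv_mem_ofPrime_iff hb1).1 hb')

variable [Algebra ℂ F] {s t s' t' z : F} {S S' : Set F}

/-- The localisation of `ℂ[S]` at the elements that are invertible in `R`, as a subalgebra
of `F`. -/
def locSub (R : LocalSubring F) (S : Set F) : Subalgebra ℂ F where
  carrier := {z | ∃ a ∈ Algebra.adjoin ℂ S, ∃ b ∈ Algebra.adjoin ℂ S,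
    b ≠ 0 ∧ b⁻¹ ∈ R.toSubring ∧ z = a * b⁻¹}
  mul_mem' := by
    rintro _ _ ⟨a, ha, b, hb, h0, hi, rfl⟩ ⟨a', ha', b', hb', h0', hi', rfl⟩
    refine ⟨a * a', mul_mem ha ha', b * b', mul_mem hb hb', mul_ne_zero h0 h0', ?_, ?_⟩
    · rw [mul_inv]; exact mul_mem hi hi'
    · field_simp
  add_mem' := by
    rintro _ _ ⟨a, ha, b, hb, h0, hi, rfl⟩ ⟨a', ha', b', hb', h0', hi', rfl⟩
    refine ⟨a * b' + a' * b, add_mem (mul_mem ha hb') (mul_mem ha' hb), b * b', mul_mem hb hb',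
      mul_ne_zero h0 h0', ?_, ?_⟩
    · rw [mul_inv]; exact mul_mem hi hi'
    · field_simp
  algebraMap_mem' c := ⟨_, Subalgebra.algebraMap_mem _ c, 1, one_mem _, one_ne_zero,
    by simp [one_mem], by simp⟩

theorem adjoin_le_locSub : Algebra.adjoin ℂ S ≤ locSub R S := fun z hz =>
  ⟨z, hz, 1, one_mem _, one_ne_zero, by simp [one_mem], by simp⟩

theorem subset_locSub : S ⊆ locSub R S :=
  Algebra.subset_adjoin.trans adjoin_le_locSub

theorem left_mem_locSub : s ∈ locSub R {s, t} := subset_locSub (by simp)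

theorem right_mem_locSub : t ∈ locSub R {s, t} := subset_locSub (by simp)

theorem inv_mem_locSub (hz : z ∈ locSub R S) (hi : z⁻¹ ∈ R.toSubring) : z⁻¹ ∈ locSub R S := by
  obtain ⟨a, ha, b, hb, h0, hbi, rfl⟩ := hz
  by_cases ha0 : a = 0
  · simp [ha0]
  refine ⟨b, hb, a, ha, ha0, ?_, by field_simp⟩
  have : a⁻¹ = (a * b⁻¹)⁻¹ * b⁻¹ := by field_simp
  rw [this]
  exact mul_mem hi hbi

theorem div_mem_locSub {w : F} (hw : w ∈ locSub R S) (hz : z ∈ locSub R S) (hu : UnitAt R z) :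
    w / z ∈ locSub R S := by
  rw [div_eq_mul_inv]; exact mul_mem hw (inv_mem_locSub hz hu.2.2)

theorem locSub_le (h : S ⊆ locSub R S') : locSub R S ≤ locSub R S' := by
  rintro _ ⟨a, ha, b, hb, h0, hi, rfl⟩
  have h' : Algebra.adjoin ℂ S ≤ locSub R S' := Algebra.adjoin_le h
  exact mul_mem (h' ha) (inv_mem_locSub (h' hb) hi)

theorem locSub_pair_le (hs : s ∈ locSub R S) (ht : t ∈ locSub R S) :
    locSub R {s, t} ≤ locSub R S :=
  locSub_le (by rintro _ (rfl | rfl) <;> assumption)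

/-- `R` is the local ring of a point of the affine plane with coordinate ring `ℂ[s, t]`: it
contains `ℂ[s, t]`, and its elements are fractions of elements of `ℂ[s, t]` whose denominators
are units of `R`. -/
structure PlanePoint (R : LocalSubring F) (s t : F) : Prop where
  const : ∀ c : ℂ, algebraMap ℂ F c ∈ R.toSubring
  left : s ∈ R.toSubring
  right : t ∈ R.toSubring
  mem : ∀ z ∈ R.toSubring, z ∈ locSub R {s, t}

theorem adjoin_le_of_const (hc : ∀ c : ℂ, algebraMap ℂ F c ∈ R.toSubring)
    (h : S ⊆ R.toSubring) : (Algebra.adjoin ℂ S).toSubring ≤ R.toSubring := by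
  let B : Subalgebra ℂ F := { R.toSubring with algebraMap_mem' := hc }
  exact fun z hz => (Algebra.adjoin_le h : Algebra.adjoin ℂ S ≤ B) hz

theorem locSub_le_of_const (hc : ∀ c : ℂ, algebraMap ℂ F c ∈ R.toSubring)
    (h : S ⊆ R.toSubring) (hz : z ∈ locSub R S) : z ∈ R.toSubring := by
  obtain ⟨a, ha, b, hb, h0, hi, rfl⟩ := hz
  exact mul_mem (adjoin_le_of_const hc h ha) hi

theorem planePoint_iff :
    PlanePoint R s t ↔ R ∈ specModel (Algebra.adjoin ℂ {s, t}).toSubring := by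
  rw [mem_specModel_iff]
  constructor
  · intro h
    exact ⟨adjoin_le_of_const h.const (by rintro _ (rfl | rfl) <;> [exact h.left; exact h.right]),
      h.mem⟩
  · rintro ⟨h, h'⟩
    exact ⟨fun c => h (Subalgebra.algebraMap_mem _ c), h (Algebra.subset_adjoin (by simp)),
      h (Algebra.subset_adjoin (by simp)), h'⟩

/-- Change of coordinates: the new coordinates have to be regular, and the old ones fractions of
polynomials in the new ones. -/
theorem PlanePoint.change (h : PlanePoint R s t) (hs' : s' ∈ R.toSubring) (ht' : t' ∈ R.toSubring)
    (hs : s ∈ locSub R {s', t'}) (ht : t ∈ locSub R {s', t'}) : PlanePoint R s' t' :=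
  ⟨h.const, hs', ht', fun z hz => locSub_pair_le hs ht (h.mem z hz)⟩

theorem PlanePoint.swap (h : PlanePoint R s t) : PlanePoint R t s :=
  h.change h.right h.left right_mem_locSub left_mem_locSub

end PlanePoint

/-! ### Membership in a blow-up in terms of coordinates -/

section OnBlowUp

/-- A local ring that contains `A` dominates the local ring of a point of `Spec A`, its centre. -/
theorem exists_specModel_le {F : Type*} [Field F] {R : LocalSubring F} {A : Subring F}
    (hA : A ≤ R.toSubring) : ∃ O ∈ specModel A, O ≤ R := by
  let p := (IsLocalRing.maximalIdeal R.toSubring).comap (Subring.inclusion hA)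
  have hp : p.IsPrime := inferInstance
  have key : ∀ b ∈ A, b ≠ 0 →
      (b⁻¹ ∈ (LocalSubring.ofPrime A p).toSubring ↔ b⁻¹ ∈ R.toSubring) := by
    intro b hb hb0
    have hb1 : (⟨b, hb⟩ : A) ≠ 0 := fun h => hb0 (congrArg Subtype.val h)
    rw [inv_mem_ofPrime_iff hb1, ← isUnit_iff_inv_mem R hb0 (hA hb), Ideal.mem_comap,
      IsLocalRing.mem_maximalIdeal, mem_nonunits_iff, not_not]
    rfl
  have hle : (LocalSubring.ofPrime A p).toSubring ≤ R.toSubring := by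
    intro z hz
    obtain ⟨a, ha, b, hb, hb', rfl⟩ := mem_ofPrime hz
    refine mul_mem (hA ha) ?_
    by_cases hb0 : b = 0
    · simp [hb0]
    · exact (key b hb hb0).1 hb'
  refine ⟨_, ⟨p, hp, rfl⟩, hle, ⟨?_⟩⟩
  rintro ⟨z, hz⟩ hu
  by_cases hz0 : z = 0
  · subst hz0
    exact absurd (hu : IsUnit (0 : R.toSubring)) not_isUnit_zero
  have hzi : z⁻¹ ∈ R.toSubring := (isUnit_iff_inv_mem R hz0 (hle hz)).1 hu
  rw [isUnit_iff_inv_mem _ hz0]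
  obtain ⟨a, ha, b, hb, hb', rfl⟩ := mem_ofPrime hz
  have hb0 : b ≠ 0 := by rintro rfl; simp at hz0
  have ha0 : a ≠ 0 := by rintro rfl; simp at hz0
  rw [mul_inv, inv_inv]
  refine mul_mem ((key a ha ha0).2 ?_) (LocalSubring.le_ofPrime A p hb)
  have : a⁻¹ = (a * b⁻¹)⁻¹ * b⁻¹ := by field_simp
  rw [this]
  exact mul_mem hzi (hle hb')

variable {R : LocalSubring K} {z w s t : K} {α β : OnePoint ℂ} {Z : Set Pt}

/-- `R` is a point of `ℙ¹ × ℙ¹` with affine coordinates `z` and `w`. -/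
def OnP1P1 (z w : K) (R : LocalSubring K) : Prop :=
  ∃ s ∈ ({z, z⁻¹} : Set K), ∃ t ∈ ({w, w⁻¹} : Set K), PlanePoint R s t

/-- `R` is a point of one of the two charts of the blow-up of a plane with coordinates `u`, `v`
at the origin. -/
def ExcPoint (R : LocalSubring K) (u v : K) : Prop :=
  PlanePoint R (u / v) v ∨ PlanePoint R (v / u) u

/-- `R` is a point of the blow-up at `Z` of `ℙ¹ × ℙ¹` with affine coordinates `z` and `w`. -/
def OnBlowUp (z w : K) (Z : Set Pt) (R : LocalSubring K) : Prop :=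
  (OnP1P1 z w R ∧ ∀ p ∈ Z, ¬ (Vanishes R (localCoord z p.1) ∧ Vanishes R (localCoord w p.2))) ∨
  ∃ p ∈ Z, (Vanishes R (localCoord z p.1) ∧ Vanishes R (localCoord w p.2)) ∧
    ExcPoint R (localCoord z p.1) (localCoord w p.2)

theorem mem_P1P1_iff : R ∈ P1P1 ↔ OnP1P1 x y R := by
  simp only [P1P1, OnP1P1, planePoint_iff, Set.mem_ofPred_eq]

theorem ExcPoint.symm {u v : K} (h : ExcPoint R u v) : ExcPoint R v u := Or.symm h

theorem OnP1P1.swap (h : OnP1P1 z w R) : OnP1P1 w z R := by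
  obtain ⟨s, hs, t, ht, h⟩ := h
  exact ⟨t, ht, s, hs, h.swap⟩

theorem OnBlowUp.swap (h : OnBlowUp z w Z R) : OnBlowUp w z (Prod.swap ⁻¹' Z) R := by
  rcases h with ⟨h, h'⟩ | ⟨p, hp, ⟨h1, h2⟩, h⟩
  · exact .inl ⟨h.swap, fun p hp hp' => h' p.swap hp ⟨hp'.2, hp'.1⟩⟩
  · exact .inr ⟨p.swap, by simpa using hp, ⟨h2, h1⟩, h.symm⟩

theorem onBlowUp_swap_iff : OnBlowUp w z (Prod.swap ⁻¹' Z) R ↔ OnBlowUp z w Z R := by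
  refine ⟨fun h => ?_, .swap⟩
  have := h.swap
  rwa [← Set.preimage_comp, Prod.swap_swap_eq, Set.preimage_id] at this

theorem localCoord_mem_locSub {S : Set K} (h : localCoord z α ∈ locSub R S)
    (hs : s ∈ ({z, z⁻¹} : Set K)) (hR : s ∈ R.toSubring) : s ∈ locSub R S := by
  match α with
  | none =>
    rcases hs with rfl | rfl
    · have h : s⁻¹ ∈ locSub R S := h
      simpa using inv_mem_locSub h (by simpa using hR)
    · exact h
  | some a =>
    have h : z ∈ locSub R S := by
      have := add_mem h (Subalgebra.algebraMap_mem _ a)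
      simpa [localCoord] using this
    rcases hs with rfl | rfl
    · exact h
    · exact inv_mem_locSub h hR

theorem PlanePoint.localCoord_left (h : PlanePoint R s t) (hs : s ∈ ({z, z⁻¹} : Set K))
    (hα : localCoord z α ∈ R.toSubring) : PlanePoint R (localCoord z α) t :=
  h.change hα h.right (localCoord_mem_locSub left_mem_locSub hs h.left) right_mem_locSub

theorem PlanePoint.localCoord_right (h : PlanePoint R s t) (ht : t ∈ ({w, w⁻¹} : Set K))
    (hβ : localCoord w β ∈ R.toSubring) : PlanePoint R s (localCoord w β) :=
  (h.swap.localCoord_left ht hβ).swap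

theorem exists_planePoint_of_localCoord (h : PlanePoint R (localCoord z α) t) :
    ∃ s ∈ ({z, z⁻¹} : Set K), PlanePoint R s t := by
  match α with
  | none => exact ⟨z⁻¹, by simp, h⟩
  | some a =>
    refine ⟨z, by simp, h.change ?_ h.right ?_ right_mem_locSub⟩
    · simpa [localCoord] using add_mem h.left (h.const a)
    · exact sub_mem left_mem_locSub (Subalgebra.algebraMap_mem _ a)

theorem OnP1P1.of_localCoord (h : PlanePoint R (localCoord z α) (localCoord w β)) :
    OnP1P1 z w R := by
  obtain ⟨s, hs, h⟩ := exists_planePoint_of_localCoord h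
  obtain ⟨t, ht, h⟩ := exists_planePoint_of_localCoord h.swap
  exact ⟨s, hs, t, ht, h.swap⟩

theorem OnP1P1.planePoint (h : OnP1P1 z w R) (hα : localCoord z α ∈ R.toSubring)
    (hβ : localCoord w β ∈ R.toSubring) : PlanePoint R (localCoord z α) (localCoord w β) := by
  obtain ⟨s, hs, t, ht, h⟩ := h
  exact (h.localCoord_left hs hα).localCoord_right ht hβ

theorem locSub_mono {F : Type*} [Field F] [Algebra ℂ F] {O R : LocalSubring F} {S : Set F}
    (h : O.toSubring ≤ R.toSubring) : locSub O S ≤ locSub R S := by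
  rintro _ ⟨a, ha, b, hb, h0, hi, rfl⟩
  exact ⟨a, ha, b, hb, h0, h hi, rfl⟩

theorem planePoint_of_mem_chart {O : LocalSubring K} {u v : K} (hv : v ≠ 0)
    (hO : PlanePoint O u v) (hle : O ≤ R)
    (h : R ∈ specModel (O.toSubring ⊔ Subring.closure {u / v})) : PlanePoint R (u / v) v := by
  rw [mem_specModel_iff] at h
  have hle' : O.toSubring ⊔ Subring.closure {u / v} ≤ (locSub R {u / v, v}).toSubring := by
    refine sup_le (fun z hz => ?_) (by simpa using left_mem_locSub)
    refine locSub_pair_le ?_ right_mem_locSub (locSub_mono hle.1 (hO.mem z hz))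
    have := mul_mem (left_mem_locSub (R := R) (s := u / v) (t := v)) right_mem_locSub
    rwa [div_mul_cancel₀ u hv] at this
  refine ⟨fun c => hle.1 (hO.const c), h.1 ?_, hle.1 hO.right, fun z hz => ?_⟩
  · exact (le_sup_right : Subring.closure _ ≤ _) (Subring.subset_closure rfl)
  · obtain ⟨a, ha, b, hb, h0, hi, rfl⟩ := h.2 z hz
    exact mul_mem (hle' ha) (inv_mem_locSub (hle' hb) hi)

theorem mem_chart_of_planePoint {O : LocalSubring K} {u v : K}
    (hO : PlanePoint O u v) (hle : O ≤ R) (h : PlanePoint R (u / v) v) :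
    R ∈ specModel (O.toSubring ⊔ Subring.closure {u / v}) := by
  have hw : u / v ∈ O.toSubring ⊔ Subring.closure {u / v} :=
    (le_sup_right : Subring.closure _ ≤ _) (Subring.subset_closure rfl)
  have hO' : O.toSubring ≤ O.toSubring ⊔ Subring.closure {u / v} := le_sup_left
  rw [mem_specModel_iff]
  refine ⟨sup_le hle.1 (by simpa using h.left), fun z hz => ?_⟩
  obtain ⟨a, ha, b, hb, h0, hi, rfl⟩ := h.mem z hz
  let B : Subalgebra ℂ K := { O.toSubring ⊔ Subring.closure {u / v} with
    algebraMap_mem' := fun c => hO' (hO.const c) }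
  have hB : Algebra.adjoin ℂ {u / v, v} ≤ B :=
    Algebra.adjoin_le (by rintro _ (rfl | rfl) <;> [exact hw; exact hO' hO.right])
  exact ⟨a, hB ha, b, hB hb, h0, hi, rfl⟩

/-- The points of the blow-up, in terms of coordinates. -/
theorem mem_blowUp_iff : R ∈ blowUp Z ↔ OnBlowUp x y Z R := by
  refine or_congr (by simp only [Set.mem_ofPred_eq, mem_P1P1_iff, LiesOver]) ⟨?_, ?_⟩
  · rintro ⟨p, hp, O, hO, hOp, hle, h⟩
    have hO' := (mem_P1P1_iff.1 hO).planePoint hOp.1.1 hOp.2.1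
    refine ⟨p, hp, ⟨hOp.1.mono hle, hOp.2.mono hle⟩, h.imp ?_ ?_⟩
    · exact planePoint_of_mem_chart (vAt_ne_zero p) hO' hle
    · exact planePoint_of_mem_chart (uAt_ne_zero p) hO'.swap hle
  · rintro ⟨p, hp, hl, h⟩
    have hc : ∀ c : ℂ, algebraMap ℂ K c ∈ R.toSubring :=
      h.elim PlanePoint.const PlanePoint.const
    obtain ⟨O, hO, hle⟩ := exists_specModel_le (R := R)
      (A := (Algebra.adjoin ℂ {uAt p, vAt p}).toSubring)
      (adjoin_le_of_const hc (by rintro _ (rfl | rfl) <;> [exact hl.1.1; exact hl.2.1]))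
    have hO' := planePoint_iff.2 hO
    refine ⟨p, hp, O, mem_P1P1_iff.2 (.of_localCoord hO'),
      ⟨hl.1.of_le hle.1 hO'.left, hl.2.of_le hle.1 hO'.right⟩, hle, h.imp ?_ ?_⟩
    · exact mem_chart_of_planePoint hO' hle
    · exact mem_chart_of_planePoint hO'.swap hle

theorem localCoord_mem_or (h : localCoord z α ∈ R.toSubring)
    (hc : ∀ c : ℂ, algebraMap ℂ K c ∈ R.toSubring) : z ∈ R.toSubring ∨ z⁻¹ ∈ R.toSubring := by
  match α with
  | none => exact .inr h
  | some a => exact .inl (by simpa [localCoord] using add_mem h (hc a))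

theorem OnBlowUp.const (h : OnBlowUp z w Z R) (c : ℂ) : algebraMap ℂ K c ∈ R.toSubring := by
  rcases h with ⟨⟨s, -, t, -, h⟩, -⟩ | ⟨p, -, -, h | h⟩ <;> exact h.const c

theorem OnBlowUp.left_mem (h : OnBlowUp z w Z R) : z ∈ R.toSubring ∨ z⁻¹ ∈ R.toSubring := by
  have hc := h.const
  rcases h with ⟨⟨s, rfl | rfl, t, -, h⟩, -⟩ | ⟨p, -, h, -⟩
  · exact .inl h.left
  · exact .inr h.left
  · exact localCoord_mem_or h.1.1 hc

theorem OnBlowUp.right_mem (h : OnBlowUp z w Z R) : w ∈ R.toSubring ∨ w⁻¹ ∈ R.toSubring :=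
  h.swap.left_mem

end OnBlowUp

/-! ### Transport along automorphisms of the function field -/

section Transport

variable {F G : Type*} [Field F] [Field G] [Algebra ℂ F] [Algebra ℂ G] (σ : G ≃ₐ[ℂ] F)
  {R : LocalSubring F} {z s t : G}

/-- The preimage of a local subring under an isomorphism of fields. -/
def pullSub (R : LocalSubring F) : LocalSubring G := R.map (σ.symm : F →+* G)

theorem mem_pullSub : z ∈ (pullSub σ R).toSubring ↔ σ z ∈ R.toSubring := by
  constructor
  · rintro ⟨w, hw, rfl⟩
    simpa using hw
  · intro h
    exact ⟨_, h, by simp⟩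

theorem vanishes_pullSub : Vanishes (pullSub σ R) z ↔ Vanishes R (σ z) := by
  by_cases h : z = 0
  · subst h; simp [vanishes_zero]
  · rw [vanishes_iff h, vanishes_iff (by simpa using h)]
    simp [mem_pullSub]

theorem locSub_pullSub {S : Set G} : z ∈ locSub (pullSub σ R) S ↔ σ z ∈ locSub R (σ '' S) := by
  have h : Algebra.adjoin ℂ (σ '' S) = (Algebra.adjoin ℂ S).map (σ : G →ₐ[ℂ] F) :=
    (AlgHom.map_adjoin (σ : G →ₐ[ℂ] F) S).symm
  constructor
  · rintro ⟨a, ha, b, hb, h0, hi, rfl⟩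
    refine ⟨σ a, by rw [h]; exact ⟨a, ha, rfl⟩, σ b, by rw [h]; exact ⟨b, hb, rfl⟩,
      by simpa using h0, ?_, by simp⟩
    rwa [mem_pullSub, map_inv₀] at hi
  · rintro ⟨a, ha, b, hb, h0, hi, he⟩
    rw [h] at ha hb
    obtain ⟨a, ha, rfl⟩ := ha
    obtain ⟨b, hb, rfl⟩ := hb
    refine ⟨a, ha, b, hb, by rintro rfl; simp at h0, ?_, ?_⟩
    · rw [mem_pullSub, map_inv₀]; exact hi
    · apply σ.injective
      simpa using he

theorem planePoint_pullSub : PlanePoint (pullSub σ R) s t ↔ PlanePoint R (σ s) (σ t) := by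
  have himg : σ '' {s, t} = {σ s, σ t} := Set.image_pair _ _ _
  constructor
  · rintro ⟨h1, h2, h3, h4⟩
    refine ⟨fun c => by simpa [mem_pullSub] using h1 c, (mem_pullSub σ).1 h2, (mem_pullSub σ).1 h3,
      fun z hz => ?_⟩
    have := h4 (σ.symm z) (by simpa [mem_pullSub] using hz)
    rwa [locSub_pullSub, himg, AlgEquiv.apply_symm_apply] at this
  · rintro ⟨h1, h2, h3, h4⟩
    refine ⟨fun c => by simpa [mem_pullSub] using h1 c, (mem_pullSub σ).2 h2, (mem_pullSub σ).2 h3,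
      fun z hz => ?_⟩
    rw [locSub_pullSub, himg]
    exact h4 _ ((mem_pullSub σ).1 hz)

theorem map_pullSub_le : (pullSub σ R).map ((σ : G →ₐ[ℂ] F) : G →+* F) ≤ R := by
  have : (pullSub σ R).map ((σ : G →ₐ[ℂ] F) : G →+* F) = R := by
    refine LocalSubring.toSubring_injective (le_antisymm ?_ ?_)
    · rintro _ ⟨z, hz, rfl⟩
      exact (mem_pullSub σ).1 hz
    · intro z hz
      exact ⟨σ.symm z, by simpa using (mem_pullSub σ).2 (by simpa using hz), by simp⟩
  exact this.le

theorem pullSub_symm_pullSub : pullSub σ.symm (pullSub σ R) = R :=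
  LocalSubring.toSubring_injective (by ext; simp [mem_pullSub])

theorem pullSub_pullSub_symm {R : LocalSubring G} : pullSub σ (pullSub σ.symm R) = R :=
  LocalSubring.toSubring_injective (by ext; simp [mem_pullSub])

theorem continuous_pullSub : Continuous (pullSub σ : LocalSubring F → LocalSubring G) := by
  refine continuous_generateFrom_iff.2 ?_
  rintro _ ⟨r, rfl⟩
  have : pullSub σ ⁻¹' {R : LocalSubring G | r ∈ R.toSubring} =
      {R : LocalSubring F | σ r ∈ R.toSubring} := by
    ext R
    exact mem_pullSub σ
  rw [this]
  exact TopologicalSpace.isOpen_generateFrom_of_mem ⟨σ r, rfl⟩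

theorem map_localCoord (σ : K ≃ₐ[ℂ] K) (z : K) (α : OnePoint ℂ) :
    σ (localCoord z α) = localCoord (σ z) α := by
  match α with
  | none => simp [localCoord]
  | some a => simp [localCoord]

/-- An automorphism of `K` transports the blow-up in the coordinates `z`, `w` to the one in their
images; so an isomorphism of surfaces is a statement about one local ring in two sets of
coordinates. -/
theorem onBlowUp_pullSub (σ : K ≃ₐ[ℂ] K) {R : LocalSubring K} {z w : K} {Z : Set Pt} :
    OnBlowUp z w Z (pullSub σ R) ↔ OnBlowUp (σ z) (σ w) Z R := by
  simp [OnBlowUp, OnP1P1, ExcPoint, vanishes_pullSub, planePoint_pullSub, map_localCoord]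

/-- The morphism of schemes given by an isomorphism of function fields under which the local rings
of the points correspond to each other. -/
def homOfPull {X : Set (LocalSubring F)} {Y : Set (LocalSubring G)}
    (h : ∀ R ∈ X, pullSub σ R ∈ Y) : Hom (σ : G →ₐ[ℂ] F) X Y where
  toFun P := ⟨pullSub σ P.1, h _ P.2⟩
  continuous_toFun := ((continuous_pullSub σ).comp continuous_subtype_val).subtype_mk _
  map_le _ := map_pullSub_le σ

theorem homOfPull_isIso {X : Set (LocalSubring F)} {Y : Set (LocalSubring G)}
    (h : ∀ R ∈ X, pullSub σ R ∈ Y) (h' : ∀ R ∈ Y, pullSub σ.symm R ∈ X) :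
    (homOfPull σ h).IsIso :=
  ⟨homOfPull σ.symm h', fun _ => Subtype.ext (pullSub_symm_pullSub σ),
    fun _ => Subtype.ext (pullSub_pullSub_symm σ)⟩

end Transport

/-! ### Coordinate changes on the charts of a blow-up -/

section Charts

variable {R : LocalSubring K} {z w w' u v V s t ε k h q : K} {Z : Set Pt} {p : Pt}

/-- The blow-up of the origin of the `(u, v)`-plane does not change when `v` is replaced by another
generator `V = ε v + k u` of the ideal modulo `u`, with a unit `ε`. -/
theorem ExcPoint.change (hu0 : u ≠ 0) (hv0 : v ≠ 0) (hV : V = ε * v + k * u) (hε : UnitAt R ε)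
    (hk : k ∈ R.toSubring) (hεL : ε ∈ locSub R {u, V}) (hkL : k ∈ locSub R {u, V})
    (hR : ExcPoint R u v) : ExcPoint R u V := by
  have key : PlanePoint R (v / u) u → PlanePoint R (V / u) u := by
    intro hR
    have e1 : V / u = ε * (v / u) + k := by rw [hV]; field_simp
    have hm : V / u ∈ R.toSubring := by
      rw [e1]; exact add_mem (mul_mem hε.2.1 hR.left) hk
    refine hR.change hm hR.right ?_ right_mem_locSub
    have hle : locSub R {u, V} ≤ locSub R {V / u, u} := by
      refine locSub_pair_le right_mem_locSub ?_
      have := mul_mem (left_mem_locSub (R := R) (s := V / u) (t := u)) right_mem_locSub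
      rwa [div_mul_cancel₀ V hu0] at this
    have e2 : v / u = (V / u - k) / ε := by
      have := hε.1
      rw [e1]; field_simp; ring
    rw [e2]
    exact div_mem_locSub (sub_mem left_mem_locSub (hle hkL)) (hle hεL) hε
  rcases hR with hR | hR
  · have e1 : V / v = ε + k * (u / v) := by rw [hV]; field_simp
    have hm : V / v ∈ R.toSubring := by
      rw [e1]; exact add_mem hε.2.1 (mul_mem hk hR.left)
    rcases vanishes_or_unitAt hm with h0 | h0
    · -- here `u / v` has to be a unit, so that `R` also lies on the other chart
      have hku : UnitAt R (k * (u / v)) := by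
        have e2 : k * (u / v) = -(ε - V / v) := by rw [e1]; ring
        rw [e2]
        exact (hε.sub_vanishes h0).neg
      have huv := UnitAt.of_mul_right hk hR.left hku
      refine .inr (key ?_)
      have e3 : v / u = (u / v)⁻¹ := (inv_div u v).symm
      have e4 : v / u ∈ R.toSubring := by rw [e3]; exact huv.2.2
      have hu : u ∈ R.toSubring := by
        have := mul_mem hR.left hR.right
        rwa [div_mul_cancel₀ u hv0] at this
      refine hR.change e4 hu ?_ ?_
      · rw [← inv_div v u]
        exact inv_mem_locSub left_mem_locSub (by rw [inv_div]; exact hR.left)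
      · have := mul_mem (left_mem_locSub (R := R) (s := v / u) (t := u)) right_mem_locSub
        rwa [div_mul_cancel₀ v hu0] at this
    · have hV0 : V ≠ 0 := by
        rintro rfl
        exact h0.1 (zero_div v)
      have e2 : u / V = (u / v) / (V / v) := by field_simp
      have e3 : V = V / v * v := (div_mul_cancel₀ V hv0).symm
      have hm1 : u / V ∈ R.toSubring := by
        rw [e2, div_eq_mul_inv]; exact mul_mem hR.left h0.2.2
      have hle : locSub R {u, V} ≤ locSub R {u / V, V} := by
        refine locSub_pair_le ?_ right_mem_locSub
        have := mul_mem (left_mem_locSub (R := R) (s := u / V) (t := V)) right_mem_locSub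
        rwa [div_mul_cancel₀ u hV0] at this
      have hL : v / V ∈ locSub R {u / V, V} := by
        have e4 : v / V = (1 - k * (u / V)) / ε := by
          have := hε.1
          field_simp
          rw [hV]; ring
        rw [e4]
        exact div_mem_locSub (sub_mem (one_mem _) (mul_mem (hle hkL) left_mem_locSub)) (hle hεL) hε
      have hvV : UnitAt R (v / V) := by rw [← inv_div]; exact h0.inv
      refine .inl (hR.change hm1 (e3 ▸ mul_mem hm hR.right) ?_ ?_)
      · have e4 : u / v = (u / V) / (v / V) := by field_simp
        rw [e4]
        exact div_mem_locSub left_mem_locSub hL hvV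
      · have := mul_mem hL (right_mem_locSub (R := R) (s := u / V) (t := V))
        rwa [div_mul_cancel₀ v hV0] at this
  · exact .inr (key hR)

/-- The three charts of the blow-up of a `ℙ¹`-bundle with fibre coordinate `w` at the point
`u = w = 0` of the fibre `u = 0`. -/
def FibPoint (R : LocalSubring K) (u w : K) : Prop :=
  PlanePoint R u w⁻¹ ∨ ExcPoint R u w

/-- The elementary transformation `w ↦ u h / w` of the `ℙ¹`-bundle lifts to the blow-up, where it
permutes the three charts. -/
theorem FibPoint.transform (hu0 : u ≠ 0) (hs0 : s ≠ 0) (ht0 : t ≠ 0) (hst : s * t = u * h)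
    (hh : UnitAt R h) (hL : h ∈ locSub R {u}) (hR : FibPoint R u s) : FibPoint R u t := by
  have hh0 := hh.1
  have ht : t = u * h / s := by field_simp; linear_combination hst
  have hL' : ∀ {S : Set K}, u ∈ locSub R S → h ∈ locSub R S := fun hu =>
    locSub_le (by rintro _ rfl; exact hu) hL
  rcases hR with hR | hR | hR
  · have e1 : t / u = s⁻¹ * h := by rw [ht]; field_simp
    have e2 : s⁻¹ = (t / u) / h := by rw [ht]; field_simp
    refine .inr (.inr (hR.change ?_ hR.left right_mem_locSub ?_))
    · rw [e1]; exact mul_mem hR.right hh.2.1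
    · rw [e2]; exact div_mem_locSub left_mem_locSub (hL' right_mem_locSub) hh
  · have e1 : t = (u / s) * h := by rw [ht]; field_simp
    have e2 : u / t = s / h := by rw [ht]; field_simp
    have hu : u ∈ locSub R {u / t, t} := by
      have := mul_mem (left_mem_locSub (R := R) (s := u / t) (t := t)) right_mem_locSub
      rwa [div_mul_cancel₀ u ht0] at this
    refine .inr (.inl (hR.change ?_ ?_ ?_ ?_))
    · rw [e2]; exact mul_mem hR.right hh.2.2
    · rw [e1]; exact mul_mem hR.left hh.2.1
    · have e3 : u / s = t / h := by rw [ht]; field_simp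
      rw [e3]; exact div_mem_locSub right_mem_locSub (hL' hu) hh
    · have e3 : s = u / t * h := by rw [e2]; field_simp
      nth_rw 1 [e3]; exact mul_mem left_mem_locSub (hL' hu)
  · have e1 : t⁻¹ = (s / u) / h := by rw [ht]; field_simp
    have e2 : s / u = t⁻¹ * h := by rw [ht]; field_simp
    refine .inl (hR.change hR.right ?_ ?_ left_mem_locSub)
    · rw [e1]; exact mul_mem hR.left hh.2.2
    · rw [e2]; exact mul_mem right_mem_locSub (hL' left_mem_locSub)

theorem PlanePoint.of_inv (h : PlanePoint R u w⁻¹) (hw : w ∈ R.toSubring) : PlanePoint R u w :=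
  h.change h.left hw left_mem_locSub (inv_mem_locSub right_mem_locSub h.right)

theorem PlanePoint.inv (h : PlanePoint R u w) (hw : w⁻¹ ∈ R.toSubring) : PlanePoint R u w⁻¹ :=
  PlanePoint.of_inv (by simpa using h) hw

theorem OnP1P1.of_left_mem {α : OnePoint ℂ} (h : OnP1P1 z w R)
    (hu : localCoord z α ∈ R.toSubring) :
    PlanePoint R (localCoord z α) w ∨ PlanePoint R (localCoord z α) w⁻¹ := by
  obtain ⟨s, hs, t, rfl | rfl, h⟩ := h
  · exact .inl (h.localCoord_left hs hu)
  · exact .inr (h.localCoord_left hs hu)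

theorem OnP1P1.of_planePoint {α : OnePoint ℂ}
    (h : PlanePoint R (localCoord z α) w ∨ PlanePoint R (localCoord z α) w⁻¹) :
    OnP1P1 z w R := by
  rcases h with h | h <;> obtain ⟨s, hs, h⟩ := exists_planePoint_of_localCoord h
  · exact ⟨s, hs, w, by simp, h⟩
  · exact ⟨s, hs, w⁻¹, by simp, h⟩

/-- Near a fibre with only one centre `p`, the blow-up is described by the three charts
of `FibPoint` for any fibre coordinate `q` that vanishes at `p`. -/
theorem onBlowUp_iff_fibPoint (hz0 : z ≠ 0) (hq0 : q ≠ 0) (hp : p ∈ Z)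
    (hu0 : localCoord z p.1 ≠ 0) (hu : Vanishes R (localCoord z p.1))
    (huniq : ∀ p' ∈ Z, p'.1 = p.1 → p' = p)
    (h1 : (PlanePoint R (localCoord z p.1) w ∨ PlanePoint R (localCoord z p.1) w⁻¹) ↔
      (PlanePoint R (localCoord z p.1) q ∨ PlanePoint R (localCoord z p.1) q⁻¹))
    (h2 : Vanishes R (localCoord w p.2) ↔ Vanishes R q)
    (h3 : Vanishes R q → (ExcPoint R (localCoord z p.1) (localCoord w p.2) ↔
      ExcPoint R (localCoord z p.1) q)) :
    OnBlowUp z w Z R ↔ FibPoint R (localCoord z p.1) q := by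
  constructor
  · intro h
    have hc := h.const
    rcases h with ⟨h, hn⟩ | ⟨p', hp', hl, h⟩
    · rcases h1.1 (h.of_left_mem hu.1) with h | h
      · have hq : UnitAt R q :=
          unitAt_of_not_vanishes h.right fun hq => hn p hp ⟨hu, h2.2 hq⟩
        exact .inl (h.inv hq.2.2)
      · exact .inl h
    · have := huniq p' hp' (localCoord_unique hc hz0 hl.1 hu)
      subst this
      exact .inr ((h3 (h2.1 hl.2)).1 h)
  · have key : PlanePoint R (localCoord z p.1) q⁻¹ → OnBlowUp z w Z R := by
      intro h
      refine .inl ⟨.of_planePoint (h1.2 (.inr h)), fun p' hp' hl => ?_⟩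
      have := huniq p' hp' (localCoord_unique h.const hz0 hl.1 hu)
      subst this
      exact ((vanishes_iff hq0).1 (h2.1 hl.2)).2 h.right
    rintro (h | h)
    · exact key h
    · have hq : q ∈ R.toSubring := by
        rcases h with h | h
        · exact h.right
        · have := mul_mem h.left h.right
          rwa [div_mul_cancel₀ q hu0] at this
      rcases vanishes_or_unitAt hq with hq | hq
      · exact .inr ⟨p, hp, ⟨hu, h2.2 hq⟩, (h3 hq).2 h⟩
      · refine key ?_
        rcases h with h | h
        · refine (h.change hu.1 hq.2.1 ?_ right_mem_locSub).inv hq.2.2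
          exact div_mem_locSub left_mem_locSub right_mem_locSub hq
        · have := Vanishes.mul h.left hu
          rw [div_mul_cancel₀ q hu0] at this
          exact absurd this hq.not_vanishes

theorem vanishes_inv_add (hw : w ≠ 0) (hws : w + z ≠ 0) (hz : z ∈ R.toSubring)
    (h : Vanishes R w⁻¹) : Vanishes R (w + z)⁻¹ := by
  have h1 : UnitAt R (1 + z * w⁻¹) := unitAt_one.add_vanishes (Vanishes.mul hz h)
  have e : (w + z)⁻¹ = (1 + z * w⁻¹)⁻¹ * w⁻¹ := by
    have := h1.1
    field_simp
  rw [e]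
  exact Vanishes.mul h1.2.2 h

/-- Translations of the fibre coordinate by regular functions on the base. -/
theorem planePoint_add (hw : w ≠ 0) (hws : w + z ≠ 0) (hz : z ∈ R.toSubring)
    (hzL : z ∈ locSub R {u}) (h : PlanePoint R u w ∨ PlanePoint R u w⁻¹) :
    PlanePoint R u (w + z) ∨ PlanePoint R u (w + z)⁻¹ := by
  have hL : ∀ {t : K}, z ∈ locSub R {u, t} := fun {t} =>
    locSub_le (by rintro _ rfl; exact left_mem_locSub) hzL
  have key : PlanePoint R u w → PlanePoint R u (w + z) := by
    intro h
    refine h.change h.left (add_mem h.right hz) left_mem_locSub ?_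
    have := sub_mem (right_mem_locSub (R := R) (s := u) (t := w + z)) hL
    simpa using this
  rcases h with h | h
  · exact .inl (key h)
  · by_cases hwR : w ∈ R.toSubring
    · exact .inl (key (h.of_inv hwR))
    · have hv := vanishes_inv_of_notMem hwR h.right
      have hv' := vanishes_inv_add hw hws hz hv
      refine .inr (h.change h.left hv'.1 left_mem_locSub ?_)
      have h1 : UnitAt R (1 - z * (w + z)⁻¹) := unitAt_one.sub_vanishes (Vanishes.mul hz hv')
      have e : w⁻¹ = (w + z)⁻¹ / (1 - z * (w + z)⁻¹) := by
        have e2 : 1 - z * (w + z)⁻¹ = w * (w + z)⁻¹ := by field_simp; ring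
        rw [e2]; field_simp
      rw [e]
      exact div_mem_locSub right_mem_locSub
        (sub_mem (one_mem _) (mul_mem hL right_mem_locSub)) h1

theorem planePoint_add_iff (hw : w ≠ 0) (hws : w + z ≠ 0) (hz : z ∈ R.toSubring)
    (hzL : z ∈ locSub R {u}) : (PlanePoint R u w ∨ PlanePoint R u w⁻¹) ↔
    (PlanePoint R u (w + z) ∨ PlanePoint R u (w + z)⁻¹) := by
  refine ⟨planePoint_add hw hws hz hzL, fun h => ?_⟩
  have := planePoint_add hws (z := -z) (by simpa using hw) (neg_mem hz) (neg_mem hzL) h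
  simpa using this

theorem vanishes_inv_add_iff (hw : w ≠ 0) (hws : w + z ≠ 0) (hz : z ∈ R.toSubring) :
    Vanishes R w⁻¹ ↔ Vanishes R (w + z)⁻¹ := by
  refine ⟨vanishes_inv_add hw hws hz, fun h => ?_⟩
  have := vanishes_inv_add hws (z := -z) (by simpa using hw) (neg_mem hz) h
  simpa using this

end Charts

/-! ### The fibrewise involution -/

section Ratio

variable {ι κ : Type*} [Fintype ι] [Fintype κ] {R : LocalSubring K}

/-- The rational function `∏ (z - a_i) / ∏ (z - b_j)`. -/
def ratio (a : ι → ℂ) (b : κ → ℂ) (z : K) : K :=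
  (∏ i, (z - algebraMap ℂ K (a i))) / ∏ j, (z - algebraMap ℂ K (b j))

theorem ratio_inv (a : ι → ℂ) (b : κ → ℂ) (z : K) : (ratio a b z)⁻¹ = ratio b a z :=
  inv_div _ _

theorem ratio_ne_zero {a : ι → ℂ} {b : κ → ℂ} {z : K} (hz : ∀ α, localCoord z α ≠ 0) :
    ratio a b z ≠ 0 :=
  div_ne_zero (Finset.prod_ne_zero_iff.2 fun i _ => hz (some (a i)))
    (Finset.prod_ne_zero_iff.2 fun j _ => hz (some (b j)))

theorem unitAt_const (hc : ∀ c : ℂ, algebraMap ℂ K c ∈ R.toSubring) {α : ℂ} (h : α ≠ 0) :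
    UnitAt R (algebraMap ℂ K α) :=
  unitAt_of_not_vanishes (hc α) (not_vanishes_const hc h)

theorem unitAt_sub_of_ne (hc : ∀ c : ℂ, algebraMap ℂ K c ∈ R.toSubring) {z : K} {α β : ℂ}
    (h : Vanishes R (z - algebraMap ℂ K α)) (hne : β ≠ α) :
    UnitAt R (z - algebraMap ℂ K β) := by
  have := (unitAt_const hc (sub_ne_zero.2 hne.symm)).add_vanishes h
  rw [map_sub] at this
  convert this using 1
  ring

/-- Near `z = a i₀` the function `ratio a b` has a simple zero. -/
theorem exists_ratio_eq {a : ι → ℂ} {b : κ → ℂ} (hab : Function.Injective (Sum.elim a b)) (i₀ : ι)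
    {z : K} (hc : ∀ c : ℂ, algebraMap ℂ K c ∈ R.toSubring)
    (h : Vanishes R (z - algebraMap ℂ K (a i₀))) :
    ∃ k : K, UnitAt R k ∧ k ∈ locSub R {z - algebraMap ℂ K (a i₀)} ∧
      ratio a b z = (z - algebraMap ℂ K (a i₀)) * k := by
  classical
  have hL : ∀ c : ℂ, z - algebraMap ℂ K c ∈ locSub R {z - algebraMap ℂ K (a i₀)} := by
    intro c
    have := add_mem (subset_locSub (R := R) (Set.mem_singleton (z - algebraMap ℂ K (a i₀))))
      (Subalgebra.algebraMap_mem _ (a i₀ - c))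
    rw [map_sub] at this
    convert this using 1
    ring
  have hN : UnitAt R (∏ i ∈ Finset.univ.erase i₀, (z - algebraMap ℂ K (a i))) :=
    UnitAt.prod fun i hi => unitAt_sub_of_ne hc h fun he =>
      Finset.ne_of_mem_erase hi (Sum.inl_injective (hab (a₁ := .inl i) (a₂ := .inl i₀) he))
  have hD : UnitAt R (∏ j, (z - algebraMap ℂ K (b j))) :=
    UnitAt.prod fun j _ => unitAt_sub_of_ne hc h fun he =>
      Sum.inr_ne_inl (hab (a₁ := .inr j) (a₂ := .inl i₀) he)
  refine ⟨_, hN.div hD, div_mem_locSub (prod_mem fun i _ => hL _) (prod_mem fun i _ => hL _) hD, ?_⟩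
  rw [ratio, ← Finset.mul_prod_erase _ _ (Finset.mem_univ i₀), mul_div_assoc]

theorem exists_prod_one_sub_mul {ι : Type*} (s : Finset ι) (a : ι → ℂ) (u : K) :
    ∃ k ∈ Algebra.adjoin ℂ {u}, ∏ i ∈ s, (1 - algebraMap ℂ K (a i) * u) =
      1 - algebraMap ℂ K (∑ i ∈ s, a i) * u + u ^ 2 * k := by
  classical
  have hu : u ∈ Algebra.adjoin ℂ {u} := Algebra.subset_adjoin rfl
  induction s using Finset.induction_on with
  | empty => exact ⟨0, zero_mem _, by simp⟩
  | insert i s hi ih =>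
    obtain ⟨k, hk, e⟩ := ih
    refine ⟨algebraMap ℂ K (a i * ∑ i ∈ s, a i) + k - algebraMap ℂ K (a i) * u * k,
      sub_mem (add_mem (Subalgebra.algebraMap_mem _ _) hk)
        (mul_mem (mul_mem (Subalgebra.algebraMap_mem _ _) hu) hk), ?_⟩
    rw [Finset.prod_insert hi, Finset.sum_insert hi, e, map_mul, map_add]
    ring

theorem prod_sub_eq_pow_mul {ι : Type*} [Fintype ι] (a : ι → ℂ) {z : K} (hz : z ≠ 0) :
    ∏ i, (z - algebraMap ℂ K (a i)) =
      z ^ Fintype.card ι * ∏ i, (1 - algebraMap ℂ K (a i) * z⁻¹) := by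
  rw [Fintype.card, ← Finset.prod_const, ← Finset.prod_mul_distrib]
  refine Finset.prod_congr rfl fun i _ => ?_
  field_simp

/-- The expansion of `ratio a b` at infinity. -/
theorem exists_ratio_eq_infinity (a : ι → ℂ) (b : κ → ℂ) (hcard : Fintype.card ι = Fintype.card κ + 2)
    {z : K} (hz : z ≠ 0) (hc : ∀ c : ℂ, algebraMap ℂ K c ∈ R.toSubring) (h : Vanishes R z⁻¹) :
    ∃ e : K, e ∈ R.toSubring ∧ e ∈ locSub R {z⁻¹} ∧
      ratio a b z = z ^ 2 * (1 + algebraMap ℂ K (∑ j, b j - ∑ i, a i) * z⁻¹ + e * z⁻¹ ^ 2) := by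
  obtain ⟨k₁, hk₁, e₁⟩ := exists_prod_one_sub_mul Finset.univ a z⁻¹
  obtain ⟨k₂, hk₂, e₂⟩ := exists_prod_one_sub_mul Finset.univ b z⁻¹
  have hD : UnitAt R (∏ j, (1 - algebraMap ℂ K (b j) * z⁻¹)) :=
    UnitAt.prod fun j _ => unitAt_one.sub_vanishes (Vanishes.mul (hc _) h)
  have hR : ∀ {k}, k ∈ locSub R {z⁻¹} → k ∈ R.toSubring := fun {k} hk =>
    locSub_le_of_const hc (by rintro _ rfl; exact h.1) hk
  have hu : z⁻¹ ∈ locSub R {z⁻¹} := subset_locSub rfl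
  set D := ∏ j, (1 - algebraMap ℂ K (b j) * z⁻¹) with hDdef
  set c := algebraMap ℂ K (∑ j, b j - ∑ i, a i) with hcdef
  set σ := algebraMap ℂ K (∑ j, b j) with hσ
  have hmem : ((k₁ - k₂) + c * σ - c * z⁻¹ * k₂) / D ∈ locSub R {z⁻¹} := by
    refine div_mem_locSub ?_ ?_ hD
    · refine sub_mem (add_mem (sub_mem (adjoin_le_locSub hk₁) (adjoin_le_locSub hk₂))
        (mul_mem (Subalgebra.algebraMap_mem _ _) (Subalgebra.algebraMap_mem _ _)))
        (mul_mem (mul_mem (Subalgebra.algebraMap_mem _ _) hu) (adjoin_le_locSub hk₂))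
    · exact prod_mem fun j _ => sub_mem (one_mem _) (mul_mem (Subalgebra.algebraMap_mem _ _) hu)
  refine ⟨_, hR hmem, hmem, ?_⟩
  have hD0 := hD.1
  rw [ratio, prod_sub_eq_pow_mul a hz, prod_sub_eq_pow_mul b hz, ← hDdef, hcard, e₁, pow_add,
    mul_assoc, mul_div_mul_left _ _ (pow_ne_zero _ hz), mul_div_assoc]
  congr 1
  have hca : algebraMap ℂ K (∑ i, a i) = σ - c := by rw [hcdef, hσ, map_sub]; ring
  rw [hca, div_eq_iff hD0]
  have e3 : ∀ X : K, (1 + c * z⁻¹ + X / D * z⁻¹ ^ 2) * D = (1 + c * z⁻¹) * D + X * z⁻¹ ^ 2 := by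
    intro X; field_simp
  rw [e3, e₂]
  ring

end Ratio

section Involution

variable {R : LocalSubring K} {z w w' : K} {S T B B' : Set ℂ} {α : ℂ}

/-- The centres of the blow-up: the points `(α, -α)` for `α ∈ S`, the points `(β, ∞)` for `β ∈ T`
and the points `(∞, γ)` for `γ ∈ B`. -/
def fibCenters (S T B : Set ℂ) : Set Pt :=
  {p | (∃ α ∈ S, p = (some α, some (-α))) ∨ (∃ β ∈ T, p = (some β, none)) ∨
    ∃ γ ∈ B, p = (none, some γ)}

theorem mem_locSub_sub (z : K) (α : ℂ) : z ∈ locSub R {z - algebraMap ℂ K α} := by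
  have := add_mem (subset_locSub (R := R) (Set.mem_singleton (z - algebraMap ℂ K α)))
      (Subalgebra.algebraMap_mem _ α)
  simpa using this

/-- The charts of the blow-up near the fibre `z = α` over a zero `α`. -/
theorem onBlowUp_zero_iff (hz : ∀ α, localCoord z α ≠ 0) (hw : ∀ α, localCoord w α ≠ 0)
    (hwz : w + z ≠ 0) (hc : ∀ c : ℂ, algebraMap ℂ K c ∈ R.toSubring)
    (hα : α ∈ S) (hαT : α ∉ T) (hu : Vanishes R (z - algebraMap ℂ K α)) :
    OnBlowUp z w (fibCenters S T B) R ↔ FibPoint R (z - algebraMap ℂ K α) (w + z) := by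
  have hz0 : z ≠ 0 := by simpa [localCoord] using hz (some 0)
  have hw0 : w ≠ 0 := by simpa [localCoord] using hw (some 0)
  have hzR : z ∈ R.toSubring := by simpa using add_mem hu.1 (hc α)
  have e : w + z = w - algebraMap ℂ K (-α) + (z - algebraMap ℂ K α) := by
    rw [map_neg]; ring
  refine onBlowUp_iff_fibPoint (p := (some α, some (-α))) hz0 hwz (.inl ⟨α, hα, rfl⟩)
    (hz (some α)) hu ?_ (planePoint_add_iff hw0 hwz hzR (mem_locSub_sub z α)) ?_ fun _ => ?_
  · rintro p' (⟨α', hα', rfl⟩ | ⟨β, hβ, rfl⟩ | ⟨γ, hγ, rfl⟩) h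
    · obtain rfl : α' = α := Option.some_injective _ h
      rfl
    · obtain rfl : β = α := Option.some_injective _ h
      exact absurd hβ hαT
    · exact absurd h (by simp)
  · change Vanishes R (w - algebraMap ℂ K (-α)) ↔ _
    rw [e]
    exact ⟨fun h => h.add hu, fun h => by have := h.sub hu; rwa [add_sub_cancel_right] at this⟩
  · change ExcPoint R (z - algebraMap ℂ K α) (w - algebraMap ℂ K (-α)) ↔ _
    constructor
    · exact ExcPoint.change (hz (some α)) (hw (some (-α))) (ε := 1) (k := 1) (by rw [e]; ring)
        unitAt_one (one_mem _) (one_mem _) (one_mem _)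
    · exact ExcPoint.change (hz (some α)) hwz (ε := 1) (k := -1)
        (by rw [e]; change _ = 1 * _ + -1 * (z - algebraMap ℂ K α); ring)
        unitAt_one (neg_mem (one_mem _)) (one_mem _) (neg_mem (one_mem _))

/-- The charts of the blow-up near the fibre `z = α` over a pole `α`. -/
theorem onBlowUp_pole_iff (hz : ∀ α, localCoord z α ≠ 0) (hw : ∀ α, localCoord w α ≠ 0)
    (hwz : w + z ≠ 0) (hc : ∀ c : ℂ, algebraMap ℂ K c ∈ R.toSubring)
    (hα : α ∈ T) (hαS : α ∉ S) (hu : Vanishes R (z - algebraMap ℂ K α)) :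
    OnBlowUp z w (fibCenters S T B) R ↔ FibPoint R (z - algebraMap ℂ K α) (w + z)⁻¹ := by
  have hz0 : z ≠ 0 := by simpa [localCoord] using hz (some 0)
  have hw0 : w ≠ 0 := by simpa [localCoord] using hw (some 0)
  have hzR : z ∈ R.toSubring := by simpa using add_mem hu.1 (hc α)
  have hzL : ∀ {t : K}, z ∈ locSub R {z - algebraMap ℂ K α, t} := fun {t} =>
    locSub_le (by rintro _ rfl; exact left_mem_locSub) (mem_locSub_sub z α)
  have h2 := vanishes_inv_add_iff hw0 hwz hzR
  refine onBlowUp_iff_fibPoint (p := (some α, none)) hz0 (inv_ne_zero hwz)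
    (.inr (.inl ⟨α, hα, rfl⟩)) (hz (some α)) hu ?_ ?_ h2 fun hq => ?_
  · rintro p' (⟨α', hα', rfl⟩ | ⟨β, hβ, rfl⟩ | ⟨γ, hγ, rfl⟩) h
    · obtain rfl : α' = α := Option.some_injective _ h
      exact absurd hα' hαS
    · obtain rfl : β = α := Option.some_injective _ h
      rfl
    · exact absurd h (by simp)
  · rw [inv_inv, or_comm (a := PlanePoint R _ (w + z)⁻¹)]
    exact planePoint_add_iff hw0 hwz hzR (mem_locSub_sub z α)
  · have hv := h2.2 hq
    change ExcPoint R (z - algebraMap ℂ K α) w⁻¹ ↔ _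
    constructor
    · refine ExcPoint.change (hz (some α)) (inv_ne_zero hw0) (ε := 1 - z * (w + z)⁻¹) (k := 0) ?_
        (unitAt_one.sub_vanishes (Vanishes.mul hzR hq)) (zero_mem _)
        (sub_mem (one_mem _) (mul_mem hzL right_mem_locSub)) (zero_mem _)
      field_simp
      ring
    · refine ExcPoint.change (hz (some α)) (inv_ne_zero hwz) (ε := 1 + z * w⁻¹) (k := 0) ?_
        (unitAt_one.add_vanishes (Vanishes.mul hzR hv)) (zero_mem _)
        (add_mem (one_mem _) (mul_mem hzL right_mem_locSub)) (zero_mem _)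
      field_simp
      ring

/-- Away from the fibres through the centres, the blow-up is a trivial `ℙ¹`-bundle. -/
theorem onBlowUp_generic_iff {Z : Set Pt} (hw0 : w ≠ 0) (hwz : w + z ≠ 0)
    (hz : z ∈ R.toSubring) (hZ : ∀ p ∈ Z, ¬ Vanishes R (localCoord z p.1)) :
    OnBlowUp z w Z R ↔ PlanePoint R z (w + z) ∨ PlanePoint R z (w + z)⁻¹ := by
  have e : localCoord z (some 0) = z := by simp [localCoord]
  have h1 : OnBlowUp z w Z R ↔ OnP1P1 z w R := by
    constructor
    · rintro (h | ⟨p, hp, h, -⟩)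
      · exact h.1
      · exact absurd h.1 (hZ p hp)
    · exact fun h => .inl ⟨h, fun p hp hl => hZ p hp hl.1⟩
  rw [h1, ← planePoint_add_iff hw0 hwz hz (subset_locSub rfl)]
  constructor
  · intro h
    have := h.of_left_mem (α := some 0) (by rwa [e])
    rwa [e] at this
  · intro h
    exact .of_planePoint (α := some 0) (by rwa [e])

theorem mem_or_vanishes_inv (h : z ∈ R.toSubring ∨ z⁻¹ ∈ R.toSubring) :
    z ∈ R.toSubring ∨ Vanishes R z⁻¹ := by
  by_cases hz : z ∈ R.toSubring
  · exact .inl hz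
  · exact .inr (vanishes_inv_of_notMem hz (h.resolve_left hz))

section infinity

variable {c e : K}

/-- Near the fibre `z = ∞`, with `u = z⁻¹`, the involution is `w ↦ c - w + O(u)`. -/
theorem mem_of_relation (hu : Vanishes R z⁻¹) (hc : c ∈ R.toSubring) (he : e ∈ R.toSubring)
    (h : w + w' + z⁻¹ * w * w' = c + e * z⁻¹) (hw : w ∈ R.toSubring) :
    w' ∈ R.toSubring ∧ UnitAt R (1 + z⁻¹ * w) ∧ w' = (c + e * z⁻¹ - w) / (1 + z⁻¹ * w) := by
  have h1 : UnitAt R (1 + z⁻¹ * w) := unitAt_one.add_vanishes (hu.mul_right hw)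
  have e1 : w' = (c + e * z⁻¹ - w) / (1 + z⁻¹ * w) := by
    rw [eq_div_iff h1.1]; linear_combination h
  refine ⟨?_, h1, e1⟩
  rw [e1, div_eq_mul_inv]
  exact mul_mem (sub_mem (add_mem hc (mul_mem he hu.1)) hw) h1.2.2

/-- Near the point `z = w = ∞`, which the involution fixes. -/
theorem inv_eq_of_relation (hw0 : w ≠ 0) (hw0' : w' ≠ 0) (hu : Vanishes R z⁻¹)
    (hc : c ∈ R.toSubring) (he : e ∈ R.toSubring)
    (h : w + w' + z⁻¹ * w * w' = c + e * z⁻¹) (hw : Vanishes R w⁻¹) :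
    UnitAt R ((c + e * z⁻¹) * w⁻¹ - 1) ∧ w'⁻¹ = (w⁻¹ + z⁻¹) / ((c + e * z⁻¹) * w⁻¹ - 1) := by
  have h1 : UnitAt R ((c + e * z⁻¹) * w⁻¹ - 1) := by
    have := (unitAt_one.sub_vanishes (Vanishes.mul (add_mem hc (mul_mem he hu.1)) hw)).neg
    rwa [neg_sub] at this
  refine ⟨h1, ?_⟩
  rw [eq_div_iff h1.1]
  field_simp
  linear_combination -h

/-- Near the fibre `z = ∞` the involution maps the blow-up to the one with reflected centres. -/
theorem OnBlowUp.transform_infinity (hz0 : z ≠ 0) (hw : ∀ α, localCoord w α ≠ 0) (hw0' : w' ≠ 0)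
    {γ₀ : ℂ} (hu : Vanishes R z⁻¹) (he : e ∈ R.toSubring) (heL : e ∈ locSub R {z⁻¹})
    (h : w + w' + z⁻¹ * w * w' = algebraMap ℂ K γ₀ + e * z⁻¹)
    (hB : ∀ γ, γ ∈ B' ↔ γ₀ - γ ∈ B)
    (hR : OnBlowUp z w (fibCenters S T B) R) : OnBlowUp z w' (fibCenters S T B') R := by
  have hw0 : w ≠ 0 := by simpa [localCoord] using hw (some 0)
  have hc := hR.const
  have h' : w' + w + z⁻¹ * w' * w = algebraMap ℂ K γ₀ + e * z⁻¹ := by rw [← h]; ring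
  have hL : ∀ {t : K}, e ∈ locSub R {z⁻¹, t} := fun {t} =>
    locSub_le (by rintro _ rfl; exact left_mem_locSub) heL
  have hnone : ∀ {B : Set ℂ}, ∀ p ∈ fibCenters S T B, Vanishes R (localCoord z p.1) →
      ∃ γ ∈ B, p = (none, some γ) := by
    rintro B p hp hl
    have hp1 : p.1 = none := localCoord_unique hc hz0 (β := none) hl hu
    rcases hp with (⟨α', hα', rfl⟩ | ⟨β, hβ, rfl⟩ | h)
    · exact absurd hp1 (by simp)
    · exact absurd hp1 (by simp)
    · exact h
  have hiff : w ∈ R.toSubring → w' ∈ R.toSubring → ∀ γ : ℂ,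
      Vanishes R (w' - algebraMap ℂ K γ) → Vanishes R (w - algebraMap ℂ K (γ₀ - γ)) := by
    intro hw hw' γ hv
    have : w - algebraMap ℂ K (γ₀ - γ) =
        z⁻¹ * (e - w * w') - (w' - algebraMap ℂ K γ) := by
      rw [map_sub]; linear_combination h
    rw [this]
    exact (hu.mul_right (sub_mem he (mul_mem hw hw'))).sub hv
  rcases hR with ⟨hP, hn⟩ | ⟨p, hp, hl, hE⟩
  · have hP' := hP.of_left_mem (α := none) hu.1
    by_cases hwR : w ∈ R.toSubring
    · have hP' : PlanePoint R z⁻¹ w := hP'.elim id fun h => h.of_inv hwR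
      have hw' := mem_of_relation hu (hc _) he h hwR
      have hw2 := mem_of_relation hu (hc _) he h' hw'.1
      refine .inl ⟨.of_planePoint (α := none) (.inl ?_), fun p hp hl => ?_⟩
      · refine hP'.change hP'.left hw'.1 left_mem_locSub ?_
        rw [hw2.2.2]
        exact div_mem_locSub (sub_mem (add_mem (Subalgebra.algebraMap_mem _ _)
          (mul_mem hL left_mem_locSub)) right_mem_locSub)
          (add_mem (one_mem _) (mul_mem left_mem_locSub right_mem_locSub)) hw2.2.1
      · obtain ⟨γ, hγ, rfl⟩ := hnone p hp hl.1
        exact hn (none, some (γ₀ - γ)) (.inr (.inr ⟨_, (hB γ).1 hγ, rfl⟩))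
          ⟨hu, hiff hwR hw'.1 γ hl.2⟩
    · have hP' : PlanePoint R z⁻¹ w⁻¹ := hP'.resolve_left fun h => hwR h.right
      have hv := vanishes_inv_of_notMem hwR hP'.right
      have h1 := inv_eq_of_relation hw0 hw0' hu (hc _) he h hv
      have hv' : Vanishes R w'⁻¹ := by
        rw [h1.2, div_eq_mul_inv]; exact (hv.add hu).mul_right h1.1.2.2
      have h2 := inv_eq_of_relation hw0' hw0 hu (hc _) he h' hv'
      refine .inl ⟨.of_planePoint (α := none) (.inr ?_), fun p hp hl => ?_⟩
      · refine hP'.change hP'.left hv'.1 left_mem_locSub ?_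
        rw [h2.2]
        exact div_mem_locSub (add_mem right_mem_locSub left_mem_locSub)
          (sub_mem (mul_mem (add_mem (Subalgebra.algebraMap_mem _ _)
          (mul_mem hL left_mem_locSub)) right_mem_locSub) (one_mem _)) h2.1
      · obtain ⟨γ, hγ, rfl⟩ := hnone p hp hl.1
        refine notMem_of_vanishes_inv hw0' hv' ?_
        simpa [localCoord] using add_mem hl.2.1 (hc γ)
  · obtain ⟨γ, hγ, rfl⟩ := hnone p hp hl.1
    have hwR : w ∈ R.toSubring := by simpa [localCoord] using add_mem hl.2.1 (hc γ)
    have hw' := mem_of_relation hu (hc _) he h hwR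
    have hw2 := mem_of_relation hu (hc _) he h' hw'.1
    have hl2 : Vanishes R (w - algebraMap ℂ K γ) := hl.2
    have e1 : w' - algebraMap ℂ K (γ₀ - γ) =
        -1 * (w - algebraMap ℂ K γ) + (e - w * w') * z⁻¹ := by
      rw [map_sub]; linear_combination h
    have hL' : w' ∈ locSub R {z⁻¹, w' - algebraMap ℂ K (γ₀ - γ)} := by
      have := add_mem (right_mem_locSub (R := R) (s := z⁻¹) (t := w' - algebraMap ℂ K (γ₀ - γ)))
        (Subalgebra.algebraMap_mem _ (γ₀ - γ))
      simpa using this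
    have hk : e - w * w' ∈ R.toSubring := sub_mem he (mul_mem hwR hw'.1)
    refine .inr ⟨(none, some (γ₀ - γ)), .inr (.inr ⟨_, (hB _).2 (by simpa using hγ), rfl⟩),
      ⟨hu, ?_⟩, ?_⟩
    · change Vanishes R (w' - algebraMap ℂ K (γ₀ - γ))
      rw [e1]
      exact (Vanishes.mul (neg_mem (one_mem _)) hl2).add (Vanishes.mul hk hu)
    · refine ExcPoint.change (inv_ne_zero hz0) (hw (some γ)) e1 unitAt_one.neg hk
        (neg_mem (one_mem _)) (sub_mem hL (mul_mem ?_ hL')) hE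
      nth_rw 1 [hw2.2.2]
      exact div_mem_locSub (sub_mem (add_mem (Subalgebra.algebraMap_mem _ _)
          (mul_mem hL left_mem_locSub)) hL')
          (add_mem (one_mem _) (mul_mem left_mem_locSub hL')) hw2.2.1

end infinity

variable {ι κ : Type*} [Fintype ι] [Fintype κ] {a : ι → ℂ} {b : κ → ℂ}

/-- The functions `w` and `w'` are exchanged by the involution of `K` over `ℂ(z)` for which
`(w + z) (w' + z) = ∏ (z - a_i) / ∏ (z - b_j)`. -/
structure Conjugate (a : ι → ℂ) (b : κ → ℂ) (z w w' : K) : Prop where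
  base : ∀ α, localCoord z α ≠ 0
  left : ∀ α, localCoord w α ≠ 0
  right : ∀ α, localCoord w' α ≠ 0
  mul_eq : (w + z) * (w' + z) = ratio a b z

theorem Conjugate.symm (h : Conjugate a b z w w') : Conjugate a b z w' w :=
  ⟨h.base, h.right, h.left, by rw [mul_comm, h.mul_eq]⟩

theorem Conjugate.base_ne_zero (h : Conjugate a b z w w') : z ≠ 0 := by
  simpa [localCoord] using h.base (some 0)

theorem Conjugate.left_ne_zero (h : Conjugate a b z w w') : w ≠ 0 := by
  simpa [localCoord] using h.left (some 0)

theorem Conjugate.add_ne_zero (h : Conjugate a b z w w') : w + z ≠ 0 :=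
  left_ne_zero_of_mul (h.mul_eq.trans_ne (ratio_ne_zero h.base))

/-- The equation of the involution in the coordinate `z⁻¹` at infinity. -/
theorem Conjugate.relation (h : Conjugate a b z w w') {c e : K}
    (hr : ratio a b z = z ^ 2 * (1 + c * z⁻¹ + e * z⁻¹ ^ 2)) :
    w + w' + z⁻¹ * w * w' = c + e * z⁻¹ := by
  have hz0 := h.base_ne_zero
  have h1 := h.mul_eq.trans hr
  field_simp at h1 ⊢
  linear_combination h1

/-- The involution lifts to the blow-ups. It preserves the fibres `z = const`: over a zero or a pole
it is an elementary transformation, over `z = ∞` it is the reflection `γ ↦ (∑ b - ∑ a) - γ`, so that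
the centres on this line have to be reflected, and over the other points there are no centres. -/
theorem Conjugate.transform (h : Conjugate a b z w w')
    (hab : Function.Injective (Sum.elim a b)) (hcard : Fintype.card ι = Fintype.card κ + 2)
    (hB : ∀ γ, γ ∈ B' ↔ (∑ j, b j - ∑ i, a i) - γ ∈ B)
    (hR : OnBlowUp z w (fibCenters (Set.range a) (Set.range b) B) R) :
    OnBlowUp z w' (fibCenters (Set.range a) (Set.range b) B') R := by
  have hz0 := h.base_ne_zero
  have hc := hR.const
  have hdisj : ∀ i j, a i ≠ b j := fun i j he =>
    Sum.inl_ne_inr (hab (a₁ := .inl i) (a₂ := .inr j) he)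
  rcases mem_or_vanishes_inv hR.left_mem with hzR | hu
  · by_cases hS : ∃ i, Vanishes R (z - algebraMap ℂ K (a i))
    · obtain ⟨i, hi⟩ := hS
      have hT : a i ∉ Set.range b := by rintro ⟨j, hj⟩; exact hdisj i j hj.symm
      obtain ⟨k, hk, hkL, e⟩ := exists_ratio_eq hab i hc hi
      rw [onBlowUp_zero_iff h.base h.left h.add_ne_zero hc (Set.mem_range_self i) hT hi] at hR
      rw [onBlowUp_zero_iff h.base h.right h.symm.add_ne_zero hc (Set.mem_range_self i) hT hi]
      exact hR.transform (h.base (some (a i))) h.add_ne_zero h.symm.add_ne_zero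
        (h.mul_eq.trans e) hk hkL
    · by_cases hT : ∃ j, Vanishes R (z - algebraMap ℂ K (b j))
      · obtain ⟨j, hj⟩ := hT
        have hS' : b j ∉ Set.range a := by rintro ⟨i, hi⟩; exact hdisj i j hi
        have hba : Function.Injective (Sum.elim b a) := by
          rw [← Sum.elim_swap]; exact hab.comp (Equiv.sumComm κ ι).injective
        obtain ⟨k, hk, hkL, e⟩ := exists_ratio_eq hba j hc hj
        rw [onBlowUp_pole_iff h.base h.left h.add_ne_zero hc (Set.mem_range_self j) hS' hj] at hR
        rw [onBlowUp_pole_iff h.base h.right h.symm.add_ne_zero hc (Set.mem_range_self j) hS' hj]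
        refine hR.transform (h.base (some (b j))) (inv_ne_zero h.add_ne_zero)
          (inv_ne_zero h.symm.add_ne_zero) ?_ hk hkL
        rw [← mul_inv, h.mul_eq, ratio_inv, e]
      · push Not at hS hT
        have hZ : ∀ {B : Set ℂ}, ∀ p ∈ fibCenters (Set.range a) (Set.range b) B,
            ¬ Vanishes R (localCoord z p.1) := by
          rintro B p (⟨_, ⟨i, rfl⟩, rfl⟩ | ⟨_, ⟨j, rfl⟩, rfl⟩ | ⟨γ, hγ, rfl⟩)
          · exact hS i
          · exact hT j
          · exact fun hv => notMem_of_vanishes_inv hz0 hv hzR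
        have hg : UnitAt R (ratio a b z) :=
          (UnitAt.prod fun i _ => unitAt_of_not_vanishes (sub_mem hzR (hc _)) (hS i)).div
            (UnitAt.prod fun j _ => unitAt_of_not_vanishes (sub_mem hzR (hc _)) (hT j))
        have hgL : ∀ {t : K}, ratio a b z ∈ locSub R {z, t} := fun {t} =>
          div_mem_locSub
            (prod_mem fun i _ => sub_mem left_mem_locSub (Subalgebra.algebraMap_mem _ _))
            (prod_mem fun i _ => sub_mem left_mem_locSub (Subalgebra.algebraMap_mem _ _))
            (UnitAt.prod fun j _ => unitAt_of_not_vanishes (sub_mem hzR (hc _)) (hT j))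
        rw [onBlowUp_generic_iff h.left_ne_zero h.add_ne_zero hzR hZ] at hR
        rw [onBlowUp_generic_iff h.symm.left_ne_zero h.symm.add_ne_zero hzR hZ]
        have hs0 := h.add_ne_zero
        have ht0 := h.symm.add_ne_zero
        have hg0 := hg.1
        rcases hR with hR | hR
        · have e1 : (w' + z)⁻¹ = (w + z) / ratio a b z := by
            rw [← h.mul_eq]; field_simp
          have e2 : w + z = (w' + z)⁻¹ * ratio a b z := by rw [e1]; field_simp
          refine .inr (hR.change hzR ?_ left_mem_locSub ?_)
          · rw [e1]; exact mul_mem hR.right hg.2.2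
          · nth_rw 1 [e2]; exact mul_mem right_mem_locSub hgL
        · have e1 : w' + z = (w + z)⁻¹ * ratio a b z := by
            rw [← h.mul_eq]; field_simp
          have e2 : (w + z)⁻¹ = (w' + z) / ratio a b z := by rw [e1]; field_simp
          refine .inl (hR.change hzR ?_ left_mem_locSub ?_)
          · rw [e1]; exact mul_mem hR.right hg.2.1
          · rw [e2]; exact div_mem_locSub right_mem_locSub hgL hg
  · obtain ⟨e, he, heL, hr⟩ := exists_ratio_eq_infinity a b hcard hz0 hc hu
    exact hR.transform_infinity hz0 h.left h.symm.left_ne_zero hu he heL (h.relation hr) hB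

end Involution

/-! ### Prime divisors of factorial affine models -/

section PrimePoint

variable {F : Type*} [Field F] {R V W : LocalSubring F}

/-- `ϖ` generates the maximal ideal of `V`, and `V` is a discrete valuation ring of `F`. These `V`
stand for the prime divisors of a surface. -/
structure IsUniformizer (V : LocalSubring F) (ϖ : F) : Prop where
  ne_zero : ϖ ≠ 0
  vanishes : Vanishes V ϖ
  exists_zpow : ∀ z : F, z ≠ 0 → ∃ k : ℤ, UnitAt V (z / ϖ ^ k)

/-- A discrete valuation ring is a maximal proper subring of `F`. -/
theorem IsUniformizer.eq_of_le {ϖ p : F} (h : IsUniformizer V ϖ) (hp0 : p ≠ 0)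
    (hp : Vanishes W p) (hle : V.toSubring ≤ W.toSubring) : V = W := by
  refine LocalSubring.toSubring_injective (le_antisymm hle fun z hz => ?_)
  by_contra hzV
  have hz0 : z ≠ 0 := by rintro rfl; exact hzV (zero_mem _)
  have hϖ0 := h.ne_zero
  obtain ⟨k, hk⟩ := h.exists_zpow z hz0
  have hϖW : UnitAt W ϖ := by
    obtain ⟨n, rfl | rfl⟩ := k.eq_nat_or_neg
    · refine absurd ?_ hzV
      have := mul_mem hk.2.1 (pow_mem h.vanishes.1 n)
      simpa [hϖ0] using this
    · match n with
      | 0 => exact absurd (by simpa using hk.2.1) hzV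
      | n + 1 =>
        have e : ϖ⁻¹ = z * ((z / ϖ ^ (-((n + 1 : ℕ) : ℤ)))⁻¹ * ϖ ^ n) := by
          rw [zpow_neg, zpow_natCast]
          field_simp
          ring
        refine ⟨hϖ0, hle h.vanishes.1, ?_⟩
        rw [e]
        exact mul_mem hz (mul_mem (hle hk.2.2) (pow_mem (hle h.vanishes.1) n))
  obtain ⟨k, hk⟩ := h.exists_zpow p hp0
  have := (hk.mono hle).mul (hϖW.zpow k)
  rw [div_mul_cancel₀ _ (zpow_ne_zero k hϖ0)] at this
  exact this.not_vanishes hp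

theorem IsUniformizer.zpow_eq_zero {ϖ : F} (h : IsUniformizer V ϖ) {k : ℤ}
    (hk : UnitAt V (ϖ ^ k)) : k = 0 := by
  have hϖ : ∀ n : ℕ, UnitAt V (ϖ ^ n) → n = 0 := by
    intro n hn
    by_contra h0
    obtain ⟨n, rfl⟩ := Nat.exists_eq_succ_of_ne_zero h0
    rw [pow_succ] at hn
    exact hn.not_vanishes (Vanishes.mul (pow_mem h.vanishes.1 n) h.vanishes)
  obtain ⟨n, rfl | rfl⟩ := k.eq_nat_or_neg
  · rw [zpow_natCast] at hk
    simp [hϖ n hk]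
  · rw [zpow_neg, zpow_natCast] at hk
    have := hk.inv
    rw [inv_inv] at this
    simp [hϖ n this]

variable {A : Subring F} {π π' : A}

/-- The local ring of `Spec A` at the prime ideal generated by a prime element `π`. -/
def primePoint (hπ : Prime π) : LocalSubring F :=
  haveI := (Ideal.span_singleton_prime hπ.ne_zero).2 hπ
  LocalSubring.ofPrime A (Ideal.span {π})

theorem primePoint_mem_specModel (hπ : Prime π) : primePoint hπ ∈ specModel A :=
  ⟨_, (Ideal.span_singleton_prime hπ.ne_zero).2 hπ, rfl⟩

theorem le_primePoint (hπ : Prime π) : A ≤ (primePoint hπ).toSubring :=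
  (mem_specModel_iff.1 (primePoint_mem_specModel hπ)).1

theorem unitAt_primePoint (hπ : Prime π) {b : A} (hb : ¬ π ∣ b) :
    UnitAt (primePoint hπ) (b : F) := by
  have := (Ideal.span_singleton_prime hπ.ne_zero).2 hπ
  have hb0 : b ≠ 0 := by rintro rfl; exact hb (dvd_zero _)
  exact ⟨by simpa using hb0, le_primePoint hπ b.2,
    (inv_mem_ofPrime_iff hb0).2 (by rwa [Ideal.mem_span_singleton])⟩

theorem vanishes_primePoint (hπ : Prime π) : Vanishes (primePoint hπ) (π : F) := by
  have := (Ideal.span_singleton_prime hπ.ne_zero).2 hπ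
  rw [vanishes_iff (by simpa using hπ.ne_zero)]
  refine ⟨le_primePoint hπ π.2, fun h => ?_⟩
  exact (inv_mem_ofPrime_iff hπ.ne_zero).1 h (Ideal.mem_span_singleton_self π)

/-- The local ring of a point on the divisor of `π` is contained in that of the divisor. -/
theorem le_primePoint_of_vanishes (hR : R ∈ specModel A) (hπ : Prime π)
    (h : Vanishes R (π : F)) : R.toSubring ≤ (primePoint hπ).toSubring := by
  rw [mem_specModel_iff] at hR
  intro z hz
  obtain ⟨a, ha, b, hb, hb0, hi, rfl⟩ := hR.2 z hz
  refine mul_mem (le_primePoint hπ ha) (unitAt_primePoint hπ (b := ⟨b, hb⟩) ?_).2.2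
  rintro ⟨c, hc⟩
  have hc : b = π * c := congrArg Subtype.val hc
  have hv : Vanishes R b := by rw [hc]; exact h.mul_right (hR.1 c.2)
  exact ((vanishes_iff hb0).1 hv).2 hi

theorem eq_primePoint_of_vanishes {ϖ : F} (hR : R ∈ specModel A) (hϖ : IsUniformizer R ϖ)
    (hπ : Prime π) (h : Vanishes R (π : F)) : R = primePoint hπ :=
  hϖ.eq_of_le (by simpa using hπ.ne_zero) (vanishes_primePoint hπ)
    (le_primePoint_of_vanishes hR hπ h)

section UFD

variable [UniqueFactorizationMonoid A]

theorem exists_prime_vanishes (hA : A ≤ R.toSubring) (a : A) (ha : a ≠ 0)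
    (h : Vanishes R (a : F)) : ∃ π : A, Prime π ∧ π ∣ a ∧ Vanishes R (π : F) := by
  induction a using UniqueFactorizationMonoid.induction_on_prime with
  | h₁ => exact absurd rfl ha
  | h₂ b hb =>
    obtain ⟨c, hc⟩ := hb.exists_right_inv
    have hc' : (b : F) * c = 1 := congrArg Subtype.val hc
    exact absurd (hc' ▸ h.mul_right (hA c.2)) not_vanishes_one
  | h₃ a p ha0 hp ih =>
    rcases vanishes_or_unitAt (hA p.2) with hv | hu
    · exact ⟨p, hp, dvd_mul_right _ _, hv⟩
    · have hv : Vanishes R (a : F) := by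
        have := Vanishes.mul hu.2.2 h
        rwa [Subring.coe_mul, inv_mul_cancel_left₀ hu.1] at this
      obtain ⟨π, hπ, hd, hv⟩ := ih ha0 hv
      exact ⟨π, hπ, hd.mul_left _, hv⟩

variable [IsFractionRing A F]

theorem exists_reduced_div (z : F) (hz : z ≠ 0) :
    ∃ a b : A, a ≠ 0 ∧ b ≠ 0 ∧ IsRelPrime a b ∧ z = a / b := by
  obtain ⟨a, b, hab, rfl⟩ := IsFractionRing.exists_reduced_fraction A z
  have e : IsLocalization.mk' F a b = (a : F) / ((b : A) : F) := IsFractionRing.mk'_eq_div b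
  have hb0 : (b : A) ≠ 0 := nonZeroDivisors.ne_zero b.2
  refine ⟨a, b, ?_, hb0, hab, e⟩
  rintro rfl
  simp at hz

theorem isUniformizer_primePoint (hπ : Prime π) : IsUniformizer (primePoint hπ) (π : F) := by
  have hπ0 : (π : F) ≠ 0 := by simpa using hπ.ne_zero
  refine ⟨hπ0, vanishes_primePoint hπ, fun z hz => ?_⟩
  obtain ⟨a, b, ha, hb, -, rfl⟩ := exists_reduced_div (A := A) z hz
  obtain ⟨i, a, ha', rfl⟩ := WfDvdMonoid.max_power_factor ha hπ.irreducible
  obtain ⟨j, b, hb', rfl⟩ := WfDvdMonoid.max_power_factor hb hπ.irreducible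
  refine ⟨(i : ℤ) - j, ?_⟩
  convert (unitAt_primePoint hπ ha').div (unitAt_primePoint hπ hb') using 1
  have hb0 : (b : F) ≠ 0 := (unitAt_primePoint hπ hb').1
  rw [zpow_sub₀ hπ0, zpow_natCast, zpow_natCast]
  push_cast
  field_simp

/-- A rational function on a factorial model is a unit at a point if it is a unit along all
prime divisors through the point. -/
theorem unitAt_of_forall_primePoint (hR : R ∈ specModel A) {z : F} (hz : z ≠ 0)
    (h : ∀ (π : A) (hπ : Prime π), Vanishes R (π : F) → UnitAt (primePoint hπ) z) :
    UnitAt R z := by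
  have hA := (mem_specModel_iff.1 hR).1
  obtain ⟨a, b, ha, hb, hab, rfl⟩ := exists_reduced_div (A := A) z hz
  have hndvd : ∀ (π : A), Prime π → π ∣ a → ¬ π ∣ b := fun π hπ h h' =>
    hπ.not_isUnit (hab h h')
  have hua : UnitAt R (a : F) := by
    refine unitAt_of_not_vanishes (hA a.2) fun hv => ?_
    obtain ⟨π, hπ, hd, hv⟩ := exists_prime_vanishes hA a ha hv
    have h1 := (h π hπ hv).mul (unitAt_primePoint hπ (hndvd π hπ hd))
    obtain ⟨c, rfl⟩ := hd
    rw [div_mul_cancel₀ _ (by simpa using hb), Subring.coe_mul] at h1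
    exact h1.not_vanishes ((vanishes_primePoint hπ).mul_right (le_primePoint hπ c.2))
  have hub : UnitAt R (b : F) := by
    refine unitAt_of_not_vanishes (hA b.2) fun hv => ?_
    obtain ⟨π, hπ, hd, hv⟩ := exists_prime_vanishes hA b hb hv
    have h1 := (h π hπ hv).inv.mul (unitAt_primePoint hπ fun hd' => hndvd π hπ hd' hd)
    obtain ⟨c, rfl⟩ := hd
    rw [inv_div, div_mul_cancel₀ _ (by simpa using ha), Subring.coe_mul] at h1
    exact h1.not_vanishes ((vanishes_primePoint hπ).mul_right (le_primePoint hπ c.2))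
  exact hua.div hub

end UFD

end PrimePoint

/-! ### Affine planes with function field `ℂ(x, y)` -/

section IsPlane

variable {s t z : K} {R : LocalSubring K}

/-- The subring `ℂ[s, t]` of `K`. -/
abbrev coordRing (s t : K) : Subring K := (Algebra.adjoin ℂ {s, t}).toSubring

/-- `s` and `t` are coordinates of an affine plane with function field `K`. -/
structure IsPlane (s t : K) : Prop where
  algInd : AlgebraicIndependent ℂ ![s, t]
  adjoin_eq : IntermediateField.adjoin ℂ (Set.range ![s, t]) = ⊤

theorem range_pair (s t : K) : Set.range ![s, t] = {s, t} := by
  simp [Matrix.range_cons, Set.pair_comm]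

theorem algebraicIndependent_xy : AlgebraicIndependent ℂ ![x, y] := by
  have h : (Algebra.ofId (MvPolynomial (Fin 2) ℂ) K).restrictScalars ℂ ∘ MvPolynomial.X =
      ![x, y] := by
    ext i
    fin_cases i <;> rfl
  rw [← h]
  exact (MvPolynomial.algebraicIndependent_X (Fin 2) ℂ).map'
    (IsFractionRing.injective (MvPolynomial (Fin 2) ℂ) K)

/-- Two functions that generate `K` over `ℂ` are algebraically independent, as the transcendence
degree is `2`. -/
theorem isPlane_of_mem (hx : x ∈ IntermediateField.adjoin ℂ {s, t})
    (hy : y ∈ IntermediateField.adjoin ℂ {s, t}) : IsPlane s t := by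
  have htop : IntermediateField.adjoin ℂ (Set.range ![s, t]) = ⊤ := by
    rw [range_pair, eq_top_iff]
    rintro z -
    have hpoly : ∀ p : MvPolynomial (Fin 2) ℂ, algebraMap (MvPolynomial (Fin 2) ℂ) K p ∈
        IntermediateField.adjoin ℂ {s, t} := by
      intro p
      induction p using MvPolynomial.induction_on with
      | C c =>
        rw [← MvPolynomial.algebraMap_eq, ← IsScalarTower.algebraMap_apply]
        exact IntermediateField.algebraMap_mem _ c
      | add p q hp hq => rw [map_add]; exact add_mem hp hq
      | mul_X p i hp =>
        rw [map_mul]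
        refine mul_mem hp ?_
        fin_cases i
        · exact hx
        · exact hy
    obtain ⟨a, b, -, rfl⟩ := IsFractionRing.div_surjective (A := MvPolynomial (Fin 2) ℂ) z
    exact div_mem (hpoly a) (hpoly b)
  refine ⟨?_, htop⟩
  have halg : Algebra.IsAlgebraic (Algebra.adjoin ℂ (Set.range ![s, t])) K := by
    refine ⟨fun z => ?_⟩
    have hz : z ∈ IntermediateField.adjoin ℂ (Set.range ![s, t]) := htop ▸ trivial
    obtain ⟨a, ha, b, hb, rfl⟩ := IntermediateField.mem_adjoin_iff_div.1 hz
    have h1 := isAlgebraic_algebraMap (R := Algebra.adjoin ℂ (Set.range ![s, t])) (A := K) ⟨a, ha⟩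
    have h2 := isAlgebraic_algebraMap (R := Algebra.adjoin ℂ (Set.range ![s, t])) (A := K) ⟨b, hb⟩
    rw [div_eq_mul_inv]
    exact h1.mul h2.inv
  have hle : Cardinal.mk (Fin 2) ≤ Algebra.trdeg ℂ K := by
    have := algebraicIndependent_xy.lift_cardinalMk_le_trdeg
    simpa using this
  exact (Algebra.IsAlgebraic.isTranscendenceBasis_of_lift_le_trdeg_of_finite ℂ ![s, t]
    (by simpa using hle)).1

/-- The automorphism of `K` that sends `x` and `y` to given coordinates. -/
def IsPlane.equiv (h : IsPlane s t) : K ≃ₐ[ℂ] K :=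
  h.algInd.aevalEquivField.trans
    ((IntermediateField.equivOfEq h.adjoin_eq).trans IntermediateField.topEquiv)

theorem IsPlane.equiv_x (h : IsPlane s t) : h.equiv x = s := by
  have := h.algInd.aevalEquivField_algebraMap_apply_coe (MvPolynomial.X 0)
  rw [MvPolynomial.aeval_X] at this
  exact this

theorem IsPlane.equiv_y (h : IsPlane s t) : h.equiv y = t := by
  have := h.algInd.aevalEquivField_algebraMap_apply_coe (MvPolynomial.X 1)
  rw [MvPolynomial.aeval_X] at this
  exact this

theorem IsPlane.exists_div (h : IsPlane s t) (z : K) :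
    ∃ a ∈ coordRing s t, ∃ b ∈ coordRing s t, z = a / b := by
  have hz : z ∈ IntermediateField.adjoin ℂ (Set.range ![s, t]) := h.adjoin_eq ▸ trivial
  rw [range_pair] at hz
  obtain ⟨a, ha, b, hb, e⟩ := IntermediateField.mem_adjoin_iff_div.1 hz
  exact ⟨a, ha, b, hb, e⟩

theorem IsPlane.isFractionRing (h : IsPlane s t) : IsFractionRing (coordRing s t) K :=
  IsFractionRing.of_field _ _ fun z => by
    obtain ⟨a, ha, b, hb, e⟩ := h.exists_div z
    exact ⟨⟨a, ha⟩, ⟨b, hb⟩, e⟩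

/-- The coordinate ring of a plane is a polynomial ring. -/
def IsPlane.polyEquiv (h : IsPlane s t) : MvPolynomial (Fin 2) ℂ ≃+* coordRing s t :=
  (h.algInd.aevalEquiv.trans
    (Subalgebra.equivOfEq _ _ (congrArg (Algebra.adjoin ℂ) (range_pair s t)))).toRingEquiv

theorem IsPlane.coe_polyEquiv (h : IsPlane s t) (p : MvPolynomial (Fin 2) ℂ) :
    (h.polyEquiv p : K) = MvPolynomial.aeval ![s, t] p :=
  h.algInd.algebraMap_aevalEquiv p

theorem IsPlane.ufd (h : IsPlane s t) : UniqueFactorizationMonoid (coordRing s t) :=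
  h.polyEquiv.toMulEquiv.uniqueFactorizationMonoid inferInstance

/-- The first coordinate of a plane, as an element of its coordinate ring. -/
def coordLeft (s t : K) : coordRing s t := ⟨s, Algebra.subset_adjoin (by simp)⟩

theorem IsPlane.polyEquiv_X (h : IsPlane s t) :
    h.polyEquiv (MvPolynomial.X 0) = coordLeft s t := by
  apply Subtype.ext
  rw [h.coe_polyEquiv, MvPolynomial.aeval_X]
  rfl

theorem IsPlane.prime_left (h : IsPlane s t) : Prime (coordLeft s t) := by
  rw [← h.polyEquiv_X]
  exact (MulEquiv.prime_iff h.polyEquiv.toMulEquiv).2 (MvPolynomial.X_prime (i := 0))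

/-- The generic point of the line `s = 0` in the plane with coordinates `s` and `t`. -/
def IsPlane.line (h : IsPlane s t) : LocalSubring K := primePoint h.prime_left

theorem IsPlane.line_planePoint (h : IsPlane s t) : PlanePoint h.line s t :=
  planePoint_iff.2 (primePoint_mem_specModel h.prime_left)

theorem IsPlane.line_uniformizer (h : IsPlane s t) : IsUniformizer h.line s :=
  have := h.ufd
  have := h.isFractionRing
  isUniformizer_primePoint h.prime_left

theorem IsPlane.line_unitAt_sub (h : IsPlane s t) (c : ℂ) :
    UnitAt h.line (t - algebraMap ℂ K c) := by
  have e : (h.polyEquiv (MvPolynomial.X 1 - MvPolynomial.C c) : K) = t - algebraMap ℂ K c := by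
    rw [h.coe_polyEquiv, map_sub, MvPolynomial.aeval_X, MvPolynomial.aeval_C]
    rfl
  rw [← e]
  refine unitAt_primePoint _ fun hd => ?_
  rw [← h.polyEquiv_X] at hd
  have hd' := (map_dvd_iff h.polyEquiv).1 hd
  have h1 := map_dvd (MvPolynomial.eval ![0, c + 1]) hd'
  simp at h1

theorem IsPlane.line_unitAt (h : IsPlane s t) : UnitAt h.line t := by
  simpa using h.line_unitAt_sub 0

theorem eq_line {ϖ : K} (h : IsPlane s t) (hR : PlanePoint R s t) (hϖ : IsUniformizer R ϖ)
    (hs : Vanishes R s) : R = h.line :=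
  eq_primePoint_of_vanishes (planePoint_iff.1 hR) hϖ h.prime_left hs

theorem exists_eq_primePoint {ϖ : K} (h : IsPlane s t) (hR : PlanePoint R s t)
    (hϖ : IsUniformizer R ϖ) : ∃ (π : coordRing s t) (hπ : Prime π), R = primePoint hπ := by
  have := h.ufd
  have hR' := planePoint_iff.1 hR
  have hA := (mem_specModel_iff.1 hR').1
  obtain ⟨a, ha, b, hb, hb0, hi, e⟩ := (mem_specModel_iff.1 hR').2 _ hϖ.vanishes.1
  have ha' : a = ϖ * b := by rw [e]; field_simp
  have hv : Vanishes R a := by rw [ha']; exact hϖ.vanishes.mul_right (hA hb)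
  have ha0 : a ≠ 0 := by rw [ha']; exact mul_ne_zero hϖ.ne_zero hb0
  obtain ⟨π, hπ, -, hv⟩ := exists_prime_vanishes hA ⟨a, ha⟩
    (fun h => ha0 (congrArg Subtype.val h)) hv
  exact ⟨π, hπ, eq_primePoint_of_vanishes hR' hϖ hπ hv⟩

end IsPlane

/-! ### Local equations of Cartier divisors -/

section IsEqn

variable {F : Type*} [Field F] {X : Set (LocalSubring F)} {D E : CaDiv X} {P : X} {f g : F}

/-- `f` is a local equation of the Cartier divisor `D` at the point `P`. -/
def IsEqn (D : CaDiv X) (P : X) (f : F) : Prop :=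
  ∃ h : f ≠ 0, D.1 P = QuotientGroup.mk (Units.mk0 f h)

theorem IsEqn.ne_zero (h : IsEqn D P f) : f ≠ 0 := h.1

theorem IsEqn.congr (h : IsEqn D P f) (hu : UnitAt P.1 (g / f)) : IsEqn D P g := by
  obtain ⟨h0, h⟩ := h
  refine ⟨fun hg => hu.1 (by simp [hg]), h.trans (mk_eq_mk_iff.2 ?_)⟩
  simpa using hu

theorem IsEqn.unique (h : IsEqn D P f) (h' : IsEqn D P g) : UnitAt P.1 (g / f) := by
  obtain ⟨h0, h⟩ := h
  obtain ⟨h0', h'⟩ := h'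
  simpa using mk_eq_mk_iff.1 (h.symm.trans h')

theorem isEqn_one : IsEqn (1 : CaDiv X) P 1 :=
  ⟨one_ne_zero, by rw [Units.mk0_one]; rfl⟩

theorem IsEqn.mul (h : IsEqn D P f) (h' : IsEqn E P g) : IsEqn (D * E) P (f * g) := by
  obtain ⟨h0, h⟩ := h
  obtain ⟨h0', h'⟩ := h'
  refine ⟨mul_ne_zero h0 h0', ?_⟩
  rw [Units.mk0_mul]
  exact congrArg₂ (· * ·) h h'

theorem IsEqn.inv (h : IsEqn D P f) : IsEqn D⁻¹ P f⁻¹ := by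
  obtain ⟨h0, h⟩ := h
  refine ⟨inv_ne_zero h0, ?_⟩
  have : Units.mk0 f⁻¹ (inv_ne_zero h0) = (Units.mk0 f h0)⁻¹ := by ext; simp
  rw [this]
  exact congrArg (·⁻¹) h

theorem IsEqn.pow (h : IsEqn D P f) (n : ℕ) : IsEqn (D ^ n) P (f ^ n) := by
  induction n with
  | zero => simpa using isEqn_one
  | succ n ih => rw [pow_succ, pow_succ]; exact ih.mul h

theorem IsEqn.zpow (h : IsEqn D P f) (n : ℤ) : IsEqn (D ^ n) P (f ^ n) := by
  obtain ⟨n, rfl | rfl⟩ := n.eq_nat_or_neg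
  · simpa using h.pow n
  · simpa using (h.pow n).inv

theorem IsEqn.prod {ι : Type*} {s : Finset ι} {D : ι → CaDiv X} {f : ι → F}
    (h : ∀ i ∈ s, IsEqn (D i) P (f i)) : IsEqn (∏ i ∈ s, D i) P (∏ i ∈ s, f i) := by
  classical
  induction s using Finset.induction_on with
  | empty => simpa using isEqn_one
  | insert i s hi ih =>
    rw [Finset.prod_insert hi, Finset.prod_insert hi]
    exact (h i (by simp)).mul (ih fun j hj => h j (by simp [hj]))

theorem isEqn_principal (f : Fˣ) : IsEqn (principal X f) P f :=
  ⟨f.ne_zero, by rw [Units.mk0_val]; rfl⟩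

theorem exists_isEqn (D : CaDiv X) (P : X) : ∃ f, IsEqn D P f := by
  obtain ⟨U, -, hP, f, hf⟩ := D.2 P
  exact ⟨f, f.ne_zero, by rw [Units.mk0_val]; exact hf P hP⟩

theorem eq_one_of_isEqn (h : ∀ P, IsEqn D P 1) : D = 1 := by
  refine Subtype.ext (funext fun P => ?_)
  obtain ⟨h0, h⟩ := h P
  rw [h, Units.mk0_one]
  rfl

theorem eq_of_isEqn (h : ∀ P, ∃ f, IsEqn D P f ∧ IsEqn E P f) : D = E := by
  refine Subtype.ext (funext fun P => ?_)
  obtain ⟨f, ⟨h0, h⟩, ⟨_, h'⟩⟩ := h P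
  rw [h, h']

theorem exists_finset_of_isOpen {V : Set (LocalSubring F)} (hV : IsOpen V) {R : LocalSubring F}
    (hR : R ∈ V) : ∃ S : Finset F, (∀ s ∈ S, s ∈ R.toSubring) ∧
      ∀ Q : LocalSubring F, (∀ s ∈ S, s ∈ Q.toSubring) → Q ∈ V := by
  classical
  induction hV with
  | basic V hV =>
    obtain ⟨s, rfl⟩ := hV
    exact ⟨{s}, by simpa using hR, fun Q hQ => hQ s (by simp)⟩
  | univ => exact ⟨∅, by simp, fun _ _ => trivial⟩
  | inter V W _ _ ih ih' =>
    obtain ⟨S, hS, hS'⟩ := ih hR.1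
    obtain ⟨T, hT, hT'⟩ := ih' hR.2
    refine ⟨S ∪ T, fun s hs => ?_, fun Q hQ => ⟨hS' Q fun s hs => hQ s (by simp [hs]),
      hT' Q fun s hs => hQ s (by simp [hs])⟩⟩
    rcases Finset.mem_union.1 hs with hs | hs
    · exact hS s hs
    · exact hT s hs
  | sUnion 𝒮 _ ih =>
    obtain ⟨V, hV, hR⟩ := hR
    obtain ⟨S, hS, hS'⟩ := ih V hV hR
    exact ⟨S, hS, fun Q hQ => ⟨V, hV, hS' Q hQ⟩⟩

/-- A local equation at `P` is a local equation at all points at which certain finitely many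
functions that are regular at `P` are regular. -/
theorem exists_isEqn_nhds (D : CaDiv X) (P : X) : ∃ (f : F) (S : Finset F),
    (∀ s ∈ S, s ∈ P.1.toSubring) ∧ ∀ Q : X, (∀ s ∈ S, s ∈ Q.1.toSubring) → IsEqn D Q f := by
  obtain ⟨U, hU, hP, f, hf⟩ := D.2 P
  obtain ⟨V, hV, rfl⟩ := isOpen_induced_iff.1 hU
  obtain ⟨S, hS, hS'⟩ := exists_finset_of_isOpen hV hP
  exact ⟨f, S, hS, fun Q hQ => ⟨f.ne_zero, by rw [Units.mk0_val]; exact hf Q (hS' _ hQ)⟩⟩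

theorem IsEqn.exists_zpow {ϖ : F} (hϖ : IsUniformizer P.1 ϖ) (D : CaDiv X) :
    ∃ k : ℤ, IsEqn D P (ϖ ^ k) := by
  obtain ⟨f, hf⟩ := exists_isEqn D P
  obtain ⟨k, hk⟩ := hϖ.exists_zpow f hf.ne_zero
  exact ⟨k, hf.congr (by simpa using hk.inv)⟩

theorem IsEqn.pullback {G : Type*} [Field G] [Algebra ℂ F] [Algebra ℂ G] {σ : G →ₐ[ℂ] F}
    {Y : Set (LocalSubring G)} (φ : Hom σ X Y) {D : CaDiv Y} {f : G}
    (h : IsEqn D (φ.toFun P) f) : IsEqn (φ.pullbackDiv D) P (σ f) := by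
  obtain ⟨h0, h⟩ := h
  refine ⟨by simpa using h0, ?_⟩
  have : Units.mk0 (σ f) (by simpa using h0) = Units.map (σ : G →* F) (Units.mk0 f h0) := by
    ext; rfl
  rw [this]
  exact congrArg (φ.stalkMap P) h

end IsEqn

section Generators

variable {Z : Set Pt} {P : blowUp Z} {p : Pt}

/-- The pullback of the line `x = ∞`. -/
def pullX (Z : Set Pt) : CaDiv (blowUp Z) :=
  (blowDown Z).pullbackDiv (infDiv (Units.mk0 x x_ne_zero) fun _ h => P1P1_x h)

/-- The pullback of the line `y = ∞`. -/
def pullY (Z : Set Pt) : CaDiv (blowUp Z) :=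
  (blowDown Z).pullbackDiv (infDiv (Units.mk0 y y_ne_zero) fun _ h => P1P1_y h)

theorem isEqn_infDiv_one {z : Kˣ} (hz : ∀ R ∈ P1P1, (z : K) ∈ R.toSubring ∨ (z : K)⁻¹ ∈ R.toSubring)
    {P : P1P1} (h : (z : K) ∈ P.1.toSubring) : IsEqn (infDiv z hz) P 1 :=
  ⟨one_ne_zero, by rw [Units.mk0_one]; exact if_pos h⟩

theorem isEqn_infDiv_inv {z : Kˣ} (hz : ∀ R ∈ P1P1, (z : K) ∈ R.toSubring ∨ (z : K)⁻¹ ∈ R.toSubring)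
    {P : P1P1} (h : (z : K)⁻¹ ∈ P.1.toSubring) : IsEqn (infDiv z hz) P (z : K)⁻¹ := by
  by_cases h' : (z : K) ∈ P.1.toSubring
  · refine (isEqn_infDiv_one hz h').congr ?_
    exact ⟨by simp, by simpa using h, by simpa using h'⟩
  · refine ⟨by simp, ?_⟩
    have : Units.mk0 (z : K)⁻¹ (by simp) = z⁻¹ := by ext; simp
    rw [this]
    exact if_neg h'

theorem blowDown_le (P : blowUp Z) : ((blowDown Z).toFun P).1 ≤ P.1 :=
  (exists_le_of_mem_blowUp P.2).choose_spec.2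

theorem isEqn_pullX_one (h : x ∈ P.1.toSubring) : IsEqn (pullX Z) P 1 := by
  have := mem_of_le (P1P1_x ((blowDown Z).toFun P).2) (blowDown_le P) (by simp) h
  simpa [pullX] using (isEqn_infDiv_one (fun _ h => P1P1_x h) this).pullback (blowDown Z)

theorem isEqn_pullX_inv (h : x⁻¹ ∈ P.1.toSubring) : IsEqn (pullX Z) P x⁻¹ := by
  have := mem_of_le (P1P1_x ((blowDown Z).toFun P).2) (blowDown_le P) (by simp) h
  simpa [pullX] using (isEqn_infDiv_inv (z := Units.mk0 x x_ne_zero)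
    (fun _ h => P1P1_x h) this).pullback (blowDown Z)

theorem isEqn_pullY_one (h : y ∈ P.1.toSubring) : IsEqn (pullY Z) P 1 := by
  have := mem_of_le (P1P1_y ((blowDown Z).toFun P).2) (blowDown_le P) (by simp) h
  simpa [pullY] using (isEqn_infDiv_one (fun _ h => P1P1_y h) this).pullback (blowDown Z)

theorem isEqn_pullY_inv (h : y⁻¹ ∈ P.1.toSubring) : IsEqn (pullY Z) P y⁻¹ := by
  have := mem_of_le (P1P1_y ((blowDown Z).toFun P).2) (blowDown_le P) (by simp) h
  simpa [pullY] using (isEqn_infDiv_inv (z := Units.mk0 y y_ne_zero)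
    (fun _ h => P1P1_y h) this).pullback (blowDown Z)

theorem isEqn_excDiv_one (hp : p ∈ Z) (h : ¬ LiesOver P.1 p) : IsEqn (excDiv hp) P 1 :=
  ⟨one_ne_zero, by rw [Units.mk0_one]; exact if_neg h⟩

/-- A generator `w` of the ideal `(u, v)` is a local equation of the exceptional divisor. -/
theorem isEqn_excDiv (hp : p ∈ Z) (h : LiesOver P.1 p) {w c₁ c₂ : K} (hw : w ≠ 0)
    (hu : uAt p / w ∈ P.1.toSubring) (hv : vAt p / w ∈ P.1.toSubring)
    (hc₁ : c₁ ∈ P.1.toSubring) (hc₂ : c₂ ∈ P.1.toSubring) (e : w = c₁ * uAt p + c₂ * vAt p) :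
    IsEqn (excDiv hp) P w := by
  have hu0 := uAt_ne_zero p
  have hv0 := vAt_ne_zero p
  by_cases huv : uAt p / vAt p ∈ P.1.toSubring
  · have h1 : IsEqn (excDiv hp) P (vAt p) := ⟨hv0, (if_pos h).trans (if_pos huv)⟩
    refine h1.congr ⟨div_ne_zero hw hv0, ?_, by rwa [inv_div]⟩
    have : w / vAt p = c₁ * (uAt p / vAt p) + c₂ := by rw [e]; field_simp
    rw [this]
    exact add_mem (mul_mem hc₁ huv) hc₂
  · have hvu := (div_mem_of_liesOver hp P.2 h).resolve_left huv
    have h1 : IsEqn (excDiv hp) P (uAt p) := ⟨hu0, (if_pos h).trans (if_neg huv)⟩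
    refine h1.congr ⟨div_ne_zero hw hu0, ?_, by rwa [inv_div]⟩
    have : w / uAt p = c₁ + c₂ * (vAt p / uAt p) := by rw [e]; field_simp
    rw [this]
    exact add_mem hc₁ (mul_mem hc₂ hvu)

end Generators

/-! ### The Picard group of a blow-up -/

section Divisors

variable {Z : Set Pt} {p : Pt} {R V : LocalSubring K} {ϖ s t : K}

theorem mem_of_localCoord_mem {L : IntermediateField ℂ K} {z : K} {α : OnePoint ℂ}
    (h : localCoord z α ∈ L) : z ∈ L := by
  match α with
  | none =>
    have h : z⁻¹ ∈ L := h
    simpa using inv_mem h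
  | some a =>
    have h : z - algebraMap ℂ K a ∈ L := h
    simpa using add_mem h (L.algebraMap_mem a)

theorem mem_adjoin_left : s ∈ IntermediateField.adjoin ℂ {s, t} :=
  IntermediateField.subset_adjoin _ _ (by simp)

theorem mem_adjoin_right : t ∈ IntermediateField.adjoin ℂ {s, t} :=
  IntermediateField.subset_adjoin _ _ (by simp)

theorem isPlane_localCoord (α β : OnePoint ℂ) : IsPlane (localCoord x α) (localCoord y β) :=
  isPlane_of_mem (mem_of_localCoord_mem (α := α) mem_adjoin_left)
    (mem_of_localCoord_mem (α := β) mem_adjoin_right)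

theorem isPlane_localCoord' (α β : OnePoint ℂ) : IsPlane (localCoord y β) (localCoord x α) :=
  isPlane_of_mem (mem_of_localCoord_mem (α := α) mem_adjoin_right)
    (mem_of_localCoord_mem (α := β) mem_adjoin_left)

theorem isPlane_pair {s t : K} (hs : s ∈ ({x, x⁻¹} : Set K)) (ht : t ∈ ({y, y⁻¹} : Set K)) :
    IsPlane s t := by
  refine isPlane_of_mem ?_ ?_
  · have := mem_adjoin_left (s := s) (t := t)
    rcases hs with rfl | rfl
    · exact this
    · simpa using inv_mem this
  · have := mem_adjoin_right (s := s) (t := t)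
    rcases ht with rfl | rfl
    · exact this
    · simpa using inv_mem this

theorem isPlane_xy : IsPlane x y := isPlane_pair (by simp) (by simp)

theorem isPlane_invX : IsPlane x⁻¹ y := isPlane_pair (by simp) (by simp)

theorem isPlane_invY : IsPlane y⁻¹ x := by
  simpa [localCoord] using isPlane_localCoord' (some 0) none

/-- The chart of the blow-up of `p` with coordinates `v` and `u / v`. -/
theorem isPlane_chart (p : Pt) : IsPlane (vAt p) (uAt p / vAt p) := by
  have h := div_mul_cancel₀ (uAt p) (vAt_ne_zero p)
  refine isPlane_of_mem (mem_of_localCoord_mem (α := p.1) ?_)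
    (mem_of_localCoord_mem (α := p.2) mem_adjoin_left)
  have := mul_mem (mem_adjoin_right (s := vAt p) (t := uAt p / vAt p)) mem_adjoin_left
  rwa [h] at this

/-- The chart of the blow-up of `p` with coordinates `u` and `v / u`. -/
theorem isPlane_chart' (p : Pt) : IsPlane (uAt p) (vAt p / uAt p) := by
  have h := div_mul_cancel₀ (vAt p) (uAt_ne_zero p)
  refine isPlane_of_mem (mem_of_localCoord_mem (α := p.1) mem_adjoin_left)
    (mem_of_localCoord_mem (α := p.2) ?_)
  have := mul_mem (mem_adjoin_right (s := uAt p) (t := vAt p / uAt p)) mem_adjoin_left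
  rwa [h] at this

/-- The local ring of a prime divisor does not lie over a closed point. -/
theorem not_liesOver_of_isUniformizer (hR : OnP1P1 x y R) (hϖ : IsUniformizer R ϖ) (p : Pt) :
    ¬ LiesOver R p := by
  rintro ⟨hu, hv⟩
  have h := isPlane_localCoord p.1 p.2
  have e := eq_line h (hR.planePoint hu.1 hv.1) hϖ hu
  subst e
  exact h.line_unitAt.not_vanishes hv

theorem mem_blowUp_of_isUniformizer (hR : OnP1P1 x y R) (hϖ : IsUniformizer R ϖ) :
    R ∈ blowUp Z :=
  mem_blowUp_iff.2 (.inl ⟨hR, fun p _ => not_liesOver_of_isUniformizer hR hϖ p⟩)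

/-- The generic point of the exceptional curve over `p`. -/
abbrev excPoint (p : Pt) : LocalSubring K := (isPlane_chart p).line

/-- The generic point of the line `x = ∞`. -/
abbrev infXPoint : LocalSubring K := isPlane_invX.line

/-- The generic point of the line `y = ∞`. -/
abbrev infYPoint : LocalSubring K := isPlane_invY.line

theorem liesOver_excPoint (p : Pt) : LiesOver (excPoint p) p := by
  have h := isPlane_chart p
  refine ⟨?_, h.line_uniformizer.vanishes⟩
  have := Vanishes.mul h.line_unitAt.2.1 h.line_uniformizer.vanishes
  rwa [div_mul_cancel₀ _ (vAt_ne_zero p)] at this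

theorem excPoint_mem (hp : p ∈ Z) : excPoint p ∈ blowUp Z :=
  mem_blowUp_iff.2 (.inr ⟨p, hp, liesOver_excPoint p, .inl (isPlane_chart p).line_planePoint.swap⟩)

theorem onP1P1_infXPoint : OnP1P1 x y infXPoint :=
  ⟨x⁻¹, by simp, y, by simp, isPlane_invX.line_planePoint⟩

theorem onP1P1_infYPoint : OnP1P1 x y infYPoint :=
  ⟨x, by simp, y⁻¹, by simp, isPlane_invY.line_planePoint.swap⟩

theorem infXPoint_mem : infXPoint ∈ blowUp Z :=
  mem_blowUp_of_isUniformizer onP1P1_infXPoint isPlane_invX.line_uniformizer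

theorem infYPoint_mem : infYPoint ∈ blowUp Z :=
  mem_blowUp_of_isUniformizer onP1P1_infYPoint isPlane_invY.line_uniformizer

theorem isUniformizer_xy {π : coordRing x y} (hπ : Prime π) :
    IsUniformizer (primePoint hπ) (π : K) :=
  have := isPlane_xy.ufd
  have := isPlane_xy.isFractionRing
  isUniformizer_primePoint hπ

theorem planePoint_primePoint_xy {π : coordRing x y} (hπ : Prime π) :
    PlanePoint (primePoint hπ) x y :=
  planePoint_iff.2 (primePoint_mem_specModel hπ)

theorem onP1P1_primePoint {π : coordRing x y} (hπ : Prime π) : OnP1P1 x y (primePoint hπ) :=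
  ⟨x, by simp, y, by simp, planePoint_primePoint_xy hπ⟩

theorem primePoint_mem {π : coordRing x y} (hπ : Prime π) : primePoint hπ ∈ blowUp Z :=
  mem_blowUp_of_isUniformizer (onP1P1_primePoint hπ) (isUniformizer_xy hπ)

/-- The prime divisors of the blow-up: the curves in the affine plane, the lines `x = ∞` and
`y = ∞`, and the exceptional curves. -/
theorem eq_of_isUniformizer (hR : R ∈ blowUp Z) (hϖ : IsUniformizer R ϖ) :
    (∃ (π : coordRing x y) (hπ : Prime π), R = primePoint hπ) ∨ R = infXPoint ∨ R = infYPoint ∨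
      ∃ p ∈ Z, R = excPoint p := by
  rcases mem_blowUp_iff.1 hR with ⟨⟨s, hs, t, ht, h⟩, -⟩ | ⟨p, hp, hl, h | h⟩
  · by_cases hx : x ∈ R.toSubring
    · by_cases hy : y ∈ R.toSubring
      · have e : ∀ z : K, localCoord z (some 0) = z := fun z => by simp [localCoord]
        have h' := (OnP1P1.planePoint ⟨s, hs, t, ht, h⟩ (α := some 0) (β := some 0)
          (by rwa [e]) (by rwa [e]))
        rw [e, e] at h'
        exact .inl (exists_eq_primePoint isPlane_xy h' hϖ)
      · rcases ht with rfl | rfl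
        · exact absurd h.right hy
        · have hv := vanishes_inv_of_notMem hy h.right
          have h' : PlanePoint R y⁻¹ x := by
            rcases hs with rfl | rfl
            · exact h.swap
            · exact h.swap.of_inv hx
          exact .inr (.inr (.inl (eq_line isPlane_invY h' hϖ hv)))
    · rcases hs with rfl | rfl
      · exact absurd h.left hx
      · have hv := vanishes_inv_of_notMem hx h.left
        have hP := isPlane_pair (s := x⁻¹) (by simp) ht
        have e := eq_line hP h hϖ hv
        have hu : UnitAt R t := by rw [e]; exact hP.line_unitAt
        have h' : PlanePoint R x⁻¹ y := by
          rcases ht with rfl | rfl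
          · exact h
          · exact h.of_inv (by simpa using hu.2.2)
        exact .inr (.inl (eq_line isPlane_invX h' hϖ hv))
  · exact .inr (.inr (.inr ⟨p, hp, eq_line (isPlane_chart p) h.swap hϖ hl.2⟩))
  · have e := eq_line (isPlane_chart' p) h.swap hϖ hl.1
    have hu : UnitAt R (vAt p / uAt p) := by rw [e]; exact (isPlane_chart' p).line_unitAt
    have hm : uAt p / vAt p ∈ R.toSubring := by rw [← inv_div]; exact hu.2.2
    have h' : PlanePoint R (vAt p) (uAt p / vAt p) := by
      have e' : vAt p / uAt p = (uAt p / vAt p)⁻¹ := (inv_div _ _).symm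
      refine h.change hl.2.1 hm ?_ ?_
      · rw [e']
        exact inv_mem_locSub right_mem_locSub (by rw [← e']; exact hu.2.1)
      · have := mul_mem (right_mem_locSub (R := R) (s := vAt p) (t := uAt p / vAt p))
          left_mem_locSub
        rwa [div_mul_cancel₀ _ (vAt_ne_zero p)] at this
    exact .inr (.inr (.inr ⟨p, hp, eq_line (isPlane_chart p) h' hϖ hl.2⟩))

/-- The charts of the blow-up are planes, and with a point of the blow-up they contain the prime
divisors through it. -/
theorem exists_chart (hR : R ∈ blowUp Z) : ∃ s t : K, IsPlane s t ∧ PlanePoint R s t ∧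
    ∀ V ϖ, PlanePoint V s t → IsUniformizer V ϖ → V ∈ blowUp Z := by
  have aux : ∀ (p : Pt) (u v : K), p ∈ Z → u ≠ 0 → v ≠ 0 →
      (∀ V, Vanishes V u → Vanishes V v → PlanePoint V (u / v) v → V ∈ blowUp Z) →
      (∀ V, PlanePoint V u v → OnP1P1 x y V) →
      ∀ V ϖ, PlanePoint V v (u / v) → IsUniformizer V ϖ → V ∈ blowUp Z := by
    intro p u v hp hu0 hv0 h1 h2 V ϖ hV hϖ
    have huV : u ∈ V.toSubring := by
      have := mul_mem hV.right hV.left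
      rwa [div_mul_cancel₀ u hv0] at this
    rcases vanishes_or_unitAt hV.left with hv | hv
    · refine h1 V ?_ hv hV.swap
      have := Vanishes.mul hV.right hv
      rwa [div_mul_cancel₀ u hv0] at this
    · refine mem_blowUp_of_isUniformizer (h2 V ?_) hϖ
      exact hV.change huV hV.left right_mem_locSub
        (div_mem_locSub left_mem_locSub right_mem_locSub hv)
  rcases mem_blowUp_iff.1 hR with ⟨⟨s, hs, t, ht, h⟩, -⟩ | ⟨p, hp, hl, h | h⟩
  · exact ⟨s, t, isPlane_pair hs ht, h, fun V ϖ hV hϖ =>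
      mem_blowUp_of_isUniformizer ⟨s, hs, t, ht, hV⟩ hϖ⟩
  · refine ⟨_, _, isPlane_chart p, h.swap, aux p _ _ hp (uAt_ne_zero p) (vAt_ne_zero p) ?_ ?_⟩
    · exact fun V hu hv h => mem_blowUp_iff.2 (.inr ⟨p, hp, ⟨hu, hv⟩, .inl h⟩)
    · exact fun V h => .of_localCoord h
  · refine ⟨_, _, isPlane_chart' p, h.swap, aux p _ _ hp (vAt_ne_zero p) (uAt_ne_zero p) ?_ ?_⟩
    · exact fun V hv hu h => mem_blowUp_iff.2 (.inr ⟨p, hp, ⟨hu, hv⟩, .inr h⟩)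
    · exact fun V h => .of_localCoord h.swap

/-- A Cartier divisor that is trivial at all prime divisors is trivial. -/
theorem eq_one_of_isUniformizer {D : CaDiv (blowUp Z)}
    (h : ∀ (P : blowUp Z) (ϖ : K), IsUniformizer P.1 ϖ → IsEqn D P 1) : D = 1 := by
  refine eq_one_of_isEqn fun P => ?_
  obtain ⟨s, t, hP, hst, hV⟩ := exists_chart P.2
  have := hP.ufd
  have := hP.isFractionRing
  obtain ⟨f, S, hS, hf⟩ := exists_isEqn_nhds D P
  have hfP := hf P hS
  have hu : UnitAt P.1 f := by
    refine unitAt_of_forall_primePoint (planePoint_iff.1 hst) hfP.ne_zero fun π hπ hv => ?_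
    have hle := le_primePoint_of_vanishes (planePoint_iff.1 hst) hπ hv
    have hϖ := isUniformizer_primePoint hπ
    let Q : blowUp Z :=
      ⟨primePoint hπ, hV _ _ (planePoint_iff.2 (primePoint_mem_specModel hπ)) hϖ⟩
    simpa using (h Q _ hϖ).unique (hf Q fun s hs => hle (hS s hs))
  exact hfP.congr (by simpa using hu.inv)

end Divisors

section PicardGroup

theorem exists_eq_const {s t : K} (h : IsPlane s t) {a : coordRing s t} (ha : IsUnit a) :
    ∃ c : ℂ, c ≠ 0 ∧ (a : K) = algebraMap ℂ K c := by
  obtain ⟨p, rfl⟩ := h.polyEquiv.surjective a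
  have hp : IsUnit p := (MulEquiv.isUnit_map h.polyEquiv).1 ha
  obtain ⟨c, hc, rfl⟩ := MvPolynomial.isUnit_iff_eq_C_of_isReduced.1 hp
  exact ⟨c, hc.ne_zero, by rw [h.coe_polyEquiv, MvPolynomial.aeval_C]⟩

/-- A rational function without zeros and poles in the affine plane is constant. -/
theorem exists_eq_const_of_forall_unitAt {s t f : K} (h : IsPlane s t) (hf : f ≠ 0)
    (hu : ∀ (π : coordRing s t) (hπ : Prime π), UnitAt (primePoint hπ) f) :
    ∃ c : ℂ, c ≠ 0 ∧ f = algebraMap ℂ K c := by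
  have := h.ufd
  have := h.isFractionRing
  obtain ⟨a, b, ha, hb, hab, rfl⟩ := exists_reduced_div (A := coordRing s t) f hf
  have hndvd : ∀ (π : coordRing s t), Prime π → π ∣ a → ¬ π ∣ b := fun π hπ h h' =>
    hπ.not_isUnit (hab h h')
  have hua : IsUnit a := by
    by_contra hna
    obtain ⟨π, hπ, hd⟩ := WfDvdMonoid.exists_irreducible_factor hna ha
    have hπ := hπ.prime
    have h1 := (hu π hπ).mul (unitAt_primePoint hπ (hndvd π hπ hd))
    obtain ⟨c, rfl⟩ := hd
    rw [div_mul_cancel₀ _ (by simpa using hb), Subring.coe_mul] at h1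
    exact h1.not_vanishes ((vanishes_primePoint hπ).mul_right (le_primePoint hπ c.2))
  have hub : IsUnit b := by
    by_contra hnb
    obtain ⟨π, hπ, hd⟩ := WfDvdMonoid.exists_irreducible_factor hnb hb
    have hπ := hπ.prime
    have h1 := (hu π hπ).inv.mul (unitAt_primePoint hπ fun hd' => hndvd π hπ hd' hd)
    obtain ⟨c, rfl⟩ := hd
    rw [inv_div, div_mul_cancel₀ _ (by simpa using ha), Subring.coe_mul] at h1
    exact h1.not_vanishes ((vanishes_primePoint hπ).mul_right (le_primePoint hπ c.2))
  obtain ⟨c, hc, ec⟩ := exists_eq_const h hua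
  obtain ⟨d, hd, ed⟩ := exists_eq_const h hub
  exact ⟨c / d, div_ne_zero hc hd, by rw [ec, ed, map_div₀]⟩

/-- A Cartier divisor is principal along the curves in the affine plane. -/
theorem exists_isEqn_primePoint {Z : Set Pt} (D : CaDiv (blowUp Z)) :
    ∃ f : K, ∀ (π : coordRing x y) (hπ : Prime π), IsEqn D ⟨_, primePoint_mem hπ⟩ f := by
  classical
  have := isPlane_xy.ufd
  have := isPlane_xy.isFractionRing
  -- an equation that is valid along all curves except for those on which `b` vanishes can be
  -- corrected along these, one prime factor of `b` at a time
  have key : ∀ (b : coordRing x y), b ≠ 0 → ∀ f : K, f ≠ 0 →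
      (∀ (π : coordRing x y) (hπ : Prime π), ¬ π ∣ b → IsEqn D ⟨_, primePoint_mem hπ⟩ f) →
      ∃ f : K, ∀ (π : coordRing x y) (hπ : Prime π), IsEqn D ⟨_, primePoint_mem hπ⟩ f := by
    intro b
    induction b using UniqueFactorizationMonoid.induction_on_prime with
    | h₁ => exact fun h => absurd rfl h
    | h₂ b hb =>
      exact fun _ f _ hf =>
        ⟨f, fun π hπ => hf π hπ fun hd => hπ.not_isUnit (isUnit_of_dvd_unit hd hb)⟩
    | h₃ a p ha0 hp ih =>
      intro _ f hf0 hf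
      have hp0 : (p : K) ≠ 0 := by simpa using hp.ne_zero
      obtain ⟨k, hk⟩ := IsEqn.exists_zpow (P := ⟨_, primePoint_mem (Z := Z) hp⟩)
        (isUniformizer_xy hp) D
      obtain ⟨l, hl⟩ := (isUniformizer_xy hp).exists_zpow f hf0
      -- the exponent is chosen such that the equation becomes correct along `p`
      refine ih ha0 (f * (p : K) ^ (k - l)) (mul_ne_zero hf0 (zpow_ne_zero _ hp0))
        fun π hπ hπa => ?_
      by_cases hd : π ∣ p
      · obtain ⟨c, hc⟩ := (hπ.associated_of_dvd hp hd).symm.dvd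
        have hv : Vanishes (primePoint hp) (π : K) := by
          rw [hc, Subring.coe_mul]
          exact (vanishes_primePoint hp).mul_right (le_primePoint hp c.2)
        have e := eq_primePoint_of_vanishes (primePoint_mem_specModel hp) (isUniformizer_xy hp)
          hπ hv
        have e' : (⟨_, primePoint_mem hp⟩ : blowUp Z) = ⟨_, primePoint_mem hπ⟩ := Subtype.ext e
        rw [← e']
        refine hk.congr ?_
        convert hl using 1
        rw [zpow_sub₀ hp0]
        have := zpow_ne_zero k hp0
        field_simp
      · refine (hf π hπ fun h => (hπ.dvd_or_dvd h).elim hd hπa).congr ?_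
        rw [mul_div_cancel_left₀ _ hf0]
        exact (unitAt_primePoint hπ hd).zpow _
  obtain ⟨f, S, -, hf⟩ := exists_isEqn_nhds D ⟨_, infXPoint_mem⟩
  have hden : ∀ s : K, ∃ b : coordRing x y, b ≠ 0 ∧ ∀ (π : coordRing x y) (hπ : Prime π),
      ¬ π ∣ b → s ∈ (primePoint hπ).toSubring := by
    intro s
    by_cases hs : s = 0
    · exact ⟨1, one_ne_zero, fun π hπ _ => hs ▸ zero_mem _⟩
    · obtain ⟨a, b, -, hb, -, rfl⟩ := exists_reduced_div (A := coordRing x y) s hs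
      refine ⟨b, hb, fun π hπ hd => ?_⟩
      rw [div_eq_mul_inv]
      exact mul_mem (le_primePoint hπ a.2) (unitAt_primePoint hπ hd).2.2
  choose b hb0 hb using hden
  obtain ⟨f', hf'⟩ : ∃ f' : K, f' ≠ 0 ∧ ∀ Q : blowUp Z, (∀ s ∈ S, s ∈ Q.1.toSubring) →
      IsEqn D Q f' := by
    by_cases h : ∃ Q : blowUp Z, ∀ s ∈ S, s ∈ Q.1.toSubring
    · exact ⟨f, (hf _ h.choose_spec).ne_zero, hf⟩
    · exact ⟨1, one_ne_zero, fun Q hQ => absurd ⟨Q, hQ⟩ h⟩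
  refine key (∏ s ∈ S, b s) (Finset.prod_ne_zero_iff.2 fun s _ => hb0 s) f' hf'.1
    fun π hπ hd => hf'.2 _ fun s hs => hb s π hπ fun h => hd (h.trans (Finset.dvd_prod_of_mem b hs))

theorem liesOver_unique {Z : Set Pt} {R : LocalSubring K} (hR : R ∈ blowUp Z) {q q' : Pt}
    (h : LiesOver R q) (h' : LiesOver R q') : q = q' :=
  Prod.ext (localCoord_unique (blowUp_const hR) x_ne_zero h.1 h'.1)
    (localCoord_unique (blowUp_const hR) y_ne_zero h.2 h'.2)

theorem isEqn_excDiv_excPoint {ι : Type*} {p : ι → Pt} (hp : Function.Injective p) (i j : ι) :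
    IsEqn (excDiv (Set.mem_range_self (f := p) j)) ⟨_, excPoint_mem (Set.mem_range_self i)⟩
      (open Classical in if j = i then vAt (p i) else 1) := by
  have hl := liesOver_excPoint (p i)
  split_ifs with h
  · subst h
    have hv0 := vAt_ne_zero (p j)
    refine isEqn_excDiv _ hl (c₁ := 0) (c₂ := 1) hv0 (isPlane_chart (p j)).line_unitAt.2.1 ?_
      (zero_mem _) (one_mem _) (by simp)
    rw [div_self hv0]
    exact one_mem _
  · exact isEqn_excDiv_one _ fun hl' =>
      h (hp (liesOver_unique (excPoint_mem (Set.mem_range_self i)) hl' hl))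

variable {ι : Type*} [Fintype ι] {p : ι → Pt}

/-- The divisor `k H_x + l H_y + ∑ e_i E_i` on the blow-up of the points `p i`. -/
def combDiv (p : ι → Pt) (k l : ℤ) (e : ι → ℤ) : CaDiv (blowUp (Set.range p)) :=
  pullX _ ^ k * pullY _ ^ l * ∏ i, excDiv (Set.mem_range_self i) ^ e i

theorem isEqn_combDiv {P : blowUp (Set.range p)} {f g : K} {h : ι → K} (hX : IsEqn (pullX _) P f)
    (hY : IsEqn (pullY _) P g) (hE : ∀ i, IsEqn (excDiv (Set.mem_range_self i)) P (h i))
    (k l : ℤ) (e : ι → ℤ) : IsEqn (combDiv p k l e) P (f ^ k * g ^ l * ∏ i, h i ^ e i) :=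
  ((hX.zpow k).mul (hY.zpow l)).mul (IsEqn.prod fun i _ => (hE i).zpow _)

theorem isEqn_excDiv_one_of_onP1P1 {Z : Set Pt} {P : blowUp Z} {ϖ : K} (h : OnP1P1 x y P.1)
    (hϖ : IsUniformizer P.1 ϖ) {q : Pt} (hq : q ∈ Z) : IsEqn (excDiv hq) P 1 :=
  isEqn_excDiv_one hq (not_liesOver_of_isUniformizer h hϖ q)

theorem isEqn_combDiv_primePoint {π : coordRing x y} (hπ : Prime π) (k l : ℤ) (e : ι → ℤ) :
    IsEqn (combDiv p k l e) ⟨_, primePoint_mem hπ⟩ 1 := by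
  have h := planePoint_primePoint_xy hπ
  simpa using isEqn_combDiv (P := ⟨_, primePoint_mem hπ⟩) (isEqn_pullX_one h.left)
    (isEqn_pullY_one h.right)
    (fun i => isEqn_excDiv_one_of_onP1P1 (onP1P1_primePoint hπ) (isUniformizer_xy hπ) _) k l e

theorem isEqn_combDiv_infXPoint (k l : ℤ) (e : ι → ℤ) :
    IsEqn (combDiv p k l e) ⟨_, infXPoint_mem⟩ (x⁻¹ ^ k) := by
  have h := isPlane_invX.line_planePoint
  simpa using isEqn_combDiv (P := ⟨_, infXPoint_mem⟩) (isEqn_pullX_inv h.left)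
    (isEqn_pullY_one h.right)
    (fun i => isEqn_excDiv_one_of_onP1P1 onP1P1_infXPoint isPlane_invX.line_uniformizer _) k l e

theorem isEqn_combDiv_infYPoint (k l : ℤ) (e : ι → ℤ) :
    IsEqn (combDiv p k l e) ⟨_, infYPoint_mem⟩ (y⁻¹ ^ l) := by
  have h := isPlane_invY.line_planePoint
  simpa using isEqn_combDiv (P := ⟨_, infYPoint_mem⟩) (isEqn_pullX_one h.right)
    (isEqn_pullY_inv h.left)
    (fun i => isEqn_excDiv_one_of_onP1P1 onP1P1_infYPoint isPlane_invY.line_uniformizer _) k l e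

theorem isEqn_combDiv_excPoint (hp : Function.Injective p) (i : ι) (e : ι → ℤ) :
    IsEqn (combDiv p 0 0 e) ⟨_, excPoint_mem (Set.mem_range_self i)⟩ (vAt (p i) ^ e i) := by
  classical
  obtain ⟨f, hf⟩ := exists_isEqn (pullX (Set.range p)) ⟨_, excPoint_mem (Set.mem_range_self i)⟩
  obtain ⟨g, hg⟩ := exists_isEqn (pullY (Set.range p)) ⟨_, excPoint_mem (Set.mem_range_self i)⟩
  convert isEqn_combDiv hf hg (fun j => isEqn_excDiv_excPoint hp i j) 0 0 e using 1
  rw [zpow_zero, zpow_zero, one_mul, one_mul, Finset.prod_eq_single i _ (by simp)]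
  · simp
  · intro j _ hj
    simp [hj]

/-- The classes `H_x`, `H_y`, `E_i` are linearly independent in the Picard group. -/
theorem eq_zero_of_mk_combDiv (hp : Function.Injective p) {k l : ℤ} {e : ι → ℤ}
    (h : Pic.mk (combDiv p k l e) = 1) : k = 0 ∧ l = 0 ∧ ∀ i, e i = 0 := by
  obtain ⟨f, hf⟩ := (QuotientGroup.eq_one_iff (combDiv p k l e)).1 h
  have hu : ∀ P g, IsEqn (combDiv p k l e) P g → UnitAt P.1 (g / f) := fun P g hg =>
    (isEqn_principal f).unique (hf ▸ hg)
  obtain ⟨c, hc, ec⟩ := exists_eq_const_of_forall_unitAt isPlane_xy f.ne_zero fun π hπ => by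
    simpa using (hu ⟨_, primePoint_mem hπ⟩ _ (isEqn_combDiv_primePoint hπ k l e)).inv
  have hu' : ∀ P g, IsEqn (combDiv p k l e) P g → UnitAt P.1 g := fun P g hg => by
    have := (hu P g hg).mul (unitAt_const (blowUp_const P.2) hc)
    rw [← ec] at this
    simpa using this
  have hk : k = 0 := isPlane_invX.line_uniformizer.zpow_eq_zero
    (hu' _ _ (isEqn_combDiv_infXPoint k l e))
  have hl : l = 0 := isPlane_invY.line_uniformizer.zpow_eq_zero
    (hu' _ _ (isEqn_combDiv_infYPoint k l e))
  subst hk hl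
  exact ⟨rfl, rfl, fun i => (isPlane_chart (p i)).line_uniformizer.zpow_eq_zero
    (hu' _ _ (isEqn_combDiv_excPoint hp i e))⟩

/-- The classes `H_x`, `H_y`, `E_i` generate the Picard group. -/
theorem exists_mk_eq_combDiv (hp : Function.Injective p) (D : CaDiv (blowUp (Set.range p))) :
    ∃ (k l : ℤ) (e : ι → ℤ), Pic.mk D = Pic.mk (combDiv p k l e) := by
  obtain ⟨f, hf⟩ := exists_isEqn_primePoint D
  have hπ : Prime (coordLeft x y) := isPlane_xy.prime_left
  have hf0 : f ≠ 0 := (hf _ hπ).ne_zero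
  obtain ⟨k, hk⟩ := IsEqn.exists_zpow (P := ⟨_, infXPoint_mem⟩)
    isPlane_invX.line_uniformizer (D * (principal _ (Units.mk0 f hf0))⁻¹)
  obtain ⟨l, hl⟩ := IsEqn.exists_zpow (P := ⟨_, infYPoint_mem⟩)
    isPlane_invY.line_uniformizer (D * (principal _ (Units.mk0 f hf0))⁻¹)
  set D₁ := D * (principal _ (Units.mk0 f hf0))⁻¹ with hD₁
  have h2 : ∀ i, ∃ n : ℤ, IsEqn (D₁ * (combDiv p k l 0)⁻¹)
      ⟨_, excPoint_mem (Set.mem_range_self i)⟩ (vAt (p i) ^ n) := fun i =>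
    IsEqn.exists_zpow (isPlane_chart (p i)).line_uniformizer _
  choose e he using h2
  refine ⟨k, l, e, ?_⟩
  have hsplit : combDiv p k l e = combDiv p k l 0 * combDiv p 0 0 e := by simp [combDiv]
  have key : D₁ * (combDiv p k l 0)⁻¹ * (combDiv p 0 0 e)⁻¹ = 1 := by
    refine eq_one_of_isUniformizer fun P ϖ hϖ => ?_
    obtain ⟨P, hP⟩ := P
    rcases eq_of_isUniformizer hP hϖ with ⟨π, hπ, rfl⟩ | rfl | rfl | ⟨_, ⟨i, rfl⟩, rfl⟩
    · have h1 : IsEqn D₁ ⟨_, hP⟩ (f * f⁻¹) := (hf π hπ).mul (isEqn_principal _).inv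
      rw [mul_inv_cancel₀ hf0] at h1
      simpa using (h1.mul (isEqn_combDiv_primePoint hπ k l 0).inv).mul
        (isEqn_combDiv_primePoint hπ 0 0 e).inv
    · convert (hk.mul (isEqn_combDiv_infXPoint k l 0).inv).mul
        (isEqn_combDiv_infXPoint 0 0 e).inv using 1
      rw [mul_inv_cancel₀ hk.ne_zero]; simp
    · convert (hl.mul (isEqn_combDiv_infYPoint k l 0).inv).mul
        (isEqn_combDiv_infYPoint 0 0 e).inv using 1
      rw [mul_inv_cancel₀ hl.ne_zero]; simp
    · convert (he i).mul (isEqn_combDiv_excPoint hp i e).inv using 1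
      rw [mul_inv_cancel₀ (he i).ne_zero]
  have hD : D = combDiv p k l e * principal _ (Units.mk0 f hf0) := by
    rw [hsplit]
    rw [mul_inv_eq_one, mul_inv_eq_iff_eq_mul, hD₁, mul_inv_eq_iff_eq_mul] at key
    rw [key, mul_comm (combDiv p 0 0 e)]
  rw [hD, map_mul]
  have : Pic.mk (principal (blowUp (Set.range p)) (Units.mk0 f hf0)) = 1 :=
    (QuotientGroup.eq_one_iff _).2 ⟨_, rfl⟩
  rw [this, mul_one]

end PicardGroup

/-! ### The lattice `Pic(𝒳)` -/

section Lattice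

variable {m : ℕ}

/-- The labels of the centres as a sum of index types. -/
def centerEquiv (m : ℕ) : Center m ≃
    ((Fin (m + 1) ⊕ Fin (m + 1)) ⊕ (Fin m ⊕ Fin m)) ⊕ (Fin m ⊕ Fin m) where
  toFun
    | .A i => .inl (.inl (.inl i))
    | .E i => .inl (.inl (.inr i))
    | .Bt j => .inl (.inr (.inl j))
    | .Ct j => .inl (.inr (.inr j))
    | .B j => .inr (.inl j)
    | .C j => .inr (.inr j)
  invFun
    | .inl (.inl (.inl i)) => .A i
    | .inl (.inl (.inr i)) => .E i
    | .inl (.inr (.inl j)) => .Bt j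
    | .inl (.inr (.inr j)) => .Ct j
    | .inr (.inl j) => .B j
    | .inr (.inr j) => .C j
  left_inv := by rintro (_ | _ | _ | _ | _ | _) <;> rfl
  right_inv := by rintro (((_ | _) | (_ | _)) | (_ | _)) <;> rfl

instance : Fintype (Center m) := Fintype.ofEquiv _ (centerEquiv m).symm

theorem card_center (m : ℕ) : Fintype.card (Center m) = 6 * m + 2 := by
  rw [Fintype.card_congr (centerEquiv m)]
  simp only [Fintype.card_sum, Fintype.card_fin]
  ring

/-- The labels of the generators as an iterated option type. -/
def genEquiv (m : ℕ) : Gen m ≃ Option (Option (Center m)) where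
  toFun
    | .Hx => none
    | .Hy => some none
    | .exc p => some (some p)
  invFun
    | none => .Hx
    | some none => .Hy
    | some (some p) => .exc p
  left_inv := by rintro (_ | _ | _) <;> rfl
  right_inv := by rintro (_ | _ | _) <;> rfl

instance : Finite (Gen m) := .of_equiv _ (genEquiv m).symm

/-- The zeros `a_i`, `d_i` of the right-hand side. -/
def zeros (q : Params m) : Fin (m + 1) ⊕ Fin (m + 1) → ℂ := Sum.elim q.a q.d

/-- The poles `b_j`, `c_j` of the right-hand side. -/
def poles (q : Params m) : Fin m ⊕ Fin m → ℂ := Sum.elim q.b q.c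

theorem Params.Distinct.injective {q : Params m} (h : q.Distinct) :
    Function.Injective (Sum.elim (zeros q) (poles q)) := h

/-- The centres in terms of the zeros and poles. -/
def sumCenter {ι κ κ' : Type*} (a : ι → ℂ) (b : κ → ℂ) (b' : κ' → ℂ) : (ι ⊕ κ) ⊕ κ' → Pt
  | .inl (.inl i) => (some (a i), some (-a i))
  | .inl (.inr j) => (some (b j), none)
  | .inr j => (none, some (b' j))

theorem sumCenter_injective {ι κ κ' : Type*} {a : ι → ℂ} {b : κ → ℂ} {b' : κ' → ℂ}
    (ha : Function.Injective a) (hb : Function.Injective b) (hb' : Function.Injective b') :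
    Function.Injective (sumCenter a b b') := by
  have hs : ∀ {c d : ℂ}, (some c : OnePoint ℂ) = some d → c = d := fun h =>
    Option.some_injective _ h
  have hn : ∀ {c : ℂ}, (some c : OnePoint ℂ) ≠ none := fun h => Option.some_ne_none _ h
  rintro ((i | i) | i) ((j | j) | j) h <;> obtain ⟨h₁, h₂⟩ := Prod.ext_iff.1 h
  · rw [ha (hs h₁)]
  · exact absurd h₂ hn
  · exact absurd h₁ hn
  · exact absurd h₂.symm hn
  · rw [hb (hs h₁)]
  · exact absurd h₁ hn
  · exact absurd h₁.symm hn
  · exact absurd h₁.symm hn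
  · rw [hb' (hs h₂)]

theorem center_eq (q₀ q : Params m) (c : Center m) :
    center q₀ q c = sumCenter (zeros q) (poles q) (poles q₀) (centerEquiv m c) := by
  rcases c with _ | _ | _ | _ | _ | _ <;> rfl

theorem center_injective {q₀ q : Params m} (h₀ : q₀.Distinct) (h : q.Distinct) :
    Function.Injective (center q₀ q) := fun c c' hc =>
  (centerEquiv m).injective (sumCenter_injective (a := zeros q) (b := poles q) (b' := poles q₀)
    (h.injective.comp Sum.inl_injective) (h.injective.comp Sum.inr_injective)
    (h₀.injective.comp Sum.inr_injective) (by rwa [← center_eq, ← center_eq]))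

theorem range_center (q₀ q : Params m) : Set.range (center q₀ q) =
    fibCenters (Set.range (zeros q)) (Set.range (poles q)) (Set.range (poles q₀)) := by
  ext p
  constructor
  · rintro ⟨c, rfl⟩
    rw [center_eq]
    rcases centerEquiv m c with (i | j) | j
    · exact .inl ⟨_, ⟨i, rfl⟩, rfl⟩
    · exact .inr (.inl ⟨_, ⟨j, rfl⟩, rfl⟩)
    · exact .inr (.inr ⟨_, ⟨j, rfl⟩, rfl⟩)
  · rintro (⟨_, ⟨i, rfl⟩, rfl⟩ | ⟨_, ⟨j, rfl⟩, rfl⟩ | ⟨_, ⟨j, rfl⟩, rfl⟩)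
    · exact ⟨(centerEquiv m).symm (.inl (.inl i)), by
        rw [center_eq, Equiv.apply_symm_apply]; rfl⟩
    · exact ⟨(centerEquiv m).symm (.inl (.inr j)), by
        rw [center_eq, Equiv.apply_symm_apply]; rfl⟩
    · exact ⟨(centerEquiv m).symm (.inr j), by rw [center_eq, Equiv.apply_symm_apply]; rfl⟩

theorem combDiv_add {ι : Type*} [Fintype ι] {p : ι → Pt} (k l k' l' : ℤ) (e e' : ι → ℤ) :
    combDiv p (k + k') (l + l') (e + e') = combDiv p k l e * combDiv p k' l' e' := by
  simp only [combDiv, zpow_add, Pi.add_apply, Finset.prod_mul_distrib]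
  ac_rfl

/-- The map `ι_n` sends coefficients to the class of the corresponding divisor. -/
theorem iota_eq (q : ℤ → Params m) (n : ℤ) (v : PicLattice m) :
    iota q n v = Additive.ofMul (Pic.mk (combDiv (center (q (n - 1)) (q n)) (v .Hx) (v .Hy)
      fun p => v (.exc p))) := by
  classical
  induction v using Finsupp.induction_linear with
  | zero =>
    rw [map_zero]
    have : combDiv (center (q (n - 1)) (q n)) 0 0 (fun _ => 0) = 1 := by simp [combDiv]
    exact (congrArg (fun D => Additive.ofMul (Pic.mk D)) this).symm
  | add v w hv hw =>
    rw [map_add, hv, hw, ← ofMul_mul, ← map_mul, ← combDiv_add]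
    rfl
  | single g k =>
    rw [iota, Finsupp.linearCombination_single]
    rcases g with _ | _ | p
    · refine Eq.trans ?_ (congrArg (fun D => Additive.ofMul (Pic.mk D))
        (a₁ := pullX (centers q n) ^ k) ?_)
      · exact (congrArg Additive.ofMul (map_zpow Pic.mk (pullX (centers q n)) k)).symm
      · simp [combDiv]
    · refine Eq.trans ?_ (congrArg (fun D => Additive.ofMul (Pic.mk D))
        (a₁ := pullY (centers q n) ^ k) ?_)
      · exact (congrArg Additive.ofMul (map_zpow Pic.mk (pullY (centers q n)) k)).symm
      · simp [combDiv]
    · refine Eq.trans ?_ (congrArg (fun D => Additive.ofMul (Pic.mk D))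
        (a₁ := excDiv (Z := centers q n) (Set.mem_range_self p) ^ k) ?_)
      · exact (congrArg Additive.ofMul (map_zpow Pic.mk
          (excDiv (Z := centers q n) (Set.mem_range_self p)) k)).symm
      · rw [combDiv, Finset.prod_eq_single p]
        · simp
        · intro p' _ hp'
          simp [hp'.symm]
        · simp

theorem iota_bijective {q : ℤ → Params m} (hdist : ∀ n, (q n).Distinct) (n : ℤ) :
    Function.Bijective (iota q n) := by
  have hp := center_injective (hdist (n - 1)) (hdist n)
  constructor
  · rw [injective_iff_map_eq_zero]
    intro v hv
    rw [iota_eq] at hv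
    obtain ⟨h1, h2, h3⟩ := eq_zero_of_mk_combDiv hp (Additive.ofMul.injective hv)
    ext (_ | _ | p)
    · exact h1
    · exact h2
    · exact h3 p
  · intro c
    obtain ⟨D, hD⟩ := QuotientGroup.mk'_surjective _ c.toMul
    obtain ⟨k, l, e, h⟩ := exists_mk_eq_combDiv hp D
    refine ⟨Finsupp.equivFunOnFinite.symm fun
      | .Hx => k
      | .Hy => l
      | .exc p => e p, ?_⟩
    rw [iota_eq]
    exact congrArg Additive.ofMul (h.symm.trans hD)

theorem ncard_centers {q : ℤ → Params m} (hdist : ∀ n, (q n).Distinct) (n : ℤ) :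
    (centers q n).ncard = 6 * m + 2 := by
  rw [← card_center, ← Nat.card_eq_fintype_card, ← Set.ncard_univ, centers, ← Set.image_univ,
    Set.ncard_image_of_injective _ (center_injective (hdist (n - 1)) (hdist n))]

theorem phi_single (g : Gen m) : Phi (Finsupp.single g 1) =
    match g with
    | .Hx => (2 * m + 1 : ℤ) • Hx + Hy - ∑ i, cA i - ∑ i, cE i - ∑ j, cBt j - ∑ j, cCt j
    | .Hy => Hx
    | .exc (.A i) => Hx - cE i
    | .exc (.E i) => Hx - cA i
    | .exc (.B j) => Hx - cBt j
    | .exc (.C j) => Hx - cCt j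
    | .exc (.Bt j) => cC j
    | .exc (.Ct j) => cB j := by
  rcases g with _ | _ | (_ | _ | _ | _ | _ | _) <;>
    simp only [Phi, Finsupp.linearCombination_single, one_smul]

theorem phi_surjective : Function.Surjective (Phi (m := m)) := by
  rw [← LinearMap.range_eq_top, eq_top_iff]
  have hmem : ∀ g : Gen m, Phi (Finsupp.single g 1) ∈ LinearMap.range (Phi (m := m)) :=
    fun g => LinearMap.mem_range_self _ _
  have hHx : Hx ∈ LinearMap.range (Phi (m := m)) := by simpa only [phi_single] using hmem .Hy
  have key : ∀ {v : PicLattice m}, Hx - v ∈ LinearMap.range (Phi (m := m)) →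
      v ∈ LinearMap.range (Phi (m := m)) := fun h => by simpa using sub_mem hHx h
  have hA : ∀ i, cA i ∈ LinearMap.range (Phi (m := m)) := fun i =>
    key (by simpa only [phi_single] using hmem (.exc (.E i)))
  have hE : ∀ i, cE i ∈ LinearMap.range (Phi (m := m)) := fun i =>
    key (by simpa only [phi_single] using hmem (.exc (.A i)))
  have hBt : ∀ i, cBt i ∈ LinearMap.range (Phi (m := m)) := fun i =>
    key (by simpa only [phi_single] using hmem (.exc (.B i)))
  have hCt : ∀ i, cCt i ∈ LinearMap.range (Phi (m := m)) := fun i =>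
    key (by simpa only [phi_single] using hmem (.exc (.C i)))
  have hHy : Hy ∈ LinearMap.range (Phi (m := m)) := by
    have h1 := hmem .Hx
    simp only [phi_single] at h1
    have h2 := add_mem (add_mem (add_mem (add_mem h1
      (sum_mem (t := Finset.univ) fun j _ => hCt j)) (sum_mem (t := Finset.univ) fun j _ => hBt j))
      (sum_mem (t := Finset.univ) fun i _ => hE i)) (sum_mem (t := Finset.univ) fun i _ => hA i)
    have h3 := sub_mem h2 (Submodule.smul_mem _ (2 * m + 1 : ℤ) hHx)
    rwa [sub_add_cancel, sub_add_cancel, sub_add_cancel, sub_add_cancel,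
      add_sub_cancel_left] at h3
  have hall : ∀ g : Gen m, Finsupp.single g 1 ∈ LinearMap.range (Phi (m := m)) := by
    rintro (_ | _ | (i | i | j | j | j | j))
    · exact hHx
    · exact hHy
    · exact hA i
    · exact hE i
    · simpa only [phi_single] using hmem (.exc (.Ct j))
    · simpa only [phi_single] using hmem (.exc (.Bt j))
    · exact hBt j
    · exact hCt j
  intro v _
  induction v using Finsupp.induction_linear with
  | zero => exact zero_mem _
  | add v w hv hw => exact add_mem (hv trivial) (hw trivial)
  | single g k => simpa using Submodule.smul_mem _ k (hall g)

theorem phi_bijective : Function.Bijective (Phi (m := m)) :=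
  ⟨OrzechProperty.injective_of_surjective_endomorphism _ phi_surjective, phi_surjective⟩

theorem intersection_single (g h : Gen m) :
    intersection (Finsupp.single g 1) (Finsupp.single h 1) =
    match g, h with
      | .Hx, .Hy => 1
      | .Hy, .Hx => 1
      | .exc p, .exc p' => if p = p' then -1 else 0
      | _, _ => 0 := by
  rcases g with _ | _ | _ <;> rcases h with _ | _ | _ <;>
    simp only [intersection, Finsupp.linearCombination_single, one_smul]

theorem intersection_phi (v w : PicLattice m) :
    intersection (Phi v) (Phi w) = intersection v w := by
  have : intersection.compl₁₂ Phi Phi = intersection (m := m) := by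
    refine Finsupp.lhom_ext' fun g => LinearMap.ext_ring (Finsupp.lhom_ext' fun h =>
      LinearMap.ext_ring ?_)
    simp only [LinearMap.comp_apply, LinearMap.compl₁₂_apply, Finsupp.lsingle_apply, phi_single]
    rcases g with _ | _ | (_ | _ | _ | _ | _ | _) <;> rcases h with _ | _ | (_ | _ | _ | _ | _ | _) <;>
      simp [intersection_single, -zsmul_eq_mul, -Finsupp.smul_single]
    ring
  exact LinearMap.congr_fun₂ this v w

end Lattice

/-! ### Pullback of divisors along the lifted mapping -/

section LocalEquations

variable {Z' : Set Pt} {σ : K ≃ₐ[ℂ] K} {u w w' h : K}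

/-- The three charts over a point of the base, distinguished by the behaviour of the coordinates. -/
theorem FibPoint.cases {R : LocalSubring K} (hu0 : u ≠ 0) (hu : Vanishes R u)
    (hR : FibPoint R u w) : w⁻¹ ∈ R.toSubring ∨ (Vanishes R w ∧ u / w ∈ R.toSubring) ∨
      (Vanishes R w ∧ w / u ∈ R.toSubring) := by
  rcases hR with hR | hR | hR
  · exact .inl hR.right
  · rcases vanishes_or_unitAt hR.right with hw | hw
    · exact .inr (.inl ⟨hw, hR.left⟩)
    · exact .inl hw.2.2
  · refine .inr (.inr ⟨?_, hR.left⟩)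
    have := Vanishes.mul hR.left hu
    rwa [div_mul_cancel₀ w hu0] at this

/-- The divisor `D` has near `P` the local equation of the exceptional curve over the
point `u = w = 0`. -/
structure FibExc {X : Set (LocalSubring K)} (D : CaDiv X) (P : X) (u w : K) : Prop where
  one : w⁻¹ ∈ P.1.toSubring → IsEqn D P 1
  left : Vanishes P.1 w → w / u ∈ P.1.toSubring → IsEqn D P u
  right : Vanishes P.1 w → u / w ∈ P.1.toSubring → IsEqn D P w

/-- The fibre `u = 0` pulls back to the sum of the exceptional curves over `u = w = 0` and
over `u = w' = 0` if `w w' = u h` with a unit `h`. -/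
theorem FibExc.mul {X : Set (LocalSubring K)} {D E : CaDiv X} {P : X} (hu0 : u ≠ 0) (hw0 : w ≠ 0)
    (hD : FibExc D P u w) (hE : FibExc E P u w') (hu : Vanishes P.1 u)
    (hww : w * w' = u * h) (hh : UnitAt P.1 h) (hP : FibPoint P.1 u w) : IsEqn (D * E) P u := by
  have hh0 := hh.1
  have e : w' = u * h / w := by field_simp; linear_combination hww
  rcases hP.cases hu0 hu with hw | ⟨hw, huw⟩ | ⟨hw, hwu⟩
  · have e1 : w' / u = w⁻¹ * h := by rw [e]; field_simp
    have hm : w' / u ∈ P.1.toSubring := by rw [e1]; exact mul_mem hw hh.2.1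
    have hv : Vanishes P.1 w' := by
      have := Vanishes.mul hm hu
      rwa [div_mul_cancel₀ w' hu0] at this
    simpa using (hD.one hw).mul (hE.left hv hm)
  · have e1 : w' = u / w * h := by rw [e]; field_simp
    have hm : w' ∈ P.1.toSubring := by rw [e1]; exact mul_mem huw hh.2.1
    rcases vanishes_or_unitAt hm with hv | hv
    · have e2 : u / w' = w / h := by rw [e]; field_simp
      have hm2 : u / w' ∈ P.1.toSubring := by
        rw [e2, div_eq_mul_inv]; exact mul_mem hw.1 hh.2.2
      refine ((hD.right hw huw).mul (hE.right hv hm2)).congr ?_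
      rw [hww]
      convert hh.inv using 1
      field_simp
    · refine ((hD.right hw huw).mul (hE.one hv.2.2)).congr ?_
      convert hv.div hh using 1
      rw [e1]; field_simp
  · have e1 : w'⁻¹ = w / u / h := by rw [e]; field_simp
    have hm : w'⁻¹ ∈ P.1.toSubring := by
      rw [e1, div_eq_mul_inv]; exact mul_mem hwu hh.2.2
    simpa using (hD.left hw hwu).mul (hE.one hm)

variable {Z : Set Pt} (hσ : ∀ R ∈ blowUp Z, pullSub σ R ∈ blowUp Z') {P : blowUp Z} {p p' : Pt}

theorem isEqn_pull_pullX_one (hx : σ x ∈ P.1.toSubring) :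
    IsEqn ((homOfPull σ hσ).pullbackDiv (pullX Z')) P 1 := by
  have : x ∈ ((homOfPull σ hσ).toFun P).1.toSubring := (mem_pullSub σ).2 hx
  simpa using (isEqn_pullX_one this).pullback (homOfPull σ hσ)

theorem isEqn_pull_pullX_inv (hx : (σ x)⁻¹ ∈ P.1.toSubring) :
    IsEqn ((homOfPull σ hσ).pullbackDiv (pullX Z')) P (σ x)⁻¹ := by
  have : x⁻¹ ∈ ((homOfPull σ hσ).toFun P).1.toSubring :=
    (mem_pullSub σ).2 (by rwa [map_inv₀])
  simpa using (isEqn_pullX_inv this).pullback (homOfPull σ hσ)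

theorem isEqn_pull_pullY_one (hy : σ y ∈ P.1.toSubring) :
    IsEqn ((homOfPull σ hσ).pullbackDiv (pullY Z')) P 1 := by
  have : y ∈ ((homOfPull σ hσ).toFun P).1.toSubring := (mem_pullSub σ).2 hy
  simpa using (isEqn_pullY_one this).pullback (homOfPull σ hσ)

theorem isEqn_pull_pullY_inv (hy : (σ y)⁻¹ ∈ P.1.toSubring) :
    IsEqn ((homOfPull σ hσ).pullbackDiv (pullY Z')) P (σ y)⁻¹ := by
  have : y⁻¹ ∈ ((homOfPull σ hσ).toFun P).1.toSubring :=
    (mem_pullSub σ).2 (by rwa [map_inv₀])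
  simpa using (isEqn_pullY_inv this).pullback (homOfPull σ hσ)

theorem liesOver_pullSub {R : LocalSubring K} : LiesOver (pullSub σ R) p ↔
    Vanishes R (localCoord (σ x) p.1) ∧ Vanishes R (localCoord (σ y) p.2) := by
  rw [LiesOver, vanishes_pullSub, vanishes_pullSub, map_localCoord, map_localCoord]

theorem isEqn_pull_excDiv_one (hp : p ∈ Z') {u v : K} (e₁ : localCoord (σ x) p.1 = u)
    (e₂ : localCoord (σ y) p.2 = v) (hl : ¬ (Vanishes P.1 u ∧ Vanishes P.1 v)) :
    IsEqn ((homOfPull σ hσ).pullbackDiv (excDiv hp)) P 1 := by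
  subst e₁ e₂
  have := isEqn_excDiv_one (P := (homOfPull σ hσ).toFun P) hp
    (fun h => hl (liesOver_pullSub.1 h))
  simpa using this.pullback (homOfPull σ hσ)

theorem isEqn_pull_excDiv (hp : p ∈ Z') {u v w c₁ c₂ : K} (e₁ : localCoord (σ x) p.1 = u)
    (e₂ : localCoord (σ y) p.2 = v) (hl : Vanishes P.1 u ∧ Vanishes P.1 v) (hw : w ≠ 0)
    (hu : u / w ∈ P.1.toSubring) (hv : v / w ∈ P.1.toSubring)
    (hc₁ : c₁ ∈ P.1.toSubring) (hc₂ : c₂ ∈ P.1.toSubring) (e : w = c₁ * u + c₂ * v) :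
    IsEqn ((homOfPull σ hσ).pullbackDiv (excDiv hp)) P w := by
  subst e₁ e₂
  have hmem : ∀ z : K, z ∈ P.1.toSubring →
      σ.symm z ∈ ((homOfPull σ hσ).toFun P).1.toSubring := fun z hz =>
    (mem_pullSub σ).2 (by rwa [AlgEquiv.apply_symm_apply])
  have hσu : σ.symm (localCoord (σ x) p.1) = uAt p := by
    rw [← map_localCoord, AlgEquiv.symm_apply_apply]
  have hσv : σ.symm (localCoord (σ y) p.2) = vAt p := by
    rw [← map_localCoord, AlgEquiv.symm_apply_apply]
  have := isEqn_excDiv (P := (homOfPull σ hσ).toFun P) hp (liesOver_pullSub.2 hl)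
    (w := σ.symm w) (c₁ := σ.symm c₁) (c₂ := σ.symm c₂) (by simpa using hw)
    (by rw [← hσu, ← map_div₀]; exact hmem _ hu) (by rw [← hσv, ← map_div₀]; exact hmem _ hv)
    (hmem _ hc₁) (hmem _ hc₂) (by rw [← hσu, ← hσv, ← map_mul, ← map_mul, ← map_add, ← e])
  simpa using this.pullback (homOfPull σ hσ)

end LocalEquations

section Comparison

variable {Z Z' : Set Pt} {σ : K ≃ₐ[ℂ] K} {X : K} {P : blowUp Z} {α : ℂ}

/-- The exceptional curve over the zero `α` in terms of the fibre coordinate `y + x`. -/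
theorem fibExc_zero (hp : ((some α, some (-α)) : Pt) ∈ Z)
    (hu : Vanishes P.1 (x - algebraMap ℂ K α)) (hs : y + x ≠ 0) :
    FibExc (excDiv hp) P
      (x - algebraMap ℂ K α) (y + x) := by
  have hu0 : x - algebraMap ℂ K α ≠ 0 := localCoord_ne_zero (.inl rfl) (some α)
  have e : y + x = 1 * (x - algebraMap ℂ K α) + 1 * (y - algebraMap ℂ K (-α)) := by
    rw [map_neg]; ring
  have e' : y - algebraMap ℂ K (-α) = (y + x) - (x - algebraMap ℂ K α) := by
    rw [map_neg]; ring
  have hl : Vanishes P.1 (y + x) → LiesOver P.1 ((some α, some (-α)) : Pt) := fun hw =>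
    ⟨hu, by change Vanishes P.1 (y - algebraMap ℂ K (-α)); rw [e']; exact hw.sub hu⟩
  refine ⟨fun hw => isEqn_excDiv_one _ fun hl => ?_, fun hw hwu => ?_, fun hw huw => ?_⟩
  · refine ((vanishes_iff hs).1 ?_).2 hw
    rw [e]
    exact (Vanishes.mul (one_mem _) hl.1).add (Vanishes.mul (one_mem _) hl.2)
  · refine isEqn_excDiv _ (hl hw) (c₁ := 1) (c₂ := 0) hu0 ?_ ?_ (one_mem _) (zero_mem _) ?_
    · change (x - algebraMap ℂ K α) / (x - algebraMap ℂ K α) ∈ _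
      rw [div_self hu0]; exact one_mem _
    · change (y - algebraMap ℂ K (-α)) / (x - algebraMap ℂ K α) ∈ _
      rw [e', sub_div, div_self hu0]; exact sub_mem hwu (one_mem _)
    · change _ = 1 * (x - algebraMap ℂ K α) + 0 * _
      ring
  · refine isEqn_excDiv _ (hl hw) hs huw ?_ (one_mem _) (one_mem _) e
    change (y - algebraMap ℂ K (-α)) / (y + x) ∈ _
    rw [e', sub_div, div_self hs]; exact sub_mem (one_mem _) huw

/-- The exceptional curve over the pole `α` in terms of the fibre coordinate `(y + x)⁻¹`. -/
theorem fibExc_pole (hp : ((some α, none) : Pt) ∈ Z)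
    (hu : Vanishes P.1 (x - algebraMap ℂ K α)) (hs : y + x ≠ 0) :
    FibExc (excDiv hp) P
      (x - algebraMap ℂ K α) (y + x)⁻¹ := by
  have hu0 : x - algebraMap ℂ K α ≠ 0 := localCoord_ne_zero (.inl rfl) (some α)
  have hc := blowUp_const P.2
  have hx : x ∈ P.1.toSubring := by simpa using add_mem hu.1 (hc α)
  have hiff := vanishes_inv_add_iff (R := P.1) y_ne_zero hs hx
  have hl : Vanishes P.1 (y + x)⁻¹ → LiesOver P.1 ((some α, none) : Pt) := fun hw =>
    ⟨hu, hiff.2 hw⟩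
  have hk : Vanishes P.1 (y + x)⁻¹ → UnitAt P.1 (1 - x * (y + x)⁻¹) := fun hw =>
    unitAt_one.sub_vanishes (Vanishes.mul hx hw)
  have e : y⁻¹ = (y + x)⁻¹ * (1 - x * (y + x)⁻¹)⁻¹ := by
    have h1 : 1 - x * (y + x)⁻¹ = y * (y + x)⁻¹ := by field_simp; ring
    have := y_ne_zero
    rw [h1]; field_simp
  have e' : (y + x)⁻¹ = 0 * (x - algebraMap ℂ K α) + (1 - x * (y + x)⁻¹) * y⁻¹ := by
    have := y_ne_zero
    field_simp
    ring
  refine ⟨fun hw => isEqn_excDiv_one _ fun hl => ?_, fun hw hwu => ?_, fun hw huw => ?_⟩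
  · exact ((vanishes_iff (inv_ne_zero hs)).1 (hiff.1 hl.2)).2 hw
  · refine isEqn_excDiv _ (hl hw) (c₁ := 1) (c₂ := 0) hu0 ?_ ?_ (one_mem _) (zero_mem _) ?_
    · change (x - algebraMap ℂ K α) / (x - algebraMap ℂ K α) ∈ _
      rw [div_self hu0]; exact one_mem _
    · change y⁻¹ / (x - algebraMap ℂ K α) ∈ _
      rw [e, mul_comm, mul_div_assoc]
      exact mul_mem (hk hw).2.2 hwu
    · change _ = 1 * (x - algebraMap ℂ K α) + 0 * _
      ring
  · refine isEqn_excDiv _ (hl hw) (inv_ne_zero hs) huw ?_ (zero_mem _) (hk hw).2.1 e'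
    change y⁻¹ / (y + x)⁻¹ ∈ _
    nth_rw 1 [e]
    rw [mul_comm, mul_div_assoc, div_self (inv_ne_zero hs), mul_one]
    exact (hk hw).2.2

variable (hσ : ∀ R ∈ blowUp Z, pullSub σ R ∈ blowUp Z')

/-- The pullback of the exceptional curve over `(-α, α)` in terms of the fibre
coordinate `X + x`. -/
theorem fibExc_pull_zero (hX : σ x = X) (hy : σ y = x) 
    (hp : ((some (-α), some α) : Pt) ∈ Z')
    (hu : Vanishes P.1 (x - algebraMap ℂ K α)) (ht : X + x ≠ 0) :
    FibExc ((homOfPull σ hσ).pullbackDiv (excDiv hp)) P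
      (x - algebraMap ℂ K α) (X + x) := by
  have hu0 : x - algebraMap ℂ K α ≠ 0 := localCoord_ne_zero (.inl rfl) (some α)
  have e : X + x = 1 * (X - algebraMap ℂ K (-α)) + 1 * (x - algebraMap ℂ K α) := by
    rw [map_neg]; ring
  have e' : X - algebraMap ℂ K (-α) = (X + x) - (x - algebraMap ℂ K α) := by
    rw [map_neg]; ring
  have e1 : localCoord (σ x) (some (-α)) = X - algebraMap ℂ K (-α) := by rw [hX]; rfl
  have e2 : localCoord (σ y) (some α) = x - algebraMap ℂ K α := by rw [hy]; rfl
  refine ⟨fun hw => isEqn_pull_excDiv_one hσ hp e1 e2 ?_, fun hw hwu => ?_, fun hw huw => ?_⟩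
  · rintro ⟨h1, h2⟩
    refine ((vanishes_iff ht).1 ?_).2 hw
    rw [e]
    exact (Vanishes.mul (one_mem _) h1).add (Vanishes.mul (one_mem _) h2)
  · refine isEqn_pull_excDiv hσ hp e1 e2 ?_ hu0 (c₁ := 0) (c₂ := 1) ?_ ?_ (zero_mem _) (one_mem _) ?_
    · rw [e']; exact ⟨hw.sub hu, hu⟩
    · rw [e', sub_div, div_self hu0]; exact sub_mem hwu (one_mem _)
    · rw [div_self hu0]; exact one_mem _
    · ring
  · refine isEqn_pull_excDiv hσ hp e1 e2 ?_ ht (c₁ := 1) (c₂ := 1) ?_ ?_ (one_mem _) (one_mem _) ?_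
    · rw [e']; exact ⟨hw.sub hu, hu⟩
    · rw [e', sub_div, div_self ht]; exact sub_mem (one_mem _) huw
    · exact huw
    · exact e

/-- The pullback of the exceptional curve over `(∞, α)` in terms of the fibre
coordinate `(X + x)⁻¹`. -/
theorem fibExc_pull_pole (hX : σ x = X) (hy : σ y = x) 
    (hp : ((none, some α) : Pt) ∈ Z') (hu : Vanishes P.1 (x - algebraMap ℂ K α))
    (hX0 : X ≠ 0) (ht : X + x ≠ 0) :
    FibExc ((homOfPull σ hσ).pullbackDiv (excDiv hp)) P
      (x - algebraMap ℂ K α) (X + x)⁻¹ := by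
  have hu0 : x - algebraMap ℂ K α ≠ 0 := localCoord_ne_zero (.inl rfl) (some α)
  have hc := blowUp_const P.2
  have hx : x ∈ P.1.toSubring := by simpa using add_mem hu.1 (hc α)
  have hiff := vanishes_inv_add_iff (R := P.1) hX0 ht hx
  have hk : Vanishes P.1 (X + x)⁻¹ → UnitAt P.1 (1 - x * (X + x)⁻¹) := fun hw =>
    unitAt_one.sub_vanishes (Vanishes.mul hx hw)
  have e : X⁻¹ = (X + x)⁻¹ * (1 - x * (X + x)⁻¹)⁻¹ := by
    have h1 : 1 - x * (X + x)⁻¹ = X * (X + x)⁻¹ := by field_simp; ring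
    rw [h1]; field_simp
  have e' : (X + x)⁻¹ = (1 - x * (X + x)⁻¹) * X⁻¹ + 0 * (x - algebraMap ℂ K α) := by
    field_simp
    ring
  have e1 : localCoord (σ x) none = X⁻¹ := by rw [hX]; rfl
  have e2 : localCoord (σ y) (some α) = x - algebraMap ℂ K α := by rw [hy]; rfl
  refine ⟨fun hw => isEqn_pull_excDiv_one hσ hp e1 e2 ?_, fun hw hwu => ?_, fun hw huw => ?_⟩
  · exact fun hl => ((vanishes_iff (inv_ne_zero ht)).1 (hiff.1 hl.1)).2 hw
  · refine isEqn_pull_excDiv hσ hp e1 e2 ?_ hu0 (c₁ := 0) (c₂ := 1) ?_ ?_ (zero_mem _) (one_mem _) ?_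
    · exact ⟨hiff.2 hw, hu⟩
    · rw [e, mul_comm, mul_div_assoc]
      exact mul_mem (hk hw).2.2 hwu
    · rw [div_self hu0]; exact one_mem _
    · ring
  · refine isEqn_pull_excDiv hσ hp e1 e2 ?_ (inv_ne_zero ht) (c₁ := 1 - x * (X + x)⁻¹) (c₂ := 0) ?_ ?_
      (hk hw).2.1 (zero_mem _) ?_
    · exact ⟨hiff.2 hw, hu⟩
    · nth_rw 1 [e]
      rw [mul_comm, mul_div_assoc, div_self (inv_ne_zero ht), mul_one]
      exact (hk hw).2.2
    · exact huw
    · exact e'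

/-- The line `x = ∞` is linearly equivalent to the fibre `x = α`, by the function `x - α`. -/
theorem isEqn_pullX_mul_principal
    (hu0 : x - algebraMap ℂ K α ≠ 0) :
    (¬ Vanishes P.1 (x - algebraMap ℂ K α) →
      IsEqn (pullX Z * principal _ (Units.mk0 _ hu0)) P 1) ∧
    (Vanishes P.1 (x - algebraMap ℂ K α) →
      IsEqn (pullX Z * principal _ (Units.mk0 _ hu0)) P (x - algebraMap ℂ K α)) := by
  have hc := blowUp_const P.2
  constructor
  · intro hu
    rcases mem_or_vanishes_inv (mem_blowUp_iff.1 P.2).left_mem with hx | hx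
    · have h1 := unitAt_of_not_vanishes (sub_mem hx (hc α)) hu
      have h2 : IsEqn _ P (1 * _) := (isEqn_pullX_one hx).mul (isEqn_principal (Units.mk0 _ hu0))
      refine h2.congr ?_
      simpa using h1.inv
    · have h1 : UnitAt P.1 (1 - algebraMap ℂ K α * x⁻¹) :=
        unitAt_one.sub_vanishes (Vanishes.mul (hc α) hx)
      have h2 : IsEqn _ P (x⁻¹ * _) :=
        (isEqn_pullX_inv hx.1).mul (isEqn_principal (Units.mk0 _ hu0))
      refine h2.congr ?_
      convert h1.inv using 1
      have := x_ne_zero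
      rw [one_div]
      congr 1
      simp only [Units.val_mk0]
      field_simp
  · intro hu
    have hx : x ∈ P.1.toSubring := by simpa using add_mem hu.1 (hc α)
    have h2 : IsEqn _ P (1 * _) := (isEqn_pullX_one hx).mul (isEqn_principal (Units.mk0 _ hu0))
    simpa using h2

end Comparison

/-! ### The action on divisors -/

section Action

variable {ι κ : Type*} [Fintype ι] [Fintype κ] {a : ι → ℂ} {b : κ → ℂ} {B : Set ℂ}
  {Z Z' : Set Pt} {σ : K ≃ₐ[ℂ] K} {X : K}
  (hσ : ∀ R ∈ blowUp Z, pullSub σ R ∈ blowUp Z')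

theorem pull_pullY (hy : σ y = x) : (homOfPull σ hσ).pullbackDiv (pullY Z') = pullX Z := by
  refine eq_of_isEqn fun P => ?_
  rcases (mem_blowUp_iff.1 P.2).left_mem with hx | hx
  · exact ⟨1, isEqn_pull_pullY_one hσ (by rwa [hy]), isEqn_pullX_one hx⟩
  · refine ⟨x⁻¹, ?_, isEqn_pullX_inv hx⟩
    have := isEqn_pull_pullY_inv hσ (P := P) (by rwa [hy])
    rwa [hy] at this

/-- The fibre `x = α` over a zero `α` consists of the exceptional curve over `(α, -α)` and the
pullback of the one over `(-α, α)`. -/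
theorem exc_mul_pull_zero (hZ : Z = fibCenters (Set.range a) (Set.range b) B)
    (hab : Function.Injective (Sum.elim a b)) (h : Conjugate a b x y X)
    (hX : σ x = X) (hy : σ y = x) (i : ι) {p p' : Pt} (hp : p ∈ Z) (hp' : p' ∈ Z')
    (e : p = (some (a i), some (-a i))) (e' : p' = (some (-a i), some (a i))) :
    excDiv hp * (homOfPull σ hσ).pullbackDiv (excDiv hp') =
      pullX Z * principal _ (Units.mk0 (x - algebraMap ℂ K (a i)) (h.base (some (a i)))) := by
  subst e e'
  refine eq_of_isEqn fun P => ?_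
  have hc := blowUp_const P.2
  by_cases hu : Vanishes P.1 (x - algebraMap ℂ K (a i))
  · refine ⟨x - algebraMap ℂ K (a i), ?_, (isEqn_pullX_mul_principal _).2 hu⟩
    obtain ⟨k, hk, -, e⟩ := exists_ratio_eq hab i hc hu
    have hP : OnBlowUp x y (fibCenters (Set.range a) (Set.range b) B) P.1 :=
      hZ ▸ mem_blowUp_iff.1 P.2
    have hi : a i ∉ Set.range b := by
      rintro ⟨j, hj⟩
      exact Sum.inl_ne_inr (hab (a₁ := .inl i) (a₂ := .inr j) hj.symm)
    exact (fibExc_zero hp hu h.add_ne_zero).mul (h.base (some (a i))) h.add_ne_zero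
      (fibExc_pull_zero hσ hX hy hp' hu h.symm.add_ne_zero) hu (h.mul_eq.trans e) hk
      ((onBlowUp_zero_iff h.base h.left h.add_ne_zero hc (Set.mem_range_self i) hi hu).1 hP)
  · refine ⟨1, ?_, (isEqn_pullX_mul_principal _).1 hu⟩
    simpa using (isEqn_excDiv_one (P := P) hp fun hl => hu hl.1).mul
      (isEqn_pull_excDiv_one hσ (P := P) hp' rfl
        (v := x - algebraMap ℂ K (a i)) (by rw [hy]; rfl) fun hl => hu hl.2)

/-- The fibre `x = β` over a pole `β` consists of the exceptional curve over `(β, ∞)` and the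
pullback of the one over `(∞, β)`. -/
theorem exc_mul_pull_pole (hZ : Z = fibCenters (Set.range a) (Set.range b) B)
    (hab : Function.Injective (Sum.elim a b)) (h : Conjugate a b x y X)
    (hX : σ x = X) (hy : σ y = x) (j : κ) {p p' : Pt} (hp : p ∈ Z) (hp' : p' ∈ Z')
    (e : p = (some (b j), none)) (e' : p' = (none, some (b j))) :
    excDiv hp * (homOfPull σ hσ).pullbackDiv (excDiv hp') =
      pullX Z * principal _ (Units.mk0 (x - algebraMap ℂ K (b j)) (h.base (some (b j)))) := by
  subst e e'
  refine eq_of_isEqn fun P => ?_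
  have hc := blowUp_const P.2
  by_cases hu : Vanishes P.1 (x - algebraMap ℂ K (b j))
  · refine ⟨x - algebraMap ℂ K (b j), ?_, (isEqn_pullX_mul_principal _).2 hu⟩
    have hba : Function.Injective (Sum.elim b a) := by
      rw [← Sum.elim_swap]; exact hab.comp (Equiv.sumComm κ ι).injective
    obtain ⟨k, hk, -, e⟩ := exists_ratio_eq hba j hc hu
    have hP : OnBlowUp x y (fibCenters (Set.range a) (Set.range b) B) P.1 :=
      hZ ▸ mem_blowUp_iff.1 P.2
    have hj : b j ∉ Set.range a := by
      rintro ⟨i, hi⟩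
      exact Sum.inl_ne_inr (hab (a₁ := .inl i) (a₂ := .inr j) hi)
    refine (fibExc_pole hp hu h.add_ne_zero).mul (h.base (some (b j))) (inv_ne_zero h.add_ne_zero)
      (fibExc_pull_pole hσ hX hy hp' hu h.symm.left_ne_zero h.symm.add_ne_zero) hu ?_ hk
      ((onBlowUp_pole_iff h.base h.left h.add_ne_zero hc (Set.mem_range_self j) hj hu).1 hP)
    rw [← mul_inv, h.mul_eq, ratio_inv, e]
  · refine ⟨1, ?_, (isEqn_pullX_mul_principal _).1 hu⟩
    simpa using (isEqn_excDiv_one (P := P) hp fun hl => hu hl.1).mul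
      (isEqn_pull_excDiv_one hσ (P := P) hp' rfl
        (v := x - algebraMap ℂ K (b j)) (by rw [hy]; rfl) fun hl => hu hl.2)

/-- The exceptional curves over the line `x = ∞` correspond to those over the line `y = ∞`, through
the reflection `γ ↦ (∑ b - ∑ a) - γ`. -/
theorem pull_exc_infinity (hcard : Fintype.card ι = Fintype.card κ + 2) (h : Conjugate a b x y X)
    (hX : σ x = X) (hy : σ y = x) {γ γ' : ℂ} (hγ : γ + γ' = ∑ j, b j - ∑ i, a i)
    {p p' : Pt} (hp : p ∈ Z) (hp' : p' ∈ Z')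
    (e : p = (none, some γ)) (e' : p' = (some γ', none)) :
    (homOfPull σ hσ).pullbackDiv (excDiv hp') = excDiv hp := by
  subst e e'
  refine eq_of_isEqn fun P => ?_
  have hc := blowUp_const P.2
  have e1 : localCoord (σ x) (some γ') = X - algebraMap ℂ K γ' := by rw [hX]; rfl
  have e2 : localCoord (σ y) none = x⁻¹ := by rw [hy]; rfl
  by_cases hu : Vanishes P.1 x⁻¹
  swap
  · exact ⟨1, isEqn_pull_excDiv_one hσ hp' e1 e2 fun hl => hu hl.2,
      isEqn_excDiv_one hp fun hl => hu hl.1⟩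
  have hu0 : x⁻¹ ≠ 0 := inv_ne_zero x_ne_zero
  obtain ⟨r, hr, -, er⟩ := exists_ratio_eq_infinity a b hcard x_ne_zero hc hu
  have hrel := h.relation er
  have hrel' := h.symm.relation er
  have eX : X - algebraMap ℂ K γ' = (r - y * X) * x⁻¹ - (y - algebraMap ℂ K γ) := by
    rw [← hγ, map_add] at hrel
    linear_combination hrel
  have hXy : Vanishes P.1 (X - algebraMap ℂ K γ') ∨ Vanishes P.1 (y - algebraMap ℂ K γ) →
      r - y * X ∈ P.1.toSubring := by
    rintro (hl | hl)
    · have hXm : X ∈ P.1.toSubring := by simpa using add_mem hl.1 (hc γ')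
      exact sub_mem hr (mul_mem (mem_of_relation hu (hc _) hr hrel' hXm).1 hXm)
    · have hym : y ∈ P.1.toSubring := by simpa using add_mem hl.1 (hc γ)
      exact sub_mem hr (mul_mem hym (mem_of_relation hu (hc _) hr hrel hym).1)
  by_cases hv : Vanishes P.1 (y - algebraMap ℂ K γ)
  swap
  · refine ⟨1, isEqn_pull_excDiv_one hσ hp' e1 e2 fun hl => hv ?_,
      isEqn_excDiv_one hp fun hl => hv hl.2⟩
    have e3 : y - algebraMap ℂ K γ = (r - y * X) * x⁻¹ - (X - algebraMap ℂ K γ') := by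
      rw [eX]; ring
    rw [e3]
    exact (Vanishes.mul (hXy (.inl hl.1)) hu).sub hl.1
  have hd := hXy (.inr hv)
  have hv' : Vanishes P.1 (X - algebraMap ℂ K γ') := by
    rw [eX]; exact (Vanishes.mul hd hu).sub hv
  have hv0 : y - algebraMap ℂ K γ ≠ 0 := h.left (some γ)
  -- the ideals `(x⁻¹, y - γ)` and `(X - γ', x⁻¹)` agree, hence so do their generators
  rcases div_mem_of_liesOver hp P.2 ⟨hu, hv⟩ with hm | hm
  · change x⁻¹ / (y - algebraMap ℂ K γ) ∈ _ at hm
    refine ⟨y - algebraMap ℂ K γ, isEqn_pull_excDiv hσ hp' e1 e2 ⟨hv', hu⟩ hv0 (c₁ := -1)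
      (c₂ := r - y * X) ?_ hm (neg_mem (one_mem _)) hd ?_,
      isEqn_excDiv hp ⟨hu, hv⟩ hv0 hm ?_ (zero_mem _) (one_mem _) (c₁ := 0) (c₂ := 1) ?_⟩
    · rw [eX, sub_div, div_self hv0, mul_div_assoc]
      exact sub_mem (mul_mem hd hm) (one_mem _)
    · rw [eX]; ring
    · change (y - algebraMap ℂ K γ) / (y - algebraMap ℂ K γ) ∈ _
      rw [div_self hv0]; exact one_mem _
    · change _ = 0 * x⁻¹ + 1 * (y - algebraMap ℂ K γ)
      ring
  · change (y - algebraMap ℂ K γ) / x⁻¹ ∈ _ at hm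
    refine ⟨x⁻¹, isEqn_pull_excDiv hσ hp' e1 e2 ⟨hv', hu⟩ hu0 (c₁ := 0) (c₂ := 1) ?_ ?_
      (zero_mem _) (one_mem _) ?_,
      isEqn_excDiv hp ⟨hu, hv⟩ hu0 ?_ hm (one_mem _) (zero_mem _) (c₁ := 1) (c₂ := 0) ?_⟩
    · rw [eX, sub_div, mul_div_assoc, div_self hu0, mul_one]
      exact sub_mem hd hm
    · rw [div_self hu0]; exact one_mem _
    · ring
    · change x⁻¹ / x⁻¹ ∈ _
      rw [div_self hu0]; exact one_mem _
    · change _ = 1 * x⁻¹ + 0 * (y - algebraMap ℂ K γ)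
      ring

theorem IsEqn.prod_single {X : Set (LocalSubring K)} {P : X} {D : ι → CaDiv X} {f : K} (i : ι)
    (h : IsEqn (D i) P f) (h' : ∀ j ≠ i, IsEqn (D j) P 1) : IsEqn (∏ j, D j) P f := by
  classical
  have := IsEqn.prod (s := Finset.univ) (D := D) (f := fun j => if j = i then f else 1) (P := P)
    fun j _ => by
      by_cases hj : j = i
      · subst hj; simpa using h
      · simpa [hj] using h' j hj
  simpa using this

theorem IsEqn.prod_one {X : Set (LocalSubring K)} {P : X} {D : ι → CaDiv X}
    (h : ∀ i, IsEqn (D i) P 1) : IsEqn (∏ i, D i) P 1 := by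
  simpa using IsEqn.prod (s := Finset.univ) (f := fun _ => 1) fun i _ => h i

/-- Over a finite point of the base, `y + x` is a local equation of the sum of the line `y = ∞`
and the principal divisor of `y + x` where it is regular, and `1` is one elsewhere. -/
theorem isEqn_pullY_mul_principal {P : blowUp Z} (hs : y + x ≠ 0) (hx : x ∈ P.1.toSubring) :
    (y + x ∈ P.1.toSubring → IsEqn (pullY Z * principal _ (Units.mk0 _ hs)) P (y + x)) ∧
    ((y + x)⁻¹ ∈ P.1.toSubring → IsEqn (pullY Z * principal _ (Units.mk0 _ hs)) P 1) := by
  have h1 : y + x ∈ P.1.toSubring →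
      IsEqn (pullY Z * principal _ (Units.mk0 _ hs)) P (y + x) := fun h => by
    have hy : y ∈ P.1.toSubring := by simpa using sub_mem h hx
    have h2 : IsEqn _ P (1 * _) := (isEqn_pullY_one hy).mul (isEqn_principal (Units.mk0 _ hs))
    simpa using h2
  refine ⟨h1, fun h => ?_⟩
  by_cases hm : y + x ∈ P.1.toSubring
  · exact (h1 hm).congr (UnitAt.div unitAt_one ⟨hs, hm, h⟩)
  · have hv := (vanishes_inv_add_iff y_ne_zero hs hx).2 (vanishes_inv_of_notMem hm h)
    have hu : UnitAt P.1 (1 + x * y⁻¹) := unitAt_one.add_vanishes (Vanishes.mul hx hv)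
    have h2 : IsEqn _ P (y⁻¹ * _) :=
      (isEqn_pullY_inv hv.1).mul (isEqn_principal (Units.mk0 _ hs))
    refine h2.congr ?_
    convert hu.inv using 1
    rw [one_div]
    congr 1
    have := y_ne_zero
    simp only [Units.val_mk0]
    field_simp

/-- Over a finite point of the base, `1` is a local equation of the pullback of the line `x = ∞`
where `X + x` is regular, and `(X + x)⁻¹` is one elsewhere. -/
theorem isEqn_pull_pullX {P : blowUp Z} (hX : σ x = X) (hX0 : X ≠ 0) (ht : X + x ≠ 0)
    (hx : x ∈ P.1.toSubring) :
    (X + x ∈ P.1.toSubring → IsEqn ((homOfPull σ hσ).pullbackDiv (pullX Z')) P 1) ∧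
    ((X + x)⁻¹ ∈ P.1.toSubring →
      IsEqn ((homOfPull σ hσ).pullbackDiv (pullX Z')) P (X + x)⁻¹) := by
  have h1 : X + x ∈ P.1.toSubring → IsEqn ((homOfPull σ hσ).pullbackDiv (pullX Z')) P 1 :=
    fun h => isEqn_pull_pullX_one hσ (by rw [hX]; simpa using sub_mem h hx)
  refine ⟨h1, fun h => ?_⟩
  by_cases hm : X + x ∈ P.1.toSubring
  · refine (h1 hm).congr (UnitAt.div (UnitAt.inv ⟨ht, hm, h⟩) unitAt_one)
  · have hv := (vanishes_inv_add_iff hX0 ht hx).2 (vanishes_inv_of_notMem hm h)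
    have hu : UnitAt P.1 (1 + x * X⁻¹) := unitAt_one.add_vanishes (Vanishes.mul hx hv)
    have h2 := isEqn_pull_pullX_inv hσ (P := P) (by rw [hX]; exact hv.1)
    rw [hX] at h2
    refine h2.congr ?_
    convert hu.inv using 1
    field_simp

/-- The pullback of the line `x = ∞` is the section `X = ∞` of the bundle `(x, y) ↦ x`. As
`(y + x) (X + x) = ratio a b x`, it is linearly equivalent, up to fibres, to the section `y = ∞`
minus the exceptional curves over the zeros and the poles: the function that compares the two
is `(y + x) ∏ (x - b_j)`. -/
theorem pull_pullX (hZ : Z = fibCenters (Set.range a) (Set.range b) B)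
    (hab : Function.Injective (Sum.elim a b)) (hcard : Fintype.card ι = Fintype.card κ + 2)
    (h : Conjugate a b x y X) (hX : σ x = X) {p : ι → Pt} {r : κ → Pt}
    (hp : ∀ i, p i ∈ Z) (hr : ∀ j, r j ∈ Z) (ep : ∀ i, p i = (some (a i), some (-a i)))
    (er : ∀ j, r j = (some (b j), none)) :
    ∃ g : Kˣ, (homOfPull σ hσ).pullbackDiv (pullX Z') *
      ((∏ i, excDiv (hp i)) * ∏ j, excDiv (hr j)) =
        pullX Z ^ (Fintype.card κ + 1) * pullY Z * principal _ g := by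
  obtain rfl : p = _ := funext ep
  obtain rfl : r = _ := funext er
  have hs0 := h.add_ne_zero
  have ht0 := h.symm.add_ne_zero
  have hQ0 : ∏ j, (x - algebraMap ℂ K (b j)) ≠ 0 :=
    Finset.prod_ne_zero_iff.2 fun j _ => h.base (some (b j))
  refine ⟨Units.mk0 _ hs0 * Units.mk0 _ hQ0, eq_of_isEqn fun P => ?_⟩
  have hc := blowUp_const P.2
  have hP : OnBlowUp x y (fibCenters (Set.range a) (Set.range b) B) P.1 :=
    hZ ▸ mem_blowUp_iff.1 P.2
  have hi : ∀ i, a i ∉ Set.range b := by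
    rintro i ⟨j, hj⟩
    exact Sum.inl_ne_inr (hab (a₁ := .inl i) (a₂ := .inr j) hj.symm)
  have hj : ∀ j, b j ∉ Set.range a := by
    rintro j ⟨i, hi⟩
    exact Sum.inl_ne_inr (hab (a₁ := .inl i) (a₂ := .inr j) hi)
  -- it suffices to compare local equations of the factors
  have key : ∀ {T e₁ e₂ s : K}, IsEqn ((homOfPull σ hσ).pullbackDiv (pullX Z')) P T →
      IsEqn (∏ i, excDiv (hp i)) P e₁ → IsEqn (∏ j, excDiv (hr j)) P e₂ →
      IsEqn (pullX Z ^ (Fintype.card κ + 1) * (pullY Z * principal _ (Units.mk0 _ hs0))) P s →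
      UnitAt P.1 (T * (e₁ * e₂) / (s * ∏ j, (x - algebraMap ℂ K (b j)))) →
      ∃ f, IsEqn ((homOfPull σ hσ).pullbackDiv (pullX Z') *
        ((∏ i, excDiv (hp i)) * ∏ j, excDiv (hr j))) P f ∧
        IsEqn (pullX Z ^ (Fintype.card κ + 1) * pullY Z *
          principal _ (Units.mk0 _ hs0 * Units.mk0 _ hQ0)) P f := by
    intro T e₁ e₂ s hT h₁ h₂ hs hu
    refine ⟨_, hT.mul (h₁.mul h₂), ?_⟩
    rw [map_mul, mul_assoc, ← mul_assoc (pullY Z), ← mul_assoc]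
    exact (hs.mul (isEqn_principal (Units.mk0 _ hQ0))).congr hu
  rcases mem_or_vanishes_inv hP.left_mem with hx | hx
  swap
  · -- the line at infinity of the base
    have hne : ∀ α : ℂ, ¬ Vanishes P.1 (x - algebraMap ℂ K α) := fun α hα => by
      have hxm : x ∈ P.1.toSubring := by simpa using add_mem hα.1 (hc α)
      exact ((vanishes_iff (inv_ne_zero x_ne_zero)).1 hx).2 (by simpa using hxm)
    have hE₁ := IsEqn.prod_one (P := P) fun i => isEqn_excDiv_one (hp i) fun hl => hne _ hl.1
    have hE₂ := IsEqn.prod_one (P := P) fun j => isEqn_excDiv_one (hr j) fun hl => hne _ hl.1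
    have hX1 := (isEqn_pullX_inv hx.1).pow (Fintype.card κ + 1)
    have hU : UnitAt P.1 (∏ j, (1 - algebraMap ℂ K (b j) * x⁻¹)) :=
      UnitAt.prod fun j _ => unitAt_one.sub_vanishes (Vanishes.mul (hc _) hx)
    have hprod : ∀ s : K, x⁻¹ ^ (Fintype.card κ + 1) * s * ∏ j, (x - algebraMap ℂ K (b j)) =
        x⁻¹ * s * ∏ j, (1 - algebraMap ℂ K (b j) * x⁻¹) := fun s => by
      have : x⁻¹ ^ Fintype.card κ * x ^ Fintype.card κ = 1 := by
        rw [← mul_pow, inv_mul_cancel₀ x_ne_zero, one_pow]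
      rw [prod_sub_eq_pow_mul b x_ne_zero, pow_succ]
      linear_combination (x⁻¹ * s * ∏ j, (1 - algebraMap ℂ K (b j) * x⁻¹)) * this
    obtain ⟨e, he, -, hratio⟩ := exists_ratio_eq_infinity a b hcard x_ne_zero hc hx
    have hrel := h.relation hratio
    have hx0 := x_ne_zero
    rcases mem_or_vanishes_inv hP.right_mem with hy | hy
    · obtain ⟨h1, h2, -⟩ := mem_of_relation hx (hc _) he hrel hy
      refine key (isEqn_pull_pullX_one hσ (by rw [hX]; exact h1)) hE₁ hE₂
        (hX1.mul ((isEqn_pullY_one hy).mul (isEqn_principal _))) ?_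
      convert (h2.mul hU).inv using 1
      have e1 : x⁻¹ * (1 * (y + x)) = 1 + x⁻¹ * y := by field_simp; ring
      rw [hprod, Units.val_mk0, e1, mul_one, mul_one, one_div]
    · obtain ⟨h1, h2⟩ := inv_eq_of_relation h.left_ne_zero h.symm.left_ne_zero hx (hc _) he hrel hy
      have hXm : X⁻¹ ∈ P.1.toSubring := by
        rw [h2, div_eq_mul_inv]; exact mul_mem (add_mem hy.1 hx.1) h1.2.2
      refine key (isEqn_pull_pullX_inv hσ (by rw [hX]; exact hXm)) hE₁ hE₂
        (hX1.mul ((isEqn_pullY_inv hy.1).mul (isEqn_principal _))) ?_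
      convert (h1.mul hU).inv using 1
      have hy0 := y_ne_zero
      have e1 : x⁻¹ * (y⁻¹ * (y + x)) = y⁻¹ + x⁻¹ := by field_simp; ring
      have hne0 : y⁻¹ + x⁻¹ ≠ 0 := by
        rw [← e1]; exact mul_ne_zero (inv_ne_zero hx0) (mul_ne_zero (inv_ne_zero hy0) hs0)
      rw [hX, h2, hprod, Units.val_mk0, e1, mul_one, mul_one, div_div, mul_left_comm,
        ← div_div, div_self hne0, one_div]
  have hX1 := (isEqn_pullX_one hx).pow (Fintype.card κ + 1)
  obtain ⟨hY, hY'⟩ := isEqn_pullY_mul_principal (P := P) hs0 hx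
  obtain ⟨hT, hT'⟩ := isEqn_pull_pullX hσ (P := P) hX h.symm.left_ne_zero ht0 hx
  replace hY := fun hm => hX1.mul (hY hm)
  replace hY' := fun hm => hX1.mul (hY' hm)
  simp only [one_pow, one_mul] at hY hY'
  have hmul := h.mul_eq
  by_cases hzero : ∃ i, Vanishes P.1 (x - algebraMap ℂ K (a i))
  · obtain ⟨i, hu⟩ := hzero
    have hu0 := h.base (some (a i))
    change x - algebraMap ℂ K (a i) ≠ 0 at hu0
    obtain ⟨k, hk, -, e⟩ := exists_ratio_eq hab i hc hu
    rw [e] at hmul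
    have hk0 := hk.1
    have hQ : UnitAt P.1 (∏ j, (x - algebraMap ℂ K (b j))) := UnitAt.prod fun j _ =>
      unitAt_sub_of_ne hc hu fun hji => hi i ⟨j, hji⟩
    have hE₁ : ∀ {f}, IsEqn (excDiv (hp i)) P f → IsEqn (∏ i, excDiv (hp i)) P f := fun hf =>
      hf.prod_single i fun i' hi' => isEqn_excDiv_one _ fun hl =>
        (unitAt_sub_of_ne hc hu fun e => hi' (Sum.inl_injective (hab e))).not_vanishes hl.1
    have hE₂ := IsEqn.prod_one (P := P) fun j => isEqn_excDiv_one (hr j) fun hl =>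
        (unitAt_sub_of_ne hc hu fun e => hi i ⟨j, e⟩).not_vanishes hl.1
    have hF := fibExc_zero (hp i) hu hs0
    have et : X + x = (x - algebraMap ℂ K (a i)) * k / (y + x) := by
      rw [eq_div_iff hs0, ← hmul]; ring
    rcases ((onBlowUp_zero_iff h.base h.left hs0 hc (Set.mem_range_self i) (hi i) hu).1 hP).cases
      hu0 hu with hw | ⟨hw, huw⟩ | ⟨hw, hwu⟩
    · refine key (hT ?_) (hE₁ (hF.one hw)) hE₂ (hY' hw) ?_
      · rw [et, div_eq_mul_inv]; exact mul_mem (mul_mem hu.1 hk.2.1) hw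
      · simpa using hQ.inv
    · refine key (hT ?_) (hE₁ (hF.right hw huw)) hE₂ (hY hw.1) ?_
      · rw [et, mul_div_right_comm]; exact mul_mem huw hk.2.1
      · convert hQ.inv using 1
        field_simp
    · refine key (hT' ?_) (hE₁ (hF.left hw hwu)) hE₂ (hY hw.1) ?_
      · rw [et, inv_div, ← div_div, div_eq_mul_inv]; exact mul_mem hwu hk.2.2
      · convert (hk.mul hQ).inv using 1
        rw [et]
        field_simp
  push Not at hzero
  have hE₁ := IsEqn.prod_one (P := P) fun i => isEqn_excDiv_one (hp i) fun hl => hzero i hl.1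
  by_cases hpole : ∃ j, Vanishes P.1 (x - algebraMap ℂ K (b j))
  · obtain ⟨j, hu⟩ := hpole
    have hu0 := h.base (some (b j))
    change x - algebraMap ℂ K (b j) ≠ 0 at hu0
    have hba : Function.Injective (Sum.elim b a) := by
      rw [← Sum.elim_swap]; exact hab.comp (Equiv.sumComm κ ι).injective
    obtain ⟨k, hk, -, e⟩ := exists_ratio_eq hba j hc hu
    rw [← ratio_inv, inv_eq_iff_eq_inv] at e
    rw [e] at hmul
    have hk0 := hk.1
    classical
    have hQ : UnitAt P.1 (∏ l ∈ Finset.univ.erase j, (x - algebraMap ℂ K (b l))) :=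
      UnitAt.prod fun l hl => unitAt_sub_of_ne hc hu fun e =>
        Finset.ne_of_mem_erase hl (Sum.inl_injective (hba e))
    have eQ := Finset.mul_prod_erase Finset.univ (fun l => x - algebraMap ℂ K (b l))
      (Finset.mem_univ j)
    have hQ1 := hQ.1
    have hE₂ : ∀ {f}, IsEqn (excDiv (hr j)) P f → IsEqn (∏ j, excDiv (hr j)) P f := fun hf =>
      hf.prod_single j fun j' hj' => isEqn_excDiv_one _ fun hl =>
        (unitAt_sub_of_ne hc hu fun e => hj' (Sum.inl_injective (hba e))).not_vanishes hl.1
    have hF := fibExc_pole (hr j) hu hs0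
    have et : X + x = (y + x)⁻¹ / (x - algebraMap ℂ K (b j)) / k := by
      rw [div_div, div_eq_mul_inv, ← hmul, inv_mul_cancel_left₀ hs0]
    have et' : (X + x)⁻¹ = (y + x) * (x - algebraMap ℂ K (b j)) * k := by
      rw [et, inv_div, div_div_eq_mul_div, div_inv_eq_mul]; ring
    rcases ((onBlowUp_pole_iff h.base h.left hs0 hc (Set.mem_range_self j) (hj j) hu).1 hP).cases
      hu0 hu with hw | ⟨hw, huw⟩ | ⟨hw, hwu⟩
    · rw [inv_inv] at hw
      refine key (hT' ?_) hE₁ (hE₂ (hF.one (by rwa [inv_inv]))) (hY hw) ?_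
      · rw [et']; exact mul_mem (mul_mem hw hu.1) hk.2.1
      · convert hk.div hQ using 1
        rw [et', ← eQ]
        field_simp
    · have huw' := huw
      rw [div_inv_eq_mul, mul_comm] at huw'
      refine key (hT' ?_) hE₁ (hE₂ (hF.right hw huw)) (hY' hw.1) ?_
      · rw [et']; exact mul_mem huw' hk.2.1
      · convert hk.div hQ using 1
        rw [et', ← eQ]
        field_simp
    · refine key (hT ?_) hE₁ (hE₂ (hF.left hw hwu)) (hY' hw.1) ?_
      · rw [et, div_eq_mul_inv _ k]; exact mul_mem hwu hk.2.2
      · convert hQ.inv using 1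
        rw [← eQ]
        field_simp
  · push Not at hpole
    have hE₂ := IsEqn.prod_one (P := P) fun j => isEqn_excDiv_one (hr j) fun hl => hpole j hl.1
    have hQ : UnitAt P.1 (∏ j, (x - algebraMap ℂ K (b j))) :=
      UnitAt.prod fun j _ => unitAt_of_not_vanishes (sub_mem hx (hc _)) (hpole j)
    have hg : UnitAt P.1 (ratio a b x) :=
      (UnitAt.prod fun i _ => unitAt_of_not_vanishes (sub_mem hx (hc _)) (hzero i)).div hQ
    have hg0 := hg.1
    have et : X + x = ratio a b x * (y + x)⁻¹ := by rw [← hmul]; field_simp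
    rcases mem_or_vanishes_inv hP.right_mem with hym | hyv
    · refine key (hT' ?_) hE₁ hE₂ (hY (add_mem hym hx)) ?_
      · rw [et, mul_inv, inv_inv]; exact mul_mem hg.2.2 (add_mem hym hx)
      · convert (hg.mul hQ).inv using 1
        rw [et]
        field_simp
    · have hw := (vanishes_inv_add y_ne_zero hs0 hx hyv).1
      refine key (hT ?_) hE₁ hE₂ (hY' hw) ?_
      · rw [et]; exact mul_mem hg.2.1 hw
      · simpa using hQ.inv

end Action

/-! ### The mapping and its lift -/

section Lift

variable {m : ℕ}

/-- A coordinate of a plane is not constant. -/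
theorem IsPlane.localCoord_left_ne_zero {s t : K} (h : IsPlane s t) (α : OnePoint ℂ) :
    localCoord s α ≠ 0 := by
  rw [← h.equiv_x, ← map_localCoord]
  exact (map_ne_zero_iff _ h.equiv.injective).2 (localCoord_ne_zero (.inl rfl) α)

theorem y_add_x_ne_zero : y + x ≠ 0 := by
  have h : IsPlane (y + x) x := by
    refine isPlane_of_mem mem_adjoin_right ?_
    simpa using sub_mem (mem_adjoin_left (s := y + x) (t := x)) mem_adjoin_right
  simpa [localCoord] using h.localCoord_left_ne_zero (some 0)

/-- The mapping composes the exchange of the coordinates with this involution over `ℂ(x)`. -/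
theorem add_mul_add_eq_ratio (q : Params m) :
    (y + x) * (xBar q + x) = ratio (zeros q) (poles q) x := by
  have e : xBar q + x = ratio (zeros q) (poles q) x / (y + x) := by
    simp only [xBar, ratio, zeros, poles, Fintype.prod_sum_type, Sum.elim_inl, Sum.elim_inr,
      Finset.prod_mul_distrib]
    rw [neg_add_eq_sub, sub_add_cancel, mul_comm (x + y), add_comm x y, ← div_div]
  rw [e, mul_div_cancel₀ _ y_add_x_ne_zero]

/-- The mapping is birational: `y` is a rational function of `x̄` and `ȳ = x`. -/
theorem isPlane_xBar (q : Params m) : IsPlane (xBar q) x := by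
  have hx : x ∈ IntermediateField.adjoin ℂ {xBar q, x} := mem_adjoin_right
  have hr : ratio (zeros q) (poles q) x ∈ IntermediateField.adjoin ℂ {xBar q, x} :=
    div_mem (prod_mem fun i _ => sub_mem hx (IntermediateField.algebraMap_mem _ _))
      (prod_mem fun i _ => sub_mem hx (IntermediateField.algebraMap_mem _ _))
  have h0 : ratio (zeros q) (poles q) x ≠ 0 := ratio_ne_zero (localCoord_ne_zero (.inl rfl))
  have hy : y = ratio (zeros q) (poles q) x / (xBar q + x) - x := by
    rw [← add_mul_add_eq_ratio] at h0 ⊢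
    rw [mul_div_cancel_right₀ _ (right_ne_zero_of_mul h0), add_sub_cancel_right]
  refine isPlane_of_mem hx ?_
  rw [hy]
  exact sub_mem (div_mem hr (add_mem mem_adjoin_left hx)) hx

theorem conjugate_xBar (q : Params m) : Conjugate (zeros q) (poles q) x y (xBar q) :=
  ⟨localCoord_ne_zero (.inl rfl), localCoord_ne_zero (.inr rfl),
    (isPlane_xBar q).localCoord_left_ne_zero, add_mul_add_eq_ratio q⟩

/-- Exchanging the coordinates exchanges the centres on `x = ∞` and on `y = ∞`, and changes the sign
of the zeros. -/
theorem swap_preimage_fibCenters {S S' T T' : Set ℂ} (h : ∀ α, α ∈ S' ↔ -α ∈ S) :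
    Prod.swap ⁻¹' fibCenters S' T T' = fibCenters S T' T := by
  ext ⟨p₁, p₂⟩
  constructor
  · rintro (⟨α, hα, e⟩ | ⟨β, hβ, e⟩ | ⟨γ, hγ, e⟩) <;> obtain ⟨rfl, rfl⟩ := Prod.ext_iff.1 e
    · exact .inl ⟨-α, (h α).1 hα, by rw [neg_neg]; rfl⟩
    · exact .inr (.inr ⟨β, hβ, rfl⟩)
    · exact .inr (.inl ⟨γ, hγ, rfl⟩)
  · rintro (⟨α, hα, e⟩ | ⟨β, hβ, e⟩ | ⟨γ, hγ, e⟩) <;> obtain ⟨rfl, rfl⟩ := Prod.ext_iff.1 e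
    · exact .inl ⟨-α, (h _).2 (by rwa [neg_neg]), by rw [neg_neg]; rfl⟩
    · exact .inr (.inr ⟨β, hβ, rfl⟩)
    · exact .inr (.inl ⟨γ, hγ, rfl⟩)

variable {q : ℤ → Params m}

/-- Confinement: a zero at `n + 1` is minus a zero at `n`. -/
theorem Confined.zeros_succ (hconf : Confined q) (n : ℤ) (i : Fin (m + 1) ⊕ Fin (m + 1)) :
    zeros (q (n + 1)) i.swap = -zeros (q n) i := by
  rcases i with i | i
  · exact hconf.d_succ n i
  · exact hconf.a_succ n i

/-- Confinement: poles at `n + 1` and at `n - 1` are exchanged by the involution induced on the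
line over `x = ∞`. -/
theorem Confined.poles_succ (hconf : Confined q) (n : ℤ) (j : Fin m ⊕ Fin m) :
    poles (q (n - 1)) j + poles (q (n + 1)) j.swap =
      ∑ j, poles (q n) j - ∑ i, zeros (q n) i := by
  simp only [zeros, poles, Fintype.sum_sum_type, Sum.elim_inl, Sum.elim_inr,
    ← Finset.sum_add_distrib]
  rcases j with j | j
  · have := hconf.c_succ n j
    simp only [Sum.swap_inl, Sum.elim_inl, Sum.elim_inr, this]
    ring
  · have := hconf.b_succ n j
    simp only [Sum.swap_inr, Sum.elim_inl, Sum.elim_inr, this]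
    ring

theorem Confined.mem_zeros_succ (hconf : Confined q) (n : ℤ) (α : ℂ) :
    α ∈ Set.range (zeros (q (n + 1))) ↔ -α ∈ Set.range (zeros (q n)) := by
  constructor
  · rintro ⟨i, rfl⟩
    exact ⟨i.swap, by rw [← neg_neg (zeros (q n) _), ← hconf.zeros_succ, Sum.swap_swap]⟩
  · rintro ⟨i, hi⟩
    exact ⟨i.swap, by rw [hconf.zeros_succ, hi, neg_neg]⟩

theorem Confined.mem_poles_succ (hconf : Confined q) (n : ℤ) (γ : ℂ) : γ ∈ Set.range (poles (q (n + 1))) ↔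
    (∑ j, poles (q n) j - ∑ i, zeros (q n) i) - γ ∈ Set.range (poles (q (n - 1))) := by
  constructor
  · rintro ⟨j, rfl⟩
    exact ⟨j.swap, by rw [← hconf.poles_succ n j.swap, Sum.swap_swap, add_sub_cancel_right]⟩
  · rintro ⟨j, hj⟩
    refine ⟨j.swap, ?_⟩
    have := hconf.poles_succ n j
    rw [hj] at this
    linear_combination this

theorem mem_surface_iff (n : ℤ) {R : LocalSubring K} : R ∈ surface q n ↔ OnBlowUp x y
    (fibCenters (Set.range (zeros (q n))) (Set.range (poles (q n)))
      (Set.range (poles (q (n - 1))))) R := by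
  rw [mem_blowUp_iff, centers, range_center]

/-- The points of `X_n` and of `X_{n+1}` correspond to each other under `φ_n`: this is where the
confinement conditions enter, as they say that the involution over `ℂ(x)` maps the centres on `X_n`
to those on `X_{n+1}`, up to the exchange of the coordinates. -/
theorem pullSub_mem_surface_iff (hdist : ∀ n, (q n).Distinct) (hconf : Confined q) (n : ℤ)
    {φ : K ≃ₐ[ℂ] K}
    (hφx : φ x = xBar (q n)) (hφy : φ y = x) {R : LocalSubring K} :
    pullSub φ R ∈ surface q (n + 1) ↔ R ∈ surface q n := by
  have hcard : Fintype.card (Fin (m + 1) ⊕ Fin (m + 1)) = Fintype.card (Fin m ⊕ Fin m) + 2 := by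
    simp only [Fintype.card_sum, Fintype.card_fin]; ring
  have h := conjugate_xBar (q n)
  rw [mem_surface_iff, onBlowUp_pullSub, hφx, hφy, ← onBlowUp_swap_iff,
    swap_preimage_fibCenters (hconf.mem_zeros_succ n), mem_surface_iff, add_sub_cancel_right]
  constructor
  · refine h.symm.transform (hdist n).injective hcard fun γ => ?_
    rw [hconf.mem_poles_succ, sub_sub_cancel]
  · exact h.transform (hdist n).injective hcard (hconf.mem_poles_succ n)

end Lift

/-! ### The action on the Picard group -/

section PicardAction

variable {m : ℕ}

theorem ofMul_mk_eq_sub {X : Set (LocalSubring K)} {D E F : CaDiv X} {g : Kˣ}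
    (h : D * E = F * principal X g) :
    Additive.ofMul (Pic.mk E) = Additive.ofMul (Pic.mk F) - Additive.ofMul (Pic.mk D) := by
  have hg : Pic.mk (principal X g) = 1 := (QuotientGroup.eq_one_iff _).2 ⟨g, rfl⟩
  rw [eq_sub_iff_add_eq, ← ofMul_mul, ← map_mul, mul_comm, h, map_mul, hg, mul_one]

theorem iota_Hx (q : ℤ → Params m) (n : ℤ) :
    iota q n Hx = Additive.ofMul (Pic.mk (pullX (centers q n))) := by
  rw [iota, Finsupp.linearCombination_single, one_smul]
  rfl

theorem iota_Hy (q : ℤ → Params m) (n : ℤ) :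
    iota q n Hy = Additive.ofMul (Pic.mk (pullY (centers q n))) := by
  rw [iota, Finsupp.linearCombination_single, one_smul]
  rfl

theorem iota_exc (q : ℤ → Params m) (n : ℤ) (p : Center m) :
    iota q n (Finsupp.single (.exc p) 1) =
      Additive.ofMul (Pic.mk (excDiv (Z := centers q n) (Set.mem_range_self p))) := by
  rw [iota, Finsupp.linearCombination_single, one_smul]

variable {q : ℤ → Params m} {φ : K ≃ₐ[ℂ] K}

/-- The action on the Picard group, read off on the generators. -/
theorem pullback_iota (hdist : ∀ n, (q n).Distinct) (hconf : Confined q) {n : ℤ}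
    (hφx : φ x = xBar (q n)) (hφy : φ y = x)
    (hφ : ∀ R ∈ surface q n, pullSub φ R ∈ surface q (n + 1)) (v : PicLattice m) :
    (homOfPull φ hφ).pullback (iota q (n + 1) v).toMul = (iota q n (Phi v)).toMul := by
  have hcard : Fintype.card (Fin (m + 1) ⊕ Fin (m + 1)) = Fintype.card (Fin m ⊕ Fin m) + 2 := by
    simp only [Fintype.card_sum, Fintype.card_fin]; ring
  have h := conjugate_xBar (q n)
  have hab := (hdist n).injective
  have hZ := range_center (q (n - 1)) (q n)
  set f := homOfPull φ hφ
  have hmk : ∀ D, f.pullback (Pic.mk D) = Pic.mk (f.pullbackDiv D) := fun _ => rfl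
  -- the exceptional curves over the points `(-α, α)`, `(∞, β)` and `(γ, ∞)` of `ℙ¹ × ℙ¹`
  have hzero : ∀ (i : Fin (m + 1) ⊕ Fin (m + 1)) (p p' : Center m),
      center (q (n - 1)) (q n) p = (some (zeros (q n) i), some (-zeros (q n) i)) →
      center (q (n + 1 - 1)) (q (n + 1)) p' = (some (-zeros (q n) i), some (zeros (q n) i)) →
      Additive.ofMul (f.pullback (iota q (n + 1) (Finsupp.single (.exc p') 1)).toMul) =
        iota q n (Hx - Finsupp.single (.exc p) 1) := by
    intro i p p' e e'
    rw [iota_exc, toMul_ofMul, hmk, map_sub, iota_Hx, iota_exc]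
    exact ofMul_mk_eq_sub (exc_mul_pull_zero hφ hZ hab h hφx hφy i _ _ e e')
  have hpole : ∀ (j : Fin m ⊕ Fin m) (p p' : Center m),
      center (q (n - 1)) (q n) p = (some (poles (q n) j), none) →
      center (q (n + 1 - 1)) (q (n + 1)) p' = (none, some (poles (q n) j)) →
      Additive.ofMul (f.pullback (iota q (n + 1) (Finsupp.single (.exc p') 1)).toMul) =
        iota q n (Hx - Finsupp.single (.exc p) 1) := by
    intro j p p' e e'
    rw [iota_exc, toMul_ofMul, hmk, map_sub, iota_Hx, iota_exc]
    exact ofMul_mk_eq_sub (exc_mul_pull_pole hφ hZ hab h hφx hφy j _ _ e e')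
  have hinf : ∀ (j : Fin m ⊕ Fin m) (p p' : Center m),
      center (q (n - 1)) (q n) p = (none, some (poles (q (n - 1)) j)) →
      center (q (n + 1 - 1)) (q (n + 1)) p' = (some (poles (q (n + 1)) j.swap), none) →
      Additive.ofMul (f.pullback (iota q (n + 1) (Finsupp.single (.exc p') 1)).toMul) =
        iota q n (Finsupp.single (.exc p) 1) := by
    intro j p p' e e'
    rw [iota_exc, toMul_ofMul, hmk, iota_exc]
    exact congrArg (fun D => Additive.ofMul (Pic.mk D))
      (pull_exc_infinity hφ hcard h hφx hφy (hconf.poles_succ n j) _ _ e e')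
  have key : ∀ g : Gen m, Additive.ofMul (f.pullback (iota q (n + 1) (Finsupp.single g 1)).toMul) =
      iota q n (Phi (Finsupp.single g 1)) := by
    intro g
    rw [phi_single]
    rcases g with _ | _ | (i | i | j | j | j | j)
    · obtain ⟨g, hg⟩ := pull_pullX hφ hZ hab hcard h hφx
        (p := fun i => center (q (n - 1)) (q n) (Sum.elim .A .E i))
        (r := fun j => center (q (n - 1)) (q n) (Sum.elim .Bt .Ct j))
        (fun _ => Set.mem_range_self _) (fun _ => Set.mem_range_self _)
        (by rintro (i | i) <;> rfl) (by rintro (j | j) <;> rfl)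
      rw [mul_comm] at hg
      have hH := ofMul_mk_eq_sub hg
      simp only [Fintype.prod_sum_type, Sum.elim_inl, Sum.elim_inr, map_mul, map_prod, map_pow,
        ofMul_mul, ofMul_prod, ofMul_pow] at hH
      simp only [map_sub, map_add, map_sum, map_smul, iota_Hx, iota_Hy, iota_exc, toMul_ofMul, hmk]
      refine hH.trans ?_
      rw [← natCast_zsmul]
      simp only [Fintype.card_sum, Fintype.card_fin]
      push_cast
      rw [← two_mul]
      abel
    · rw [iota_Hy, toMul_ofMul, hmk, pull_pullY hφ hφy]
      exact (iota_Hx q n).symm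
    · exact hzero (.inr i) _ _ rfl (by simp [center, zeros, hconf.a_succ]; rfl)
    · exact hzero (.inl i) _ _ rfl (by simp [center, zeros, hconf.d_succ]; rfl)
    · exact hpole (.inl j) _ _ rfl (by rw [add_sub_cancel_right]; rfl)
    · exact hpole (.inr j) _ _ rfl (by rw [add_sub_cancel_right]; rfl)
    · exact hinf (.inr j) _ _ rfl rfl
    · exact hinf (.inl j) _ _ rfl rfl
  have hlin : (MonoidHom.toAdditive f.pullback).toIntLinearMap ∘ₗ iota q (n + 1) =
      iota q n ∘ₗ Phi := Finsupp.lhom_ext' fun g => LinearMap.ext_ring (key g)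
  exact congrArg Additive.toMul (LinearMap.congr_fun hlin v)

end PicardAction

end ClassIII

end

theorem proposition3 (m : ℕ) (hm : 1 ≤ m) (q : ℤ → ClassIII.Params m)
    (hdist : ∀ n, (q n).Distinct) (hconf : ClassIII.Confined q) :
    -- `Φ` is a lattice automorphism of `Pic(𝒳)`
    (Function.Bijective (ClassIII.Phi (m := m)) ∧
      ∀ v w : ClassIII.PicLattice m,
        ClassIII.intersection (ClassIII.Phi v) (ClassIII.Phi w) = ClassIII.intersection v w) ∧
    ∀ n : ℤ,
      -- `X_n` is the blow-up at `6m + 2` distinct points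
      (ClassIII.centers q n).ncard = 6 * m + 2 ∧
      -- `ι_n` identifies `Pic(𝒳)` with `Pic(X_n)`
      Function.Bijective (ClassIII.iota q n) ∧
      -- `φ` is the pullback of rational functions by the birational mapping `φ_n`
      ∃ φ : ClassIII.K ≃ₐ[ℂ] ClassIII.K,
        φ ClassIII.x = ClassIII.xBar (q n) ∧ φ ClassIII.y = ClassIII.x ∧
        -- `φ_n` lifts to an isomorphism `f : X_n ⟶ X_{n+1}` with `f^* ∘ ι_{n+1} = ι_n ∘ Φ`
        ∃ f : ClassIII.Hom (φ : ClassIII.K →ₐ[ℂ] ClassIII.K)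
            (ClassIII.surface q n) (ClassIII.surface q (n + 1)),
          f.IsIso ∧
          ∀ v : ClassIII.PicLattice m,
            f.pullback (ClassIII.iota q (n + 1) v).toMul =
              (ClassIII.iota q n (ClassIII.Phi v)).toMul := by
  refine ⟨⟨ClassIII.phi_bijective, ClassIII.intersection_phi⟩, fun n =>
    ⟨ClassIII.ncard_centers hdist n, ClassIII.iota_bijective hdist n, ?_⟩⟩
  have h := ClassIII.isPlane_xBar (q n)
  have hiff {R} := ClassIII.pullSub_mem_surface_iff hdist hconf n h.equiv_x h.equiv_y (R := R)
  exact ⟨h.equiv, h.equiv_x, h.equiv_y,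
    ClassIII.homOfPull h.equiv fun _ hR => hiff.2 hR,
    ClassIII.homOfPull_isIso _ _ fun R hR => hiff.1 (by rwa [ClassIII.pullSub_pullSub_symm]),
    ClassIII.pullback_iota hdist hconf h.equiv_x h.equiv_y _⟩
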